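/- Graphs are finite and may have loops and parallel edges. A cut-vertex of a graph is a vertex $w$ such that the edge set can be partitioned into two non-empty parts having only $w$ as a common vertex; a block is a maximal connected subgraph with no cut-vertex of its own (so every loop is a block), and an end-block is a block containing at most one cut-vertex of the graph. A path graph is a connected graph whose blocks–cut-vertices graph is a path. $M(H)$ is the cycle matroid of $H$. For a signed graph $\Omega$ (edges labelled $\pm1$, a cycle being balanced if it has an even number of edges labelled $-1$), $F(\Omega)$ is its frame matroid, whose circuits are the balanced cycles, the tight and loose handcuffs formed by unbalanced cycles, and the theta subgraphs with all cycles unbalanced. For $\delta:V\to\{\pm1\}$, the switching $\delta(\Omega)$ relabels every edge by the product of its label and the labels $\delta$ of its ends. Two graphs are 2-isomorphic if one arises from the other by Whitney flips, identifications of two vertices from distinct components, and partitions into blocks. For a path graph $H'$ with vertices $a_1,a_2$, and a path graph $H$ with vertices $b_1,b_2$, we say that $H$ is 2-isomorphic to $H'$ with $a_1a_2$-paths changed to $b_1b_2$-paths if, after adding a new edge $e$ joining $a_1,a_2$ to $H'$ and $e$ joining $b_1,b_2$ to $H$, the two resulting graphs are 2-isomorphic. **Lemma.** Let $\Omega$ be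 a signed graph whose underlying graph $\Gamma$ is connected, such that a block is unbalanced if and only if it is an end-block. Let $B_1,\dots,B_k$ be all the end-blocks, and suppose that each $B_i$ has a vertex $v_i$ such that $B_i\setminus v_i$ is balanced and $v_i$ is a cut-vertex of $\Gamma$ separating $B_i$ from all other unbalanced blocks. Then: (1) There is a switching $\delta(\Omega)$ such that every edge labelled $-1$ in $\delta(\Omega)$ is in some $B_i$ and incident with $v_i$. Moreover, for every $\delta$ as in (1) the following hold. (2) For each $i$ there is a path graph $H_i'$ with distinct vertices $v_{i1}',v_{i2}'$ such that $B_i$, with its labels in $\delta(\Omega)$, is obtained from $H_i'$ by identifying $v_{i1}'$ and $v_{i2}'$ to $v_i$, with all edges originally incident with $v_{i1}'$ labelled $-1$ and all other edges labelled $1$; and $F(B_i)=M(H_i')$. (3) Let path graphs $H_i'$ as described in (2) be given, and for each $i$ let $H_i$ be a path graph 2-isomorphic to $H_i'$ with $v_{i1}'v_{i2}'$-paths changed to $v_{i1}v_{i2}$-paths. Let $\Gamma'$ be obtained from $\Gamma$ by deleting all $B_i$ except for the vertices $v_i$, and let $H$ be obtained from $\Gamma'$ by adding a new vertex $v$ and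 then adding $H_1,\dots,H_k$, identifying $v_{i2}$ with $v_i$ for each $i$, and $v_{11},\dots,v_{k1}$ with $v$. Then $F(\Omega)=M(H)$. (4) If the vertices $v_1,\dots,v_k$ are not all equal, and $H$ is the graph of (3) for the choice $H_i=H_i'$, $v_{ij}=v_{ij}'$, then $\delta(\Omega)$ is a curling of $H$. That is: $H$ is 2-connected, and there are distinct vertices $w_1,\dots,w_m$ of $H$ different from a vertex $v$, and edge-disjoint connected subgraphs $K_1,\dots,K_m$ of $H$ such that $K_j$ has exactly the vertices $v,w_j$ in common with the subgraph formed by the edges outside $K_j$, every edge incident with $v$ is in some $K_j$, and $\delta(\Omega)$ is, up to the names of the vertices, obtained from $H$ by labelling the edges incident with $v$ by $-1$ and all others by $1$, replacing each edge $uv$ of $K_j$ by an edge $uw_j$ (a loop if $u=w_j$), and removing $v$. -/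

import Mathlib

open scoped Graph

/-! Graphs are Mathlib's multigraphs `Graph α β`: loops and parallel edges are allowed. -/

namespace Graph

variable {α β γ κ : Type*}

/-- Connected graphs (with at least one vertex). -/
def Connected (G : Graph α β) : Prop :=
  V(G).Nonempty ∧ ∀ x ∈ V(G), ∀ y ∈ V(G), Relation.ReflTransGen G.Adj x y

/-- The vertices of the subgraph `G|X` formed by a set `X` of edges and their ends. -/
def vertsOf (G : Graph α β) (X : Set β) : Set α := {x | ∃ e ∈ X, G.Inc e x}

/-- The vertex `w` is a cut-vertex of `G` which separates the edge set `A` from the edge set `B`: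
the edges of `G` are divided into two nonempty parts, one containing `A`, the other containing `B`,
and `w` is the only vertex that the parts have in common. -/
def Separates (G : Graph α β) (w : α) (A B : Set β) : Prop :=
  ∃ X Y : Set β, A ⊆ X ∧ B ⊆ Y ∧ X.Nonempty ∧ Y.Nonempty ∧ Disjoint X Y ∧ X ∪ Y = E(G) ∧
    G.vertsOf X ∩ G.vertsOf Y = {w}

/-- Cut-vertices. For a graph without loops, this says that deleting `w` increases the number of
components. A vertex incident with a loop and with some other edge is a cut-vertex too, so that
each loop is a block. -/
def IsCutVertex (G : Graph α β) (w : α) : Prop := G.Separates w ∅ ∅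

/-- A block is a maximal connected subgraph without a cut-vertex (of its own). -/
def IsBlock (G B : Graph α β) : Prop :=
  Maximal (fun K : Graph α β => K ≤ G ∧ K.Connected ∧ ∀ w, ¬ K.IsCutVertex w) B

/-- An end-block is a block containing at most one cut-vertex of the whole graph. -/
def IsEndBlock (G B : Graph α β) : Prop :=
  G.IsBlock B ∧ {w | G.IsCutVertex w ∧ w ∈ V(B)}.Subsingleton

/-- Components. -/
def IsComponent (G K : Graph α β) : Prop :=
  Maximal (fun K : Graph α β => K ≤ G ∧ K.Connected) K

/-- 2-connected graphs. -/
def TwoConnected (G : Graph α β) : Prop :=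
  G.Connected ∧ 2 < V(G).encard ∧ ∀ w, ¬ G.IsCutVertex w

/-- The blocks-cut-vertices graph. -/
def blockCutGraph (G : Graph α β) :
    SimpleGraph ({B : Graph α β // G.IsBlock B} ⊕ {w : α // G.IsCutVertex w}) :=
  SimpleGraph.fromRel fun a b => ∃ B w, a = Sum.inl B ∧ b = Sum.inr w ∧ w.1 ∈ V(B.1)

/-- A path graph is a connected graph whose blocks-cut-vertices graph is a path. -/
def IsPathGraph (G : Graph α β) : Prop :=
  G.Connected ∧ ∃ n : ℕ, Nonempty (G.blockCutGraph ≃g SimpleGraph.pathGraph n)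

/-- `C` is the edge set of a cycle of `G`: there are distinct vertices `x 0, …, x n` and distinct
edges `e 0, …, e n` such that `e i` joins `x i` and `x (i + 1)`, indices being read cyclically.
Loops are the cycles with `n = 0`. -/
def IsCycleSet (G : Graph α β) (C : Set β) : Prop :=
  ∃ (n : ℕ) (x : Fin (n + 1) → α) (e : Fin (n + 1) → β), x.Injective ∧ e.Injective ∧
    (∀ i, G.IsLink (e i) (x i) (x (i + 1))) ∧ Set.range e = C

/-- `P` is the edge set of a path of `G` from `a` to `b`. -/
def IsPathSet (G : Graph α β) (P : Set β) (a b : α) : Prop :=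
  ∃ (n : ℕ) (x : Fin (n + 1) → α) (e : Fin n → β), x.Injective ∧
    (∀ i, G.IsLink (e i) (x i.castSucc) (x i.succ)) ∧ Set.range e = P ∧
    x 0 = a ∧ x (Fin.last n) = b

/-- The circuits of the frame matroid of the biased graph with underlying graph `G` and set `𝓑` of
(edge sets of) balanced cycles: balanced cycles, tight handcuffs and loose handcuffs formed by
unbalanced cycles, and theta graphs all of whose cycles are unbalanced. -/
def IsFrameCircuit (G : Graph α β) (𝓑 : Set (Set β)) (C : Set β) : Prop :=
  (G.IsCycleSet C ∧ C ∈ 𝓑) ∨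
  (∃ C₁ C₂ u, G.IsCycleSet C₁ ∧ C₁ ∉ 𝓑 ∧ G.IsCycleSet C₂ ∧ C₂ ∉ 𝓑 ∧ Disjoint C₁ C₂ ∧
    G.vertsOf C₁ ∩ G.vertsOf C₂ = {u} ∧ C = C₁ ∪ C₂) ∨
  (∃ C₁ C₂ P u₁ u₂, G.IsCycleSet C₁ ∧ C₁ ∉ 𝓑 ∧ G.IsCycleSet C₂ ∧ C₂ ∉ 𝓑 ∧
    Disjoint (G.vertsOf C₁) (G.vertsOf C₂) ∧ G.IsPathSet P u₁ u₂ ∧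
    G.vertsOf P ∩ G.vertsOf C₁ = {u₁} ∧ G.vertsOf P ∩ G.vertsOf C₂ = {u₂} ∧
    C = C₁ ∪ C₂ ∪ P) ∨
  (∃ P₁ P₂ P₃ x y, x ≠ y ∧ G.IsPathSet P₁ x y ∧ G.IsPathSet P₂ x y ∧ G.IsPathSet P₃ x y ∧
    Disjoint P₁ P₂ ∧ Disjoint P₁ P₃ ∧ Disjoint P₂ P₃ ∧
    G.vertsOf P₁ ∩ G.vertsOf P₂ = {x, y} ∧ G.vertsOf P₁ ∩ G.vertsOf P₃ = {x, y} ∧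
    G.vertsOf P₂ ∩ G.vertsOf P₃ = {x, y} ∧ C = P₁ ∪ P₂ ∪ P₃ ∧
    ∀ D ⊆ C, G.IsCycleSet D → D ∉ 𝓑)

/-- `M` is the frame matroid of the biased graph `(G, 𝓑)`. -/
def IsFrameMatroid (G : Graph α β) (𝓑 : Set (Set β)) (M : Matroid β) : Prop :=
  M.E = E(G) ∧ ∀ C, M.IsCircuit C ↔ G.IsFrameCircuit 𝓑 C

/-- `M` is the cycle matroid of `G`. -/
def IsCycleMatroid (G : Graph α β) (M : Matroid β) : Prop :=
  M.E = E(G) ∧ ∀ C, M.IsCircuit C ↔ G.IsCycleSet C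

/-- `H` arises from `G` by a Whitney flip on `{u₁, u₂}`: on the part `X₁` of the edge set, the
vertices `u₁` and `u₂` are exchanged. -/
def IsWhitneyFlip (G H : Graph α β) : Prop :=
  open Classical in
  ∃ (X₁ X₂ : Set β) (u₁ u₂ : α), u₁ ≠ u₂ ∧ Disjoint X₁ X₂ ∧ X₁ ∪ X₂ = E(G) ∧
    G.vertsOf X₁ ∩ G.vertsOf X₂ = {u₁, u₂} ∧ V(H) = V(G) ∧
    ∀ e x y, H.IsLink e x y ↔ (e ∈ X₂ ∧ G.IsLink e x y) ∨
      (e ∈ X₁ ∧ G.IsLink e (Equiv.swap u₁ u₂ x) (Equiv.swap u₁ u₂ y))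

/-- `H` arises from `G` by identifying two vertices from distinct components. -/
def IsComponentIdentification (G H : Graph α β) : Prop :=
  open Classical in
  ∃ x ∈ V(G), ∃ y ∈ V(G), ¬ Relation.ReflTransGen G.Adj x y ∧
    H = G.map (Function.update id y x)

/-- `H` is the partition of `G` into its blocks: the components of `H` are disjoint copies of the
blocks of `G`, one for each block. -/
def IsBlockPartition (G H : Graph α β) : Prop :=
  ∃ f : α → α, H.map f = G ∧
    (∀ K, H.IsComponent K → Set.InjOn f V(K) ∧ G.IsBlock (K.map f)) ∧
    (∀ K L, H.IsComponent K → H.IsComponent L → K.map f = L.map f → K = L)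

/-- 2-isomorphic graphs: one arises from the other by a sequence of Whitney flips, identifications
of two vertices from distinct components, and partitions into blocks. The names of the vertices are
immaterial; the edges keep their names. -/
def TwoIsomorphic (G H : Graph α β) : Prop :=
  Relation.ReflTransGen (fun G H : Graph α β =>
    (∃ f : α → α, Set.InjOn f V(G) ∧ H = G.map f) ∨ G.IsWhitneyFlip H ∨
      G.IsComponentIdentification H ∨ G.IsBlockPartition H) G H

/-- `G` with a new edge `none` joining `p` and `q`. -/
def addNewEdge (G : Graph α β) (p q : α) : Graph α (Option β) where
  vertexSet := V(G) ∪ {p, q}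
  IsLink e x y := (∃ f, e = some f ∧ G.IsLink f x y) ∨ (e = none ∧ s(x, y) = s(p, q))
  isLink_symm := by
    intro e _
    constructor
    rintro x y (⟨f, rfl, h⟩ | ⟨rfl, h⟩)
    · exact Or.inl ⟨f, rfl, h.symm⟩
    · exact Or.inr ⟨rfl, by rw [Sym2.eq_swap, h]⟩
  eq_or_eq_of_isLink_of_isLink := by
    rintro e x y z w (⟨f, rfl, h⟩ | ⟨rfl, h⟩) (⟨g, hg, h'⟩ | ⟨hg, h'⟩)
    · obtain rfl : f = g := by simpa using hg
      exact G.eq_or_eq_of_isLink_of_isLink h h'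
    · simp at hg
    · simp at hg
    · rw [← h'] at h
      rcases Sym2.eq_iff.1 h with ⟨h, -⟩ | ⟨h, -⟩
      · exact Or.inl h
      · exact Or.inr h
  left_mem_of_isLink := by
    rintro e x y (⟨f, rfl, h⟩ | ⟨rfl, h⟩)
    · exact Or.inl h.left_mem
    · rcases Sym2.eq_iff.1 h with ⟨h, -⟩ | ⟨h, -⟩ <;> simp [h]

/-- `H` is a path graph 2-isomorphic to the path graph `G` with the paths of `G` between `a₁` and
`a₂` changed to paths of `H` between `b₁` and `b₂`: after adding a new edge joining `a₁` and `a₂`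
to `G`, and adding the same edge to `H` with ends `b₁` and `b₂`, the two graphs are 2-isomorphic. -/
def PathTwoIsomorphic (G : Graph α β) (a₁ a₂ : α) (H : Graph α β) (b₁ b₂ : α) : Prop :=
  H.IsPathGraph ∧ b₁ ∈ V(H) ∧ b₂ ∈ V(H) ∧
    (G.addNewEdge a₁ a₂).TwoIsomorphic (H.addNewEdge b₁ b₂)

/-- The name, in the glued graph below, of the vertex `y` of the `i`-th piece: `p i` becomes the
new vertex `none`, `q i` becomes the old vertex `v i`, the other vertices stay separate. -/
noncomputable def glueVertex (v : κ → α) (p q : κ → γ) (i : κ) (y : γ) : Option (α ⊕ κ × γ) :=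
  open Classical in
  if y = p i then none else if y = q i then some (Sum.inl (v i)) else some (Sum.inr (i, y))

/-- `H` is the graph obtained from `G` by adding a new vertex `none`, and then adding all the
graphs `K i`, identifying `q i` with `v i` and all the `p i` with the new vertex. -/
def IsGluing (G : Graph α β) (v : κ → α) (K : κ → Graph γ β) (p q : κ → γ)
    (H : Graph (Option (α ⊕ κ × γ)) β) : Prop :=
  V(H) = {none} ∪ (fun x => some (Sum.inl x)) '' V(G) ∪ (⋃ i, glueVertex v p q i '' V(K i)) ∧
  ∀ e x y, H.IsLink e x y ↔
    (∃ a b, G.IsLink e a b ∧ x = some (Sum.inl a) ∧ y = some (Sum.inl b)) ∨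
    (∃ i a b, (K i).IsLink e a b ∧ x = glueVertex v p q i a ∧ y = glueVertex v p q i b)

/-- What remains of `G` after deleting the pieces `B i`, except for their vertices `v i`. -/
def remainder (G : Graph α β) (B : κ → Graph α β) (v : κ → α) : Graph α β :=
  (G.deleteEdges (⋃ i, E(B i))).deleteVerts (⋃ i, V(B i) \ {v i})

end Graph

/-- A signed graph: a graph with labels `1` and `-1` on its edges. -/
structure SignedGraph (α β : Type*) where
  /-- The underlying graph. -/
  graph : Graph α β
  /-- The labels (only those of edges of the graph matter). -/
  sign : β → ℤˣ

namespace SignedGraph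

variable {α β γ : Type*}

/-- The balanced cycles: those with an even number of edges labelled `-1`. -/
def balancedCycles (Ω : SignedGraph α β) : Set (Set β) :=
  {C | Ω.graph.IsCycleSet C ∧ Even {e ∈ C | Ω.sign e = -1}.ncard}

/-- A signed graph is balanced if all its cycles are. -/
def IsBalanced (Ω : SignedGraph α β) : Prop :=
  ∀ C, Ω.graph.IsCycleSet C → C ∈ Ω.balancedCycles

/-- The subgraph `K` with the labels of `Ω`. -/
def on (Ω : SignedGraph α β) (K : Graph α β) : SignedGraph α β := ⟨K, Ω.sign⟩

/-- Switching: each edge is relabelled by the product of its label and the labels of its ends. -/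
noncomputable def switch (Ω : SignedGraph α β) (δ : α → ℤˣ) : SignedGraph α β where
  graph := Ω.graph
  sign e := open Classical in
    if h : ∃ p : α × α, Ω.graph.IsLink e p.1 p.2 then δ h.choose.1 * Ω.sign e * δ h.choose.2
    else Ω.sign e

theorem switch_sign {Ω : SignedGraph α β} {δ : α → ℤˣ} {e : β} {x y : α}
    (h : Ω.graph.IsLink e x y) : (Ω.switch δ).sign e = δ x * Ω.sign e * δ y := by
  have h' : ∃ p : α × α, Ω.graph.IsLink e p.1 p.2 := ⟨(x, y), h⟩
  have hc := h'.choose_spec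
  simp only [switch, dif_pos h']
  rcases (h.eq_and_eq_or_eq_and_eq hc) with ⟨h1, h2⟩ | ⟨h1, h2⟩
  · rw [← h1, ← h2]
  · rw [← h1, ← h2, mul_right_comm, mul_comm (δ y), mul_right_comm]

/-- The frame matroid of `Ω` equals the cycle matroid of `H`. -/
def FrameEqCycle (Ω : SignedGraph α β) (H : Graph γ β) : Prop :=
  ∃ M : Matroid β, Ω.graph.IsFrameMatroid Ω.balancedCycles M ∧ H.IsCycleMatroid M

/-- `Ω` is obtained from the graph `H` by identifying its distinct vertices `p` and `q` to `v`,
where the edges incident with `p` get the label `-1` and all other edges get the label `1`. -/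
def IsPinch (Ω : SignedGraph α β) (v : α) (H : Graph γ β) (p q : γ) : Prop :=
  p ∈ V(H) ∧ q ∈ V(H) ∧ p ≠ q ∧
  (∃ f : γ → α, f p = v ∧ f q = v ∧ Set.InjOn f (V(H) \ {p}) ∧ Ω.graph = H.map f) ∧
  ∀ e ∈ E(H), Ω.sign e = -1 ↔ H.Inc e p

/-- `Ω` is a curling of `H`, with its labels. The map `φ` identifies the vertices of `Ω` with the
vertices of `H` other than `v`. -/
def IsCurling (Ω : SignedGraph α β) (H : Graph γ β) : Prop :=
  H.TwoConnected ∧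
  ∃ v ∈ V(H), ∃ (k : ℕ) (w : Fin k → γ) (K : Fin k → Graph γ β), w.Injective ∧
    (∀ i, w i ≠ v) ∧
    (∀ i, K i ≤ H ∧ (K i).Connected ∧ V(K i) ∩ H.vertsOf (E(H) \ E(K i)) = {v, w i}) ∧
    (∀ i j, i ≠ j → Disjoint E(K i) E(K j)) ∧
    (∀ e, H.Inc e v → ∃ i, e ∈ E(K i)) ∧
    (∀ e ∈ E(H), Ω.sign e = -1 ↔ H.Inc e v) ∧
    ∃ φ : α → γ, Set.BijOn φ V(Ω.graph) (V(H) \ {v}) ∧ E(Ω.graph) = E(H) ∧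
      ∀ e, ∀ x ∈ V(Ω.graph), ∀ y ∈ V(Ω.graph), Ω.graph.IsLink e x y ↔
        H.IsLink e (φ x) (φ y) ∨
        ∃ i, e ∈ E(K i) ∧ ((H.IsLink e v (φ x) ∧ φ y = w i) ∨ (H.IsLink e v (φ y) ∧ φ x = w i))

end SignedGraph

/-! Everything is reduced to linear algebra over `ℚ`. Orient the edges and give an edge from `x` to
`y` with sign `s` the coboundary `h x - s • h y` of a function `h` on the vertices. A finite edge
set is called free if coboundaries take arbitrary values on it, which means that its columns in the
signed incidence matrix are independent. Frame circuits are exactly the minimal non-free sets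
(`isFrameCircuit_iff`): a component without unbalanced cycles carries a nonvanishing kernel
function, while an unbalanced cycle forces every kernel function to vanish on it. The cycle matroid
of a graph is the case of positive labels. Hence `F(Ω) = M(H)` holds as soon as the two incidence
matrices have the same row space up to nonzero scaling of the columns (`frameEqCycle_of_cobound`).

The signed labels are chosen by a potential on the edges that need not be negative. A cycle of such
edges lies in one block, and there it is balanced, either because the block is or because the cycle
avoids `v i` in `B i`.

For one pinched block, with `p` and `q` identified to `v`, a function `h` on the signed graph
corresponds to the function on the unpinched graph which is `0` at `p` and `h (f y) + h v` at every
other vertex `y`. Negative edges become edges at `p`, and `q` gets the value `2 * h v`. Outside the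
blocks `B i` one takes `2 * h`, so all values agree after gluing, with `0` at the new vertex.
Whitney flips, identifications and block partitions preserve row spaces up to scaling. Applied with
the extra edge joining the two terminals, this shows that a piece may be replaced by a 2-isomorphic
one while the potential difference between the terminals is retained
(`PathTwoIsomorphic.exists_potentials`).

An unpinched block is a path graph because any separation of it at one vertex must separate `p` from
`q`; otherwise the pinched block would have a cut-vertex. This orders the cut-vertices linearly
(`isPathGraph_of_strictSep`).

For the curling statement the glued graph is 2-connected: a separation that cuts no piece descends
to `Ω`, where each side contains an end-block, so the new vertex is on both sides; a separation that
cuts a piece contradicts the nonseparability of that block or the connectivity of `Ω`. Pieces with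
the same `v i` are united to give the subgraphs required of a curling. -/

namespace Graph

variable {α β γ : Type*} {G : Graph α β} {a b c x y : α} {S T : Set α} {P Q D : Set β} {e f : β}

/-! ### Paths -/

/-- `G.IsPathOn a b S P`: there is a path from `a` to `b` with vertex set `S` and edge set `P`. -/
inductive IsPathOn (G : Graph α β) (a : α) : α → Set α → Set β → Prop
  | nil : IsPathOn G a a {a} ∅
  | snoc {b c : α} {S : Set α} {P : Set β} {e : β} : IsPathOn G a b S P → G.IsLink e b c → c ∉ S →
      IsPathOn G a c (insert c S) (insert e P)

namespace IsPathOn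

theorem left_mem (h : G.IsPathOn a b S P) : a ∈ S := by
  induction h with
  | nil => rfl
  | snoc _ _ _ ih => exact Or.inr ih

theorem right_mem (h : G.IsPathOn a b S P) : b ∈ S := by
  cases h with
  | nil => rfl
  | snoc => exact Or.inl rfl

theorem edge_subset (h : G.IsPathOn a b S P) : P ⊆ E(G) := by
  induction h with
  | nil => simp
  | snoc _ he _ ih => exact Set.insert_subset he.edge_mem ih

theorem inc_mem (h : G.IsPathOn a b S P) (he : e ∈ P) (hx : G.Inc e x) : x ∈ S := by
  induction h with
  | nil => simp at he
  | snoc h hl _ ih =>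
    rcases he with rfl | he
    · rcases hx.eq_or_eq_of_isLink hl with rfl | rfl
      · exact Or.inr h.right_mem
      · exact Or.inl rfl
    · exact Or.inr (ih he)

theorem notMem_of_inc (h : G.IsPathOn a b S P) (hx : G.Inc e x) (hxS : x ∉ S) : e ∉ P :=
  fun he => hxS (h.inc_mem he hx)

theorem finite (h : G.IsPathOn a b S P) : S.Finite ∧ P.Finite := by
  induction h with
  | nil => simp
  | snoc _ _ _ ih => exact ⟨ih.1.insert _, ih.2.insert _⟩

theorem ncard_eq (h : G.IsPathOn a b S P) : S.ncard = P.ncard + 1 := by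
  induction h with
  | nil => simp
  | snoc h hl hc ih =>
    rw [Set.ncard_insert_of_notMem hc h.finite.1,
      Set.ncard_insert_of_notMem (h.notMem_of_inc hl.inc_right hc) h.finite.2, ih]

theorem exists_isLink_ne (h : G.IsPathOn a b S P) (he : e ∈ P) :
    ∃ x y, x ≠ y ∧ G.IsLink e x y := by
  induction h with
  | nil => simp at he
  | snoc h hl hc ih =>
    rcases he with rfl | he
    · exact ⟨_, _, fun hh => hc (by rw [← hh]; exact h.right_mem), hl⟩
    · exact ih he

theorem vertsOf_subset (h : G.IsPathOn a b S P) : G.vertsOf P ⊆ S := by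
  rintro x ⟨e, he, hx⟩
  exact h.inc_mem he hx

theorem vertsOf_eq_or (h : G.IsPathOn a b S P) :
    (a = b ∧ S = {a} ∧ P = ∅) ∨ (P.Nonempty ∧ G.vertsOf P = S) := by
  induction h with
  | nil => simp
  | @snoc b c S P e h hl hc ih =>
    refine Or.inr ⟨⟨e, Or.inl rfl⟩, ?_⟩
    refine (h.snoc hl hc).vertsOf_subset.antisymm ?_
    rintro x (rfl | hx)
    · exact ⟨e, Or.inl rfl, hl.inc_right⟩
    · rcases ih with ⟨rfl, rfl, rfl⟩ | ⟨-, rfl⟩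
      · obtain rfl : x = a := hx
        exact ⟨e, Or.inl rfl, hl.inc_left⟩
      · obtain ⟨f, hf, hfx⟩ := hx
        exact ⟨f, Or.inr hf, hfx⟩

theorem vertsOf_eq (h : G.IsPathOn a b S P) (hab : a ≠ b) : G.vertsOf P = S := by
  rcases h.vertsOf_eq_or with h | h
  · exact absurd h.1 hab
  · exact h.2

theorem single (h : G.IsLink e a b) (hab : a ≠ b) : G.IsPathOn a b {a, b} {e} := by
  have := (IsPathOn.nil (G := G) (a := a)).snoc h (by simpa using hab.symm)
  rwa [Set.pair_comm, show ({e} : Set β) = insert e ∅ by simp]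

theorem append (h : G.IsPathOn a b S P) (h' : G.IsPathOn b c T Q) (hST : S ∩ T ⊆ {b}) :
    G.IsPathOn a c (S ∪ T) (P ∪ Q) := by
  induction h' with
  | nil =>
    rw [Set.union_empty, Set.union_eq_self_of_subset_right]
    · exact h
    · simpa using h.right_mem
  | @snoc d c T Q e h' hl hc ih =>
    rw [Set.union_insert, Set.union_insert]
    refine (ih ((Set.inter_subset_inter_right _ (Set.subset_insert _ _)).trans hST)).snoc hl ?_
    rintro (h1 | h1)
    · obtain rfl : c = b := hST ⟨h1, Or.inl rfl⟩
      exact hc h'.left_mem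
    · exact hc h1

theorem symm (h : G.IsPathOn a b S P) : G.IsPathOn b a S P := by
  induction h with
  | nil => exact nil
  | @snoc d c T Q e h' hl hc ih =>
    have hdc : c ≠ d := fun hh => hc (hh ▸ h'.right_mem)
    have := (single hl.symm hdc).append ih (by
      rintro x ⟨rfl | rfl, hx⟩
      · exact absurd hx hc
      · rfl)
    convert this using 1
    swap
    · exact Set.insert_eq _ _
    · ext x
      simp only [Set.mem_insert_iff, Set.mem_union, Set.mem_singleton_iff]
      constructor
      · rintro (h | h) <;> simp [h]
      · rintro ((h | rfl) | h)
        · simp [h]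
        · exact Or.inr h'.right_mem
        · exact Or.inr h

theorem split (h : G.IsPathOn a b S P) {d : α} (hd : d ∈ S) :
    ∃ S₁ P₁ S₂ P₂, G.IsPathOn a d S₁ P₁ ∧ G.IsPathOn d b S₂ P₂ ∧ S₁ ∪ S₂ = S ∧ S₁ ∩ S₂ = {d} ∧
      P₁ ∪ P₂ = P ∧ Disjoint P₁ P₂ := by
  induction h with
  | nil =>
    obtain rfl : d = a := hd
    exact ⟨_, _, _, _, nil, nil, by simp, by simp, by simp, by simp⟩
  | @snoc b c S P e h hl hc ih =>
    rcases hd with rfl | hd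
    · refine ⟨_, _, _, _, h.snoc hl hc, nil, by simp, by simp, by simp, by simp⟩
    · obtain ⟨S₁, P₁, S₂, P₂, h1, h2, hS, hS', hP, hP'⟩ := ih hd
      have hc2 : c ∉ S₂ := fun hh => hc (hS ▸ Or.inr hh)
      have hc1 : c ∉ S₁ := fun hh => hc (hS ▸ Or.inl hh)
      refine ⟨S₁, P₁, _, _, h1, h2.snoc hl hc2, ?_, ?_, ?_, ?_⟩
      · rw [Set.union_insert, hS]
      · rw [Set.inter_insert_of_notMem hc1, hS']
      · rw [Set.union_insert, hP]
      · rw [Set.disjoint_insert_right]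
        exact ⟨h1.notMem_of_inc hl.inc_right hc1, hP'⟩

end IsPathOn

/-- Reachability by edges of `D`. -/
def Reach (G : Graph α β) (D : Set β) : α → α → Prop :=
  Relation.ReflTransGen fun x y => ∃ e ∈ D, G.IsLink e x y

theorem Reach.symm (h : G.Reach D x y) : G.Reach D y x := by
  induction h with
  | refl => exact .refl
  | tail _ h ih => obtain ⟨e, he, hl⟩ := h; exact .head ⟨e, he, hl.symm⟩ ih

theorem Reach.trans {z : α} (h : G.Reach D x y) (h' : G.Reach D y z) : G.Reach D x z :=
  Relation.ReflTransGen.trans h h'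

theorem Reach.single (he : e ∈ D) (h : G.IsLink e x y) : G.Reach D x y :=
  Relation.ReflTransGen.single ⟨e, he, h⟩

theorem IsPathOn.reach (h : G.IsPathOn a b S P) (hP : P ⊆ D) (hx : x ∈ S) : G.Reach D a x := by
  induction h generalizing x with
  | nil => obtain rfl : x = a := hx; exact .refl
  | snoc h hl hc ih =>
    have hP' := (Set.subset_insert _ _).trans hP
    rcases hx with rfl | hx
    · exact (ih hP' h.right_mem).tail ⟨_, hP (Or.inl rfl), hl⟩
    · exact ih hP' hx

/-- Only the part of the walk after its last visit to `A` is kept: the path restarts whenever the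
walk enters `A`, and is truncated when the walk returns to a vertex of the path. This yields the
connecting paths of handcuffs and thetas. -/
theorem Reach.exists_isPathOn {A : Set α} (h : G.Reach D x y) (hx : x ∈ A) :
    ∃ a S P, G.IsPathOn a y S P ∧ P ⊆ D ∧ S ∩ A = {a} := by
  induction h with
  | refl => exact ⟨x, _, _, .nil, by simp, by simpa using hx⟩
  | @tail y z _ h ih =>
    obtain ⟨e, he, hl⟩ := h
    obtain ⟨a, S, P, hp, hP, hS⟩ := ih
    by_cases hz : z ∈ A
    · exact ⟨z, _, _, .nil, by simp, by simpa using hz⟩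
    have ha : a ∈ S ∩ A := hS ▸ rfl
    by_cases hzS : z ∈ S
    · obtain ⟨S₁, P₁, S₂, P₂, h1, h2, hSS, -, hPP, -⟩ := hp.split hzS
      refine ⟨a, S₁, P₁, h1, fun _ h => hP (hPP ▸ Or.inl h), ?_⟩
      refine Set.Subset.antisymm (fun x hx => hS ▸ ⟨hSS ▸ Or.inl hx.1, hx.2⟩) ?_
      rintro _ rfl
      exact ⟨h1.left_mem, ha.2⟩
    · refine ⟨a, _, _, hp.snoc hl hzS, Set.insert_subset he hP, ?_⟩
      rw [Set.insert_inter_of_notMem hz, hS]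

theorem Reach.exists_path (h : G.Reach D x y) : ∃ S P, G.IsPathOn x y S P ∧ P ⊆ D := by
  obtain ⟨a, S, P, hp, hP, hS⟩ := h.exists_isPathOn (A := {x}) rfl
  have ha : a ∈ S ∩ {x} := hS ▸ rfl
  obtain rfl : a = x := ha.2
  exact ⟨S, P, hp, hP⟩

/-! ### Comparison with indexed paths and cycles -/

theorem isPathOn_of_fin {n : ℕ} {x : Fin (n + 1) → α} {e : Fin n → β} (hx : x.Injective)
    (hl : ∀ i, G.IsLink (e i) (x i.castSucc) (x i.succ)) :
    G.IsPathOn (x 0) (x (Fin.last n)) (Set.range x) (Set.range e) := by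
  induction n with
  | zero =>
    have : Set.range x = {x 0} :=
      Set.Subset.antisymm (by rintro _ ⟨i, rfl⟩; rw [Fin.fin_one_eq_zero i]; rfl)
        (by rintro _ rfl; exact ⟨0, rfl⟩)
    rw [this, Set.range_eq_empty e]
    exact .nil
  | succ n ih =>
    have h := ih (x := Fin.init x) (e := Fin.init e)
      (fun i j hij => Fin.castSucc_injective _ (hx hij)) fun i => hl i.castSucc
    rw [← Fin.snoc_init_self x, ← Fin.snoc_init_self e, Fin.range_snoc, Fin.range_snoc,
      Fin.snoc_last]
    have h0 : (Fin.snoc (Fin.init x) (x (Fin.last (n + 1))) : Fin (n + 2) → α) 0 = Fin.init x 0 :=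
      Fin.snoc_castSucc (α := fun _ => α) _ _ 0
    rw [h0]
    refine h.snoc (hl (Fin.last n)) ?_
    rintro ⟨i, hi⟩
    exact (Fin.castSucc_lt_last i).ne (hx hi)

theorem IsPathOn.exists_fin (h : G.IsPathOn a b S P) :
    ∃ (n : ℕ) (x : Fin (n + 1) → α) (e : Fin n → β), x.Injective ∧ e.Injective ∧
      (∀ i, G.IsLink (e i) (x i.castSucc) (x i.succ)) ∧ Set.range e = P ∧ Set.range x = S ∧
      x 0 = a ∧ x (Fin.last n) = b := by
  induction h with
  | nil =>
    refine ⟨0, fun _ => a, Fin.elim0,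
      fun i j _ => (Fin.fin_one_eq_zero i).trans (Fin.fin_one_eq_zero j).symm, fun i => i.elim0,
      fun i => i.elim0, by simp, by simp, rfl, rfl⟩
  | @snoc b c S P f h hl hc ih =>
    obtain ⟨n, x, e, hx, he, hl', rfl, rfl, h0, hn⟩ := ih
    refine ⟨n + 1, Fin.snoc x c, Fin.snoc e f, ?_, ?_, ?_, ?_, ?_, ?_, ?_⟩
    · exact Fin.snoc_injective_iff.2 ⟨hx, hc⟩
    · exact Fin.snoc_injective_iff.2 ⟨he, h.notMem_of_inc hl.inc_right hc⟩
    · intro i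
      induction i using Fin.lastCases with
      | last =>
        rw [Fin.snoc_last, Fin.succ_last, Fin.snoc_last, Fin.snoc_castSucc, hn]
        exact hl
      | cast i =>
        rw [Fin.snoc_castSucc, Fin.snoc_castSucc, Fin.succ_castSucc, Fin.snoc_castSucc]
        exact hl' i
    · exact Fin.range_snoc _ _
    · exact Fin.range_snoc _ _
    · rw [← h0]; exact Fin.snoc_castSucc (α := fun _ => α) _ _ 0
    · exact Fin.snoc_last _ _

theorem IsPathOn.isPathSet (h : G.IsPathOn a b S P) : G.IsPathSet P a b := by
  obtain ⟨n, x, e, hx, -, hl, hP, -, h0, hn⟩ := h.exists_fin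
  exact ⟨n, x, e, hx, hl, hP, h0, hn⟩

theorem IsPathSet.exists_isPathOn (h : G.IsPathSet P a b) : ∃ S, G.IsPathOn a b S P := by
  obtain ⟨n, x, e, hx, hl, rfl, rfl, rfl⟩ := h
  exact ⟨_, isPathOn_of_fin hx hl⟩

theorem IsPathOn.isCycleSet (h : G.IsPathOn a b S P) (hf : f ∉ P) (hl : G.IsLink f b a) :
    G.IsCycleSet (insert f P) := by
  obtain ⟨n, x, e, hx, he, hl', rfl, -, rfl, rfl⟩ := h.exists_fin
  refine ⟨n, x, Fin.snoc e f, hx, Fin.snoc_injective_iff.2 ⟨he, hf⟩, fun i => ?_, Fin.range_snoc _ _⟩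
  induction i using Fin.lastCases with
  | last => rw [Fin.snoc_last, Fin.last_add_one]; exact hl
  | cast i => rw [Fin.snoc_castSucc, Fin.coeSucc_eq_succ]; exact hl' i

/-- Shifting the cyclic indices by `k + 1` makes `e k` the closing edge, so the remaining edges form
a path through all vertices of the cycle. -/
theorem IsCycleSet.exists_aux {n : ℕ} {x : Fin (n + 1) → α} {e : Fin (n + 1) → β}
    (hx : x.Injective) (he : e.Injective) (hl : ∀ i, G.IsLink (e i) (x i) (x (i + 1)))
    (k : Fin (n + 1)) : ∃ P, G.IsPathOn (x (k + 1)) (x k) (Set.range x) P ∧ e k ∉ P ∧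
      Set.range e = insert (e k) P := by
  have hk : ∀ i : Fin n, i.succ + (k + 1) = i.castSucc + (k + 1) + 1 := by
    intro i; rw [← Fin.coeSucc_eq_succ]; abel
  have h := isPathOn_of_fin (G := G) (n := n) (x := fun i => x (i + (k + 1)))
    (e := fun i => e (i.castSucc + (k + 1))) (fun i j hij => by simpa using hx hij)
    (fun i => by simpa only [hk] using hl (i.castSucc + (k + 1)))
  have hlast : Fin.last n + (k + 1) = k := by
    rw [add_comm k 1, ← add_assoc, Fin.last_add_one, zero_add]
  have hr : Set.range (fun i => x (i + (k + 1))) = Set.range x :=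
    (Equiv.addRight (k + 1)).surjective.range_comp x
  refine ⟨Set.range fun i : Fin n => e (i.castSucc + (k + 1)), ?_, ?_, ?_⟩
  · simpa only [zero_add, hlast, hr] using h
  · rintro ⟨i, hi⟩
    have h1 : i.castSucc + (k + 1) = Fin.last n + (k + 1) := (he hi).trans hlast.symm
    exact absurd (add_right_cancel h1) (Fin.castSucc_lt_last i).ne
  · rw [← (Equiv.addRight (k + 1)).surjective.range_comp e]
    ext z
    simp only [Set.mem_range, Set.mem_insert_iff, Function.comp, Equiv.coe_addRight]
    constructor
    · rintro ⟨i, rfl⟩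
      induction i using Fin.lastCases with
      | last => left; rw [hlast]
      | cast i => exact Or.inr ⟨i, rfl⟩
    · rintro (rfl | ⟨i, rfl⟩)
      · exact ⟨Fin.last n, by rw [hlast]⟩
      · exact ⟨_, rfl⟩

theorem vertsOf_insert_of_isPathOn (h : G.IsPathOn a b S P) (hl : G.IsLink f b a) :
    G.vertsOf (insert f P) = S := by
  refine Set.Subset.antisymm ?_ ?_
  · rintro z ⟨e, rfl | he, hz⟩
    · rcases hz.eq_or_eq_of_isLink hl with rfl | rfl
      exacts [h.right_mem, h.left_mem]
    · exact h.inc_mem he hz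
  · intro z hz
    rcases h.vertsOf_eq_or with ⟨rfl, rfl, rfl⟩ | ⟨-, rfl⟩
    · obtain rfl : z = a := hz
      exact ⟨f, Or.inl rfl, hl.inc_left⟩
    · obtain ⟨e, he, hez⟩ := hz
      exact ⟨e, Or.inr he, hez⟩

theorem IsCycleSet.exists_of_edge (h : G.IsCycleSet D) (hf : f ∈ D) :
    ∃ a b P, G.IsPathOn a b (G.vertsOf D) P ∧ f ∉ P ∧ G.IsLink f b a ∧ D = insert f P := by
  obtain ⟨n, x, e, hx, he, hl, rfl⟩ := h
  obtain ⟨k, rfl⟩ := hf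
  obtain ⟨P, hP, hk, hr⟩ := IsCycleSet.exists_aux hx he hl k
  refine ⟨_, _, P, ?_, hk, hl k, hr⟩
  rwa [hr, vertsOf_insert_of_isPathOn hP (hl k)]

theorem IsCycleSet.exists_of_vert (h : G.IsCycleSet D) (ha : a ∈ G.vertsOf D) :
    ∃ b P f, G.IsPathOn a b (G.vertsOf D) P ∧ f ∉ P ∧ G.IsLink f b a ∧ D = insert f P := by
  obtain ⟨n, x, e, hx, he, hl, rfl⟩ := h
  have : ∃ k, x k = a := by
    obtain ⟨_, ⟨k, rfl⟩, ha⟩ := ha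
    rcases ha.eq_or_eq_of_isLink (hl k) with rfl | rfl
    exacts [⟨_, rfl⟩, ⟨_, rfl⟩]
  obtain ⟨k, rfl⟩ := this
  obtain ⟨P, hP, hk, hr⟩ := IsCycleSet.exists_aux hx he hl (k - 1)
  rw [sub_add_cancel] at hP
  have hlk := hl (k - 1)
  rw [sub_add_cancel] at hlk
  refine ⟨_, P, _, ?_, hk, hlk, hr⟩
  rwa [hr, vertsOf_insert_of_isPathOn hP hlk]

theorem IsCycleSet.nonempty (h : G.IsCycleSet D) : D.Nonempty := by
  obtain ⟨n, x, e, -, -, -, rfl⟩ := h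
  exact ⟨_, 0, rfl⟩

theorem IsCycleSet.finite (h : G.IsCycleSet D) : D.Finite := by
  obtain ⟨n, x, e, -, -, -, rfl⟩ := h
  exact Set.finite_range e

theorem IsCycleSet.subset (h : G.IsCycleSet D) : D ⊆ E(G) := by
  obtain ⟨n, x, e, -, -, hl, rfl⟩ := h
  rintro _ ⟨i, rfl⟩
  exact (hl i).edge_mem

theorem IsCycleSet.of_links {H : Graph γ β} {g : α → γ} (h : G.IsCycleSet D)
    (hg : Set.InjOn g (G.vertsOf D))
    (hl : ∀ e ∈ D, ∀ x y, G.IsLink e x y → H.IsLink e (g x) (g y)) : H.IsCycleSet D := by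
  obtain ⟨n, x, e, hx, he, hl', rfl⟩ := h
  refine ⟨n, g ∘ x, e, fun i j hij => hx (hg ?_ ?_ hij), he,
    fun i => hl _ ⟨i, rfl⟩ _ _ (hl' i), rfl⟩
  · exact ⟨_, ⟨i, rfl⟩, (hl' i).inc_left⟩
  · exact ⟨_, ⟨j, rfl⟩, (hl' j).inc_left⟩

theorem IsCycleSet.mono {H : Graph α β} (hHG : H ≤ G) (h : H.IsCycleSet D) : G.IsCycleSet D :=
  h.of_links (g := id) Function.injective_id.injOn fun _ _ _ _ hl => hl.mono hHG

theorem IsCycleSet.of_le {H : Graph α β} (hHG : H ≤ G) (h : G.IsCycleSet D) (hD : D ⊆ E(H)) :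
    H.IsCycleSet D :=
  h.of_links (g := id) Function.injective_id.injOn fun _ he _ _ hl =>
    (hHG.isLink_iff (hD he)).2 hl

/-- The union of two paths with the same ends and no other common vertex is a cycle. -/
theorem IsPathOn.union_isCycleSet (h : G.IsPathOn a b S P) (h' : G.IsPathOn a b T Q) (hab : a ≠ b)
    (hST : S ∩ T ⊆ {a, b}) (hPQ : Disjoint P Q) : G.IsCycleSet (P ∪ Q) := by
  cases h' with
  | nil => exact absurd rfl hab
  | @snoc c _ T Q f h' hl hb =>
    have h1 := h.symm.append h' (by
      intro z hz
      rcases hST ⟨hz.1, Or.inr hz.2⟩ with rfl | rfl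
      · rfl
      · exact absurd hz.2 hb)
    rw [Set.union_insert]
    refine h1.isCycleSet ?_ hl
    rintro (h2 | h2)
    · exact hPQ.le_bot ⟨h2, Or.inl rfl⟩
    · exact h'.notMem_of_inc hl.inc_right hb h2

end Graph

namespace SignedGraph

variable {α β γ : Type*} {Ω : SignedGraph α β} {a b x y : α} {S T : Set α} {C D P Q : Set β} {e f : β}
  {o : β → α × α}

/-! ### Products of labels and potentials -/

/-- The product of the labels of the edges in `P`. -/
noncomputable def prodSign (Ω : SignedGraph α β) (P : Set β) : ℤˣ := ∏ᶠ e ∈ P, Ω.sign e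

theorem prodSign_insert (hP : P.Finite) (he : e ∉ P) :
    Ω.prodSign (insert e P) = Ω.sign e * Ω.prodSign P :=
  finprod_mem_insert _ he hP

theorem prodSign_union (hP : P.Finite) (hQ : Q.Finite) (h : Disjoint P Q) :
    Ω.prodSign (P ∪ Q) = Ω.prodSign P * Ω.prodSign Q :=
  finprod_mem_union h hP hQ

theorem prodSign_eq_pow (hP : P.Finite) :
    Ω.prodSign P = (-1) ^ {e ∈ P | Ω.sign e = -1}.ncard := by
  induction P, hP using Set.Finite.induction_on with
  | empty => simp [prodSign]
  | @insert e P he hP ih =>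
    rw [prodSign_insert hP he, ih]
    rcases Int.units_eq_one_or (Ω.sign e) with h | h
    · have : {f ∈ insert e P | Ω.sign f = -1} = {f ∈ P | Ω.sign f = -1} := by
        ext f
        simp only [Set.mem_insert_iff, Set.mem_ofPred_eq]
        constructor
        · rintro ⟨rfl | h1, h2⟩
          · rw [h] at h2; exact absurd h2 (by decide)
          · exact ⟨h1, h2⟩
        · exact fun h => ⟨Or.inr h.1, h.2⟩
      rw [this, h, one_mul]
    · have : {f ∈ insert e P | Ω.sign f = -1} = insert e {f ∈ P | Ω.sign f = -1} := by
        ext f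
        simp only [Set.mem_insert_iff, Set.mem_ofPred_eq]
        constructor
        · rintro ⟨rfl | h1, h2⟩
          exacts [Or.inl rfl, Or.inr ⟨h1, h2⟩]
        · rintro (rfl | h1)
          exacts [⟨Or.inl rfl, h⟩, ⟨Or.inr h1.1, h1.2⟩]
      rw [this, Set.ncard_insert_of_notMem (fun h => he h.1) (hP.subset fun _ h => h.1), h, pow_succ,
        mul_comm]

theorem mem_balancedCycles :
    C ∈ Ω.balancedCycles ↔ Ω.graph.IsCycleSet C ∧ Ω.prodSign C = 1 := by
  refine and_congr_right fun h => ?_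
  rw [prodSign_eq_pow h.finite]
  constructor
  · exact fun h => h.neg_one_pow
  · intro h
    by_contra h'
    rw [Nat.not_even_iff_odd] at h'
    rw [h'.neg_one_pow] at h
    exact absurd h (by decide)

theorem prodSign_eq_neg_one (h : Ω.graph.IsCycleSet C) (hC : C ∉ Ω.balancedCycles) :
    Ω.prodSign C = -1 :=
  (Int.units_eq_one_or _).resolve_left fun h' => hC (mem_balancedCycles.2 ⟨h, h'⟩)

/-- The values may lie in any set acted on by the signs, so that the rule serves both for potentials
in `ℤˣ` and for kernel functions in `ℚ`. -/
theorem eq_prodSign_smul {M : Type*} [MulAction ℤˣ M] {g : α → M}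
    (h : Ω.graph.IsPathOn a b S P)
    (hg : ∀ e ∈ P, ∀ x y, Ω.graph.IsLink e x y → g x = Ω.sign e • g y) :
    g a = Ω.prodSign P • g b := by
  induction h with
  | nil => simp [prodSign]
  | snoc h hl hc ih =>
    rw [prodSign_insert h.finite.2 (h.notMem_of_inc hl.inc_right hc),
      ih fun e he => hg e (Or.inr he), hg _ (Or.inl rfl) _ _ hl, mul_comm, mul_smul]

theorem eq_prodSign_smul_self {M : Type*} [MulAction ℤˣ M] {g : α → M}
    (h : Ω.graph.IsCycleSet C)
    (hg : ∀ e ∈ C, ∀ x y, Ω.graph.IsLink e x y → g x = Ω.sign e • g y)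
    (ha : a ∈ Ω.graph.vertsOf C) : g a = Ω.prodSign C • g a := by
  obtain ⟨b, P, f, hP, hf, hl, hC⟩ := h.exists_of_vert ha
  rw [hC] at hg
  rw [hC, prodSign_insert hP.finite.2 hf, mul_comm, mul_smul, ← hg f (Or.inl rfl) _ _ hl]
  exact eq_prodSign_smul hP fun e he => hg e (Or.inr he)

theorem prodSign_eq_one {g : α → ℤˣ} (h : Ω.graph.IsCycleSet C)
    (hg : ∀ e ∈ C, ∀ x y, Ω.graph.IsLink e x y → g x = Ω.sign e * g y) : Ω.prodSign C = 1 := by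
  obtain ⟨f, hf⟩ := h.nonempty
  obtain ⟨x, y, hl⟩ := Ω.graph.exists_isLink_of_mem_edgeSet (h.subset hf)
  have := eq_prodSign_smul_self (g := g) (a := x) h (fun e he x y hl => hg e he x y hl)
    ⟨f, hf, hl.inc_left⟩
  rw [smul_eq_mul] at this
  exact (mul_eq_right.1 this.symm)

/-- A set of edges without unbalanced cycles can be switched to positive labels. -/
theorem exists_potential (hD : D.Finite) (hDE : D ⊆ E(Ω.graph))
    (h : ∀ C ⊆ D, Ω.graph.IsCycleSet C → Ω.prodSign C = 1) :
    ∃ g : α → ℤˣ, ∀ e ∈ D, ∀ x y, Ω.graph.IsLink e x y → g x = Ω.sign e * g y := by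
  classical
  induction D, hD using Set.Finite.induction_on with
  | empty => exact ⟨1, by simp⟩
  | @insert e D he hD ih =>
    obtain ⟨g, hg⟩ := ih ((Set.subset_insert _ _).trans hDE) fun C hC =>
      h C (hC.trans (Set.subset_insert _ _))
    obtain ⟨x, y, hl⟩ := Ω.graph.exists_isLink_of_mem_edgeSet (hDE (Or.inl rfl))
    have huni : ∀ s t u : ℤˣ, s = t * u → u = t * s := by decide
    have key : ∀ g' : α → ℤˣ, g' x = Ω.sign e * g' y →
        ∀ u w, Ω.graph.IsLink e u w → g' u = Ω.sign e * g' w := by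
      intro g' hg' u w hu
      rcases hu.eq_and_eq_or_eq_and_eq hl with ⟨rfl, rfl⟩ | ⟨rfl, rfl⟩
      · exact hg'
      · exact huni _ _ _ hg'
    -- If the ends of `e` are already joined in `D`, then `e` closes a cycle, whose balance forces
    -- the old potential to be right at `e`. Otherwise the potential is rescaled on the component of
    -- `x`.
    by_cases hr : Ω.graph.Reach D x y
    · refine ⟨g, ?_⟩
      rintro f (rfl | hf)
      · refine key g ?_
        obtain ⟨S, P, hP, hPD⟩ := hr.exists_path
        have heP : f ∉ P := fun h => he (hPD h)
        have h1 := h _ (Set.insert_subset_insert hPD) (hP.isCycleSet heP hl.symm)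
        rw [prodSign_insert hP.finite.2 heP] at h1
        have h2 := eq_prodSign_smul hP (g := g) fun e he x y hl => hg e (hPD he) x y hl
        rw [h2, smul_eq_mul]
        have huni : ∀ s t : ℤˣ, s * t = 1 → t = s := by decide
        rw [huni _ _ h1]
      · exact hg f hf
    -- The constant `Ω.sign e * g y * g x` gives `x` the value `Ω.sign e * g y`, because `g x * g x
    -- = 1`.
    · refine ⟨fun u => if Ω.graph.Reach D x u then Ω.sign e * g y * g x * g u else g u, ?_⟩
      rintro f (rfl | hf) u w hu
      · refine key (fun u => if Ω.graph.Reach D x u then Ω.sign f * g y * g x * g u else g u) ?_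
          u w hu
        have : Ω.graph.Reach D x x := .refl
        simp only [this, hr, if_true, if_false, mul_assoc, Int.units_mul_self, mul_one]
      · have h1 : Ω.graph.Reach D x u ↔ Ω.graph.Reach D x w :=
          ⟨fun h => h.trans (Graph.Reach.single hf hu),
            fun h => h.trans (Graph.Reach.single hf hu.symm)⟩
        simp only [h1]
        split_ifs
        · rw [hg f hf u w hu]; simp only [mul_left_comm]
        · exact hg f hf u w hu

/-! ### Free sets of edges -/

/-- The rows of the incidence matrix, for the orientation `o` of the edges. -/
def cobound (Ω : SignedGraph α β) (o : β → α × α) (h : α → ℚ) (e : β) : ℚ :=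
  h (o e).1 - Ω.sign e • h (o e).2

theorem cobound_add_mul (h g : α → ℚ) (c : ℚ) :
    Ω.cobound o (fun u => h u + c * g u) e = Ω.cobound o h e + c * Ω.cobound o g e := by
  rcases Int.units_eq_one_or (Ω.sign e) with hs | hs <;> simp [cobound, hs] <;> ring

/-- Reversing an edge only changes its coboundary by a sign, so vanishing does not depend on the
orientation. -/
theorem cobound_eq_zero_iff {h : α → ℚ} (ho : Ω.graph.IsLink e (o e).1 (o e).2) :
    Ω.cobound o h e = 0 ↔ ∀ x y, Ω.graph.IsLink e x y → h x = Ω.sign e • h y := by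
  rw [cobound, sub_eq_zero]
  refine ⟨fun hh x y hl => ?_, fun hh => hh _ _ ho⟩
  rcases hl.eq_and_eq_or_eq_and_eq ho with ⟨rfl, rfl⟩ | ⟨rfl, rfl⟩
  · exact hh
  · rw [hh, smul_smul, Int.units_mul_self, one_smul]

/-- The columns of the incidence matrix belonging to `D` are linearly independent. -/
def Free (Ω : SignedGraph α β) (o : β → α × α) (D : Set β) : Prop :=
  ∀ t : β → ℚ, ∃ h : α → ℚ, ∀ e ∈ D, Ω.cobound o h e = t e

theorem Free.mono (h : Ω.Free o D) (hC : C ⊆ D) : Ω.Free o C := fun t =>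
  (h t).imp fun _ hh e he => hh e (hC he)

/-- Adding a multiple of `g` adjusts the value at `e` without disturbing the values on `D`. -/
theorem Free.free_insert (hD : Ω.Free o D) {g : α → ℚ} (hg : ∀ e ∈ D, Ω.cobound o g e = 0)
    (he : Ω.cobound o g e ≠ 0) : Ω.Free o (insert e D) := by
  intro t
  obtain ⟨h, hh⟩ := hD t
  refine ⟨fun u => h u + ((t e - Ω.cobound o h e) / Ω.cobound o g e) * g u, ?_⟩
  rintro f (rfl | hf)
  · rw [cobound_add_mul]; field_simp; ring
  · rw [cobound_add_mul, hg f hf, hh f hf, mul_zero, add_zero]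

/-- Restriction to finitely many vertices and edges makes freeness the surjectivity of a linear map
between coordinate spaces, so that dimensions can be compared. -/
theorem exists_linearMap (ho : ∀ e ∈ E(Ω.graph), Ω.graph.IsLink e (o e).1 (o e).2)
    (hD : D ⊆ E(Ω.graph)) (hS : Ω.graph.vertsOf D ⊆ S) :
    ∃ L : (S → ℚ) →ₗ[ℚ] (D → ℚ), (Function.Surjective L ↔ Ω.Free o D) ∧
      ∀ h : α → ℚ, L (fun u => h u) = fun e : D => Ω.cobound o h e := by
  have h1 : ∀ e : D, (o e).1 ∈ S := fun e => hS ⟨e, e.2, (ho e (hD e.2)).inc_left⟩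
  have h2 : ∀ e : D, (o e).2 ∈ S := fun e => hS ⟨e, e.2, (ho e (hD e.2)).inc_right⟩
  let L : (S → ℚ) →ₗ[ℚ] (D → ℚ) :=
    { toFun := fun h e => h ⟨_, h1 e⟩ - Ω.sign e • h ⟨_, h2 e⟩
      map_add' := fun h g => by
        funext e
        simp only [Pi.add_apply, smul_add]
        ring
      map_smul' := fun c h => by
        funext e
        rcases Int.units_eq_one_or (Ω.sign e) with hs | hs <;> simp [hs] <;> ring }
  refine ⟨L, ⟨fun h t => ?_, fun h t => ?_⟩, fun h => rfl⟩
  · classical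
    obtain ⟨h, hh⟩ := h fun e => t e
    refine ⟨fun u => if hu : u ∈ S then h ⟨u, hu⟩ else 0, fun e he => ?_⟩
    rw [cobound, dif_pos (h1 ⟨e, he⟩), dif_pos (h2 ⟨e, he⟩)]
    exact congrFun hh ⟨e, he⟩
  · classical
    obtain ⟨h, hh⟩ := h fun e => if he : e ∈ D then t ⟨e, he⟩ else 0
    refine ⟨fun u => h u, funext fun e => ?_⟩
    have := hh e e.2
    rw [dif_pos e.2] at this
    exact this

theorem not_free_of_ncard_lt (ho : ∀ e ∈ E(Ω.graph), Ω.graph.IsLink e (o e).1 (o e).2)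
    (hD : D ⊆ E(Ω.graph)) (hDf : D.Finite) (hS : Ω.graph.vertsOf D ⊆ S) (hSf : S.Finite)
    (hSD : S.ncard < D.ncard) : ¬ Ω.Free o D := by
  obtain ⟨L, hL, -⟩ := exists_linearMap ho hD hS
  have := hDf.fintype
  have := hSf.fintype
  rw [← hL]
  intro h
  have := LinearMap.finrank_le_finrank_of_surjective h
  rw [Module.finrank_fintype_fun_eq_card, Module.finrank_fintype_fun_eq_card,
    Fintype.card_eq_nat_card, Fintype.card_eq_nat_card] at this
  exact absurd hSD (not_lt.2 this)

/-- With as many vertices as edges the matrix is square, and surjectivity is equivalent to having no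
kernel; `free_of_kernel` is the other direction. -/
theorem not_free_of_kernel (ho : ∀ e ∈ E(Ω.graph), Ω.graph.IsLink e (o e).1 (o e).2)
    (hD : D ⊆ E(Ω.graph)) (hDf : D.Finite) (hS : Ω.graph.vertsOf D ⊆ S) (hSf : S.Finite)
    (hSD : S.ncard = D.ncard) {g : α → ℚ} (hg : ∀ e ∈ D, Ω.cobound o g e = 0) (ha : a ∈ S)
    (hga : g a ≠ 0) : ¬ Ω.Free o D := by
  obtain ⟨L, hL, hL'⟩ := exists_linearMap ho hD hS
  have := hDf.fintype
  have := hSf.fintype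
  have hfr : Module.finrank ℚ (S → ℚ) = Module.finrank ℚ (D → ℚ) := by
    rw [Module.finrank_fintype_fun_eq_card, Module.finrank_fintype_fun_eq_card,
      Fintype.card_eq_nat_card, Fintype.card_eq_nat_card]
    exact hSD
  rw [← hL, ← LinearMap.injective_iff_surjective_of_finrank_eq_finrank hfr]
  intro h
  have h0 : (fun u : S => g u) = 0 := h (by
    rw [hL', map_zero]; exact funext fun e => hg e e.2)
  exact hga (congrFun h0 ⟨a, ha⟩)

theorem free_of_kernel (ho : ∀ e ∈ E(Ω.graph), Ω.graph.IsLink e (o e).1 (o e).2)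
    (hD : D ⊆ E(Ω.graph)) (hDf : D.Finite) (hS : Ω.graph.vertsOf D ⊆ S) (hSf : S.Finite)
    (hSD : S.ncard = D.ncard)
    (h : ∀ g : α → ℚ, (∀ e ∈ D, ∀ x y, Ω.graph.IsLink e x y → g x = Ω.sign e • g y) →
      ∀ a ∈ S, g a = 0) : Ω.Free o D := by
  obtain ⟨L, hL, hL'⟩ := exists_linearMap ho hD hS
  have := hDf.fintype
  have := hSf.fintype
  have hfr : Module.finrank ℚ (S → ℚ) = Module.finrank ℚ (D → ℚ) := by
    rw [Module.finrank_fintype_fun_eq_card, Module.finrank_fintype_fun_eq_card,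
      Fintype.card_eq_nat_card, Fintype.card_eq_nat_card]
    exact hSD
  rw [← hL, ← LinearMap.injective_iff_surjective_of_finrank_eq_finrank hfr,
    injective_iff_map_eq_zero]
  classical
  intro g hg
  let g' : α → ℚ := fun u => if hu : u ∈ S then g ⟨u, hu⟩ else 0
  have hgg : g = fun u : S => g' u := by
    funext u; simp [g', u.2]
  rw [hgg, hL'] at hg
  rw [hgg]
  funext u
  exact h g' (fun e he => (cobound_eq_zero_iff (ho e (hD he))).1 (congrFun hg ⟨e, he⟩)) u u.2

/-- The indicator function of the last vertex has zero coboundary on the earlier edges but not on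
the last one, so edges can be added one at a time. -/
theorem free_of_isPathOn (ho : ∀ e ∈ E(Ω.graph), Ω.graph.IsLink e (o e).1 (o e).2)
    (h : Ω.graph.IsPathOn a b S P) : Ω.Free o P := by
  classical
  induction h with
  | nil => exact fun t => ⟨0, by simp⟩
  | @snoc b c S P e h hl hc ih =>
    refine ih.free_insert (g := Pi.single c 1) (fun f hf => ?_) ?_
    · rw [cobound_eq_zero_iff (ho f (h.edge_subset hf))]
      intro x y hl
      have hx : x ≠ c := fun hx => hc (hx ▸ h.inc_mem hf hl.inc_left)
      have hy : y ≠ c := fun hx => hc (hx ▸ h.inc_mem hf hl.inc_right)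
      simp [hx, hy]
    · rw [Ne, cobound_eq_zero_iff (ho e hl.edge_mem)]
      intro hh
      have hbc : b ≠ c := fun hh => hc (hh ▸ h.right_mem)
      simpa [hbc] using hh _ _ hl.symm

end SignedGraph

namespace Graph

variable {α β : Type*} {G : Graph α β} {a b u : α} {S : Set α} {C D P : Set β}

theorem vertsOf_union {X Y : Set β} : G.vertsOf (X ∪ Y) = G.vertsOf X ∪ G.vertsOf Y := by
  ext x
  simp only [vertsOf, Set.mem_union, Set.mem_ofPred_eq, or_and_right, exists_or]

theorem vertsOf_mono {X Y : Set β} (h : X ⊆ Y) : G.vertsOf X ⊆ G.vertsOf Y :=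
  fun _ ⟨e, he, hx⟩ => ⟨e, h he, hx⟩

theorem IsPathOn.disjoint_of_inter_subset (h : G.IsPathOn a b S P) (hS : S ∩ G.vertsOf C ⊆ {u}) :
    Disjoint P C := by
  rw [Set.disjoint_left]
  intro f hf hfC
  obtain ⟨x, y, hxy, hl⟩ := h.exists_isLink_ne hf
  have hx : x = u := hS ⟨h.inc_mem hf hl.inc_left, f, hfC, hl.inc_left⟩
  have hy : y = u := hS ⟨h.inc_mem hf hl.inc_right, f, hfC, hl.inc_right⟩
  exact hxy (hx.trans hy.symm)

theorem IsCycleSet.reach (h : G.IsCycleSet C) (hC : C ⊆ D) (ha : a ∈ G.vertsOf C)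
    (hb : b ∈ G.vertsOf C) : G.Reach D a b := by
  obtain ⟨c, P, f, hP, -, -, rfl⟩ := h.exists_of_vert ha
  exact hP.reach ((Set.subset_insert _ _).trans hC) hb

end Graph

namespace SignedGraph

variable {α β γ : Type*} {Ω : SignedGraph α β} {a b x y z : α} {S T : Set α} {C C₁ C₂ D P Q : Set β}
  {e f : β} {o : β → α × α}

/-! ### Dependent sets contain circuits -/

/-- If the component of `z` has only balanced cycles, it has a potential; extended by zero outside
the component, this is a kernel function. -/
theorem exists_kernel_of_component (hD : D.Finite) (hDE : D ⊆ E(Ω.graph))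
    (h : ∀ C ⊆ D, Ω.graph.IsCycleSet C → (∃ c ∈ Ω.graph.vertsOf C, Ω.graph.Reach D z c) →
      Ω.prodSign C = 1) :
    ∃ g : α → ℚ, g z = 1 ∧ (∀ u, ¬ Ω.graph.Reach D z u → g u = 0) ∧
      ∀ e ∈ D, ∀ x y, Ω.graph.IsLink e x y → g x = Ω.sign e • g y := by
  classical
  let D' := {e ∈ D | ∃ u, Ω.graph.Inc e u ∧ Ω.graph.Reach D z u}
  have hD' : D' ⊆ D := fun e he => he.1
  obtain ⟨g, hg⟩ := exists_potential (hD.subset hD') (hD'.trans hDE) fun C hC hCc => by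
    refine h C (hC.trans hD') hCc ?_
    obtain ⟨f, hf⟩ := hCc.nonempty
    obtain ⟨u, hu, hu'⟩ := (hC hf).2
    exact ⟨u, ⟨f, hf, hu⟩, hu'⟩
  -- The factor `g z` normalizes the value at `z` to `1`.
  refine ⟨fun u => if Ω.graph.Reach D z u then (((g z * g u : ℤˣ) : ℤ) : ℚ) else 0, ?_, ?_, ?_⟩
  · have : Ω.graph.Reach D z z := .refl
    simp [this]
  · intro u hu
    simp [hu]
  · intro e he x y hl
    have h1 : Ω.graph.Reach D z x ↔ Ω.graph.Reach D z y :=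
      ⟨fun h => h.trans (Graph.Reach.single he hl), fun h => h.trans (Graph.Reach.single he hl.symm)⟩
    by_cases hx : Ω.graph.Reach D z x
    · have hy := h1.1 hx
      simp only [hx, hy, if_true]
      rw [hg e ⟨he, x, hl.inc_left, hx⟩ x y hl, Units.smul_def, zsmul_eq_mul, mul_left_comm]
      push_cast
      rfl
    · have hy : ¬ Ω.graph.Reach D z y := fun h => hx (h1.2 h)
      simp [hx, hy]

/-- The new edge joins two components, each containing an unbalanced cycle. Paths from its ends to
these cycles complete a loose handcuff. -/
theorem exists_circuit_of_not_reach (hC₁ : Ω.graph.IsCycleSet C₁) (hb₁ : C₁ ∉ Ω.balancedCycles)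
    (hD₁ : C₁ ⊆ D) (hC₂ : Ω.graph.IsCycleSet C₂) (hb₂ : C₂ ∉ Ω.balancedCycles) (hD₂ : C₂ ⊆ D)
    (h₁ : ∃ c ∈ Ω.graph.vertsOf C₁, Ω.graph.Reach D x c)
    (h₂ : ∃ c ∈ Ω.graph.vertsOf C₂, Ω.graph.Reach D y c)
    (hxy : ¬ Ω.graph.Reach D x y) (hl : Ω.graph.IsLink e x y) :
    ∃ C ⊆ insert e D, Ω.graph.IsFrameCircuit Ω.balancedCycles C := by
  obtain ⟨c₁, hc₁, hr₁⟩ := h₁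
  obtain ⟨c₂, hc₂, hr₂⟩ := h₂
  obtain ⟨a₁, S₁, P₁, hp₁, hP₁, hS₁⟩ := hr₁.symm.exists_isPathOn hc₁
  obtain ⟨a₂, S₂, P₂, hp₂, hP₂, hS₂⟩ := hr₂.symm.exists_isPathOn hc₂
  have hv₁ : ∀ z ∈ Ω.graph.vertsOf C₁, Ω.graph.Reach D x z := fun z hz =>
    hr₁.trans (hC₁.reach hD₁ hc₁ hz)
  have hv₂ : ∀ z ∈ Ω.graph.vertsOf C₂, Ω.graph.Reach D y z := fun z hz =>
    hr₂.trans (hC₂.reach hD₂ hc₂ hz)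
  have hs₁ : ∀ z ∈ S₁, Ω.graph.Reach D x z := fun z hz => hp₁.symm.reach hP₁ hz
  have hs₂ : ∀ z ∈ S₂, Ω.graph.Reach D y z := fun z hz => hp₂.symm.reach hP₂ hz
  have hno : ∀ z, Ω.graph.Reach D x z → Ω.graph.Reach D y z → False := fun z h h' =>
    hxy (h.trans h'.symm)
  have ha₁ : a₁ ∈ S₁ ∩ Ω.graph.vertsOf C₁ := hS₁ ▸ rfl
  have ha₂ : a₂ ∈ S₂ ∩ Ω.graph.vertsOf C₂ := hS₂ ▸ rfl
  have hy : y ∉ S₁ := fun h => hxy (hs₁ y h)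
  have hp := (hp₁.snoc hl hy).append hp₂.symm (by
    rintro z ⟨rfl | hz, hz'⟩
    · rfl
    · exact (hno z (hs₁ z hz) (hs₂ z hz')).elim)
  have hne : a₁ ≠ a₂ := by
    rintro rfl
    exact hno _ (hs₁ _ ha₁.1) (hs₂ _ ha₂.1)
  refine ⟨C₁ ∪ C₂ ∪ (insert e P₁ ∪ P₂), ?_, Or.inr (Or.inr (Or.inl
    ⟨C₁, C₂, _, a₁, a₂, hC₁, hb₁, hC₂, hb₂, ?_, hp.isPathSet, ?_, ?_, rfl⟩))⟩
  · have := Set.subset_insert e D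
    exact Set.union_subset (Set.union_subset (hD₁.trans this) (hD₂.trans this))
      (Set.union_subset (Set.insert_subset_insert hP₁) (hP₂.trans this))
  · exact Set.disjoint_left.2 fun z h h' => hno z (hv₁ z h) (hv₂ z h')
  · rw [hp.vertsOf_eq hne]
    refine Set.Subset.antisymm ?_ ?_
    · rintro z ⟨(rfl | hz) | hz, hz'⟩
      · exact (hxy (hv₁ z hz')).elim
      · exact hS₁ ▸ ⟨hz, hz'⟩
      · exact (hno z (hv₁ z hz') (hs₂ z hz)).elim
    · rintro _ rfl
      exact ⟨Or.inl (Or.inr ha₁.1), ha₁.2⟩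
  · rw [hp.vertsOf_eq hne]
    refine Set.Subset.antisymm ?_ ?_
    · rintro z ⟨(rfl | hz) | hz, hz'⟩
      · exact hS₂ ▸ ⟨hp₂.right_mem, hz'⟩
      · exact (hno z (hs₁ z hz) (hv₂ z hz')).elim
      · exact hS₂ ▸ ⟨hz, hz'⟩
    · rintro _ rfl
      exact ⟨Or.inr ha₂.1, ha₂.2⟩

/-- The product of the signs of the three cycles of a theta is a square, because each path is used
twice; it is `1`, so the three cycles cannot all be unbalanced. -/
theorem false_of_theta {P₁ P₂ P₃ : Set β} {S₁ S₂ S₃ : Set α} (h₁ : Ω.graph.IsPathOn a b S₁ P₁)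
    (h₂ : Ω.graph.IsPathOn a b S₂ P₂) (h₃ : Ω.graph.IsPathOn a b S₃ P₃) (hab : a ≠ b)
    (d12 : Disjoint P₁ P₂) (d13 : Disjoint P₁ P₃) (d23 : Disjoint P₂ P₃)
    (i12 : S₁ ∩ S₂ ⊆ {a, b}) (i13 : S₁ ∩ S₃ ⊆ {a, b}) (i23 : S₂ ∩ S₃ ⊆ {a, b})
    (h : ∀ C ⊆ P₁ ∪ P₂ ∪ P₃, Ω.graph.IsCycleSet C → C ∉ Ω.balancedCycles) : False := by
  have c12 := h₁.union_isCycleSet h₂ hab i12 d12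
  have c13 := h₁.union_isCycleSet h₃ hab i13 d13
  have c23 := h₂.union_isCycleSet h₃ hab i23 d23
  have e12 := prodSign_eq_neg_one c12 (h _ Set.subset_union_left c12)
  have e13 := prodSign_eq_neg_one c13 (h _ (Set.union_subset_union_left _ Set.subset_union_left) c13)
  have e23 := prodSign_eq_neg_one c23 (h _ (Set.union_subset_union_left _ Set.subset_union_right) c23)
  rw [prodSign_union h₁.finite.2 h₂.finite.2 d12] at e12
  rw [prodSign_union h₁.finite.2 h₃.finite.2 d13] at e13
  rw [prodSign_union h₂.finite.2 h₃.finite.2 d23] at e23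
  have : ∀ s t u : ℤˣ, s * t = -1 → s * u = -1 → t * u = -1 → False := by decide
  exact this _ _ _ e12 e13 e23

/-- The edge `e` gives a second cycle, or a handle on `C₁`, in the component of an unbalanced cycle.
If no circuit arose, all cycles would be unbalanced; then a handcuff appears, or a theta excluded by
`false_of_theta`. -/
theorem exists_circuit_of_reach (hC₁ : Ω.graph.IsCycleSet C₁) (hb₁ : C₁ ∉ Ω.balancedCycles)
    (hD₁ : C₁ ⊆ D) (h₁ : ∃ c ∈ Ω.graph.vertsOf C₁, Ω.graph.Reach D x c)
    (hxy : Ω.graph.Reach D x y) (hl : Ω.graph.IsLink e x y) (he : e ∉ D) :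
    ∃ C ⊆ insert e D, Ω.graph.IsFrameCircuit Ω.balancedCycles C := by
  by_contra! hcon
  have hunb : ∀ C ⊆ insert e D, Ω.graph.IsCycleSet C → C ∉ Ω.balancedCycles := fun C hC hCc hb =>
    hcon C hC (Or.inl ⟨hCc, hb⟩)
  have hDi := Set.subset_insert e D
  have heC : e ∉ C₁ := fun h => he (hD₁ h)
  obtain ⟨c₁, hc₁, hr₁⟩ := h₁
  obtain ⟨a₁, S₁, P₁, hp₁, hP₁, hS₁⟩ := hr₁.symm.exists_isPathOn hc₁
  have ha₁ : a₁ ∈ S₁ ∩ Ω.graph.vertsOf C₁ := hS₁ ▸ rfl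
  obtain ⟨a₂, S₂, P₂, hp₂, hP₂, hS₂⟩ := (hr₁.symm.trans hxy).exists_isPathOn
    (A := Ω.graph.vertsOf C₁ ∪ S₁) (Or.inl hc₁)
  have ha₂ : a₂ ∈ S₂ ∩ (Ω.graph.vertsOf C₁ ∪ S₁) := hS₂ ▸ rfl
  have hS₁' : ∀ z ∈ S₁, z ∈ Ω.graph.vertsOf C₁ → z = a₁ := fun z h h' => by
    have : z ∈ S₁ ∩ Ω.graph.vertsOf C₁ := ⟨h, h'⟩
    rwa [hS₁] at this
  have hS₂' : ∀ z ∈ S₂, z ∈ Ω.graph.vertsOf C₁ ∪ S₁ → z = a₂ := fun z h h' => by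
    have : z ∈ S₂ ∩ (Ω.graph.vertsOf C₁ ∪ S₁) := ⟨h, h'⟩
    rwa [hS₂] at this
  -- If the path from `y` ends on the path joining `C₁` to `x`, then the part from `a₂` to `x`, the
  -- edge `e` and the path to `y` form a second cycle.
  by_cases ha : a₂ ∈ S₁
  · obtain ⟨Sa, Pa, Sb, Pb, hpa, hpb, hSab, hSi, hPab, -⟩ := hp₁.split ha
    have hSb : Sb ⊆ S₁ := hSab ▸ Set.subset_union_right
    have hSa : Sa ⊆ S₁ := hSab ▸ Set.subset_union_left
    have hq := hpb.symm.append hp₂ (by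
      rintro z ⟨hz, hz'⟩
      exact hS₂' z hz' (Or.inr (hSb hz)))
    have hPq : Pb ∪ P₂ ⊆ D :=
      Set.union_subset ((hPab ▸ Set.subset_union_right : Pb ⊆ P₁).trans hP₁) hP₂
    have heq : e ∉ Pb ∪ P₂ := fun h => he (hPq h)
    have hC₂ := hq.isCycleSet heq hl.symm
    have hV₂ := Graph.vertsOf_insert_of_isPathOn hq hl.symm
    have hb₂ := hunb _ (Set.insert_subset_insert hPq) hC₂
    -- The second cycle meets `C₁` exactly in `a₁` (tight handcuff), or is disjoint from it and
    -- joined to it by `Pa` (loose handcuff).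
    by_cases h12 : a₂ = a₁
    · subst h12
      have hi : (Sb ∪ S₂) ∩ Ω.graph.vertsOf C₁ ⊆ {a₂} := by
        rintro z ⟨hz | hz, hz'⟩
        · exact hS₁' z (hSb hz) hz'
        · exact hS₂' z hz (Or.inl hz')
      refine hcon _ ?_ (Or.inr (Or.inl ⟨C₁, _, a₂, hC₁, hb₁, hC₂, hb₂, ?_, ?_, rfl⟩))
      · exact Set.union_subset (hD₁.trans hDi) (Set.insert_subset_insert hPq)
      · rw [Set.disjoint_insert_right]
        exact ⟨heC, (hq.disjoint_of_inter_subset hi).symm⟩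
      · rw [hV₂, Set.inter_comm]
        refine hi.antisymm ?_
        rintro _ rfl
        exact ⟨Or.inr ha₂.1, ha₁.2⟩
    · refine hcon _ ?_ (Or.inr (Or.inr (Or.inl ⟨C₁, _, Pa, a₁, a₂, hC₁, hb₁, hC₂, hb₂, ?_,
        hpa.isPathSet, ?_, ?_, rfl⟩)))
      · exact Set.union_subset (Set.union_subset (hD₁.trans hDi) (Set.insert_subset_insert hPq))
          (((hPab ▸ Set.subset_union_left : Pa ⊆ P₁).trans hP₁).trans hDi)
      · rw [hV₂, Set.disjoint_left]
        rintro z hz (hz' | hz')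
        · obtain rfl := hS₁' z (hSb hz') hz
          have : z ∈ Sa ∩ Sb := ⟨hpa.left_mem, hz'⟩
          rw [hSi] at this
          exact h12 this.symm
        · obtain rfl := hS₂' z hz' (Or.inl hz)
          exact h12 (hS₁' z ha hz)
      · rw [hpa.vertsOf_eq (Ne.symm h12)]
        refine Set.Subset.antisymm (fun z hz => hS₁' z (hSa hz.1) hz.2) ?_
        rintro _ rfl
        exact ⟨hpa.left_mem, ha₁.2⟩
      · rw [hpa.vertsOf_eq (Ne.symm h12), hV₂]
        refine Set.Subset.antisymm ?_ ?_
        · rintro z ⟨hz, hz' | hz'⟩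
          · exact hSi ▸ ⟨hz, hz'⟩
          · exact hS₂' z hz' (Or.inr (hSa hz))
        · rintro _ rfl
          exact ⟨hpa.right_mem, Or.inr ha₂.1⟩
  -- Otherwise the two paths and `e` form a path between distinct vertices of `C₁`. Together with
  -- the two arcs of `C₁` this is a theta.
  · have ha₂C : a₂ ∈ Ω.graph.vertsOf C₁ := ha₂.2.resolve_right ha
    have h12 : a₁ ≠ a₂ := fun h => ha (h ▸ ha₁.1)
    have hS12 : ∀ z ∈ S₁, z ∈ S₂ → False := fun z hz hz' => ha (hS₂' z hz' (Or.inr hz) ▸ hz)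
    have hq := (hp₁.snoc hl (fun h => hS12 y h hp₂.right_mem)).append hp₂.symm (by
      rintro z ⟨rfl | hz, hz'⟩
      · rfl
      · exact (hS12 z hz hz').elim)
    have hqC : ∀ z ∈ insert y S₁ ∪ S₂, z ∈ Ω.graph.vertsOf C₁ → z ∈ ({a₁, a₂} : Set α) := by
      rintro z ((rfl | hz) | hz) hz'
      · exact Or.inr (hS₂' z hp₂.right_mem (Or.inl hz'))
      · exact Or.inl (hS₁' z hz hz')
      · exact Or.inr (hS₂' z hz (Or.inl hz'))
    have hqd : Disjoint (insert e P₁ ∪ P₂) C₁ := by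
      rw [Set.disjoint_union_left, Set.disjoint_insert_left]
      exact ⟨⟨heC, hp₁.disjoint_of_inter_subset hS₁.subset⟩,
        hp₂.disjoint_of_inter_subset (u := a₂) fun z hz => hS₂' z hz.1 (Or.inl hz.2)⟩
    obtain ⟨b, R, f, hR, hf, hfl, hCR⟩ := hC₁.exists_of_vert ha₁.2
    obtain ⟨R₁, Q₁, R₂, Q₂, hR₁, hR₂, hRR, hRi, hQQ, hQd⟩ := hR.split ha₂C
    have ha₁R : a₁ ∉ R₂ := fun h => by
      have : a₁ ∈ R₁ ∩ R₂ := ⟨hR₁.left_mem, h⟩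
      rw [hRi] at this
      exact h12 this
    have hR₂' := (hR₂.snoc hfl ha₁R).symm
    have hQC₁ : Q₁ ⊆ C₁ := by rw [hCR, ← hQQ]; exact fun z hz => Or.inr (Or.inl hz)
    have hQC₂ : insert f Q₂ ⊆ C₁ := by
      rw [hCR, ← hQQ]; exact Set.insert_subset_insert Set.subset_union_right
    have hSC₁ : R₁ ⊆ Ω.graph.vertsOf C₁ := hRR ▸ Set.subset_union_left
    have hSC₂ : insert a₁ R₂ ⊆ Ω.graph.vertsOf C₁ :=
      Set.insert_subset ha₁.2 (hRR ▸ Set.subset_union_right)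
    refine false_of_theta hq hR₁ hR₂' h12 (hqd.mono_right hQC₁) (hqd.mono_right hQC₂) ?_
      (fun z hz => hqC z hz.1 (hSC₁ hz.2)) (fun z hz => hqC z hz.1 (hSC₂ hz.2)) ?_ ?_
    · rw [Set.disjoint_insert_right]
      exact ⟨fun h => hf (hQQ ▸ Or.inl h), hQd⟩
    · rintro z ⟨hz, rfl | hz'⟩
      · exact Or.inl rfl
      · exact Or.inr (hRi ▸ ⟨hz, hz'⟩)
    · intro C hC
      refine hunb C (hC.trans ?_)
      exact Set.union_subset (Set.union_subset (Set.union_subset (Set.insert_subset_insert hP₁)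
        (hP₂.trans hDi)) (hQC₁.trans (hD₁.trans hDi))) (hQC₂.trans (hD₁.trans hDi))

/-- Edges are added one at a time. If freeness fails at `e`, kernel functions of the earlier edges
satisfy the equation at `e` as well, which forces unbalanced cycles where a circuit can then be
built. -/
theorem free_of_forall_not_isFrameCircuit
    (ho : ∀ e ∈ E(Ω.graph), Ω.graph.IsLink e (o e).1 (o e).2) (hD : D.Finite)
    (hDE : D ⊆ E(Ω.graph)) (h : ∀ C ⊆ D, ¬ Ω.graph.IsFrameCircuit Ω.balancedCycles C) :
    Ω.Free o D := by
  induction D, hD using Set.Finite.induction_on with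
  | empty => exact fun t => ⟨0, by simp⟩
  | @insert e D he hD ih =>
    have hDi := Set.subset_insert e D
    have hDE' := hDi.trans hDE
    have hF := ih hDE' fun C hC => h C (hC.trans hDi)
    obtain ⟨x, y, hl⟩ := Ω.graph.exists_isLink_of_mem_edgeSet (hDE (Or.inl rfl))
    by_contra hcon
    -- A kernel function of `D` violating the equation at `e` would make `insert e D` free.
    have hker : ∀ g : α → ℚ, (∀ e ∈ D, ∀ x y, Ω.graph.IsLink e x y → g x = Ω.sign e • g y) →
        g x = Ω.sign e • g y := by
      intro g hg
      by_contra hne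
      refine hcon (hF.free_insert (g := g) (fun f hf => ?_) fun h0 => ?_)
      · exact (cobound_eq_zero_iff (ho f (hDE' hf))).2 (hg f hf)
      · exact hne ((cobound_eq_zero_iff (ho e (hDE (Or.inl rfl)))).1 h0 x y hl)
    -- To find an unbalanced cycle in the component of `z`, it suffices to refute the kernel
    -- function that is `1` at `z` and supported on this component. If `x` and `y` are joined in
    -- `D`, it would make the cycle closed by `e` balanced; if not, it would violate the equation at
    -- `e`.
    have hunb : ∀ z, (∀ g : α → ℚ, g z = 1 → (∀ u, ¬ Ω.graph.Reach D z u → g u = 0) →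
        (∀ e ∈ D, ∀ x y, Ω.graph.IsLink e x y → g x = Ω.sign e • g y) → False) →
        ∃ C ⊆ D, Ω.graph.IsCycleSet C ∧ (∃ c ∈ Ω.graph.vertsOf C, Ω.graph.Reach D z c) ∧
          C ∉ Ω.balancedCycles := by
      intro z hz
      by_contra! hC
      obtain ⟨g, h1, h2, h3⟩ := exists_kernel_of_component (z := z) hD hDE' fun C hCD hCc hr =>
        (mem_balancedCycles.1 (hC C hCD hCc hr)).2
      exact hz g h1 h2 h3
    by_cases hxy : Ω.graph.Reach D x y
    · obtain ⟨C, hCD, hCc, hr, hCb⟩ := hunb x fun g h1 _ h3 => by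
        obtain ⟨S, P, hP, hPD⟩ := hxy.exists_path
        have heP : e ∉ P := fun h => he (hPD h)
        refine h _ (Set.insert_subset_insert hPD) (Or.inl
          ⟨hP.isCycleSet heP hl.symm, mem_balancedCycles.2 ⟨hP.isCycleSet heP hl.symm, ?_⟩⟩)
        rw [prodSign_insert hP.finite.2 heP]
        have h4 := eq_prodSign_smul hP fun e he x y hl => h3 e (hPD he) x y hl
        have h5 := hker g h3
        rw [h1] at h4 h5
        rcases Int.units_eq_one_or (Ω.sign e) with hs | hs <;>
          rcases Int.units_eq_one_or (Ω.prodSign P) with hs' | hs' <;>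
          simp only [hs, hs', one_smul, Units.neg_smul] at h4 h5 ⊢ <;>
          first | rfl | linarith
      obtain ⟨C', h1, h2⟩ := exists_circuit_of_reach hCc hCb hCD hr hxy hl he
      exact h C' h1 h2
    · obtain ⟨C₁, hD₁, hC₁, hr₁, hb₁⟩ := hunb x fun g h1 h2 h3 => by
        have h5 := hker g h3
        rw [h1, h2 y hxy, smul_zero] at h5
        exact one_ne_zero h5
      obtain ⟨C₂, hD₂, hC₂, hr₂, hb₂⟩ := hunb y fun g h1 h2 h3 => by
        have h5 := hker g h3
        rw [h1, h2 x fun h => hxy h.symm] at h5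
        rcases Int.units_eq_one_or (Ω.sign e) with hs | hs <;> simp [hs] at h5
      obtain ⟨C', h1, h2⟩ := exists_circuit_of_not_reach hC₁ hb₁ hD₁ hC₂ hb₂ hD₂ hr₁ hr₂ hxy hl
      exact h C' h1 h2

end SignedGraph

namespace Graph

variable {α β : Type*} {G : Graph α β} {C D : Set β}

theorem IsCycleSet.finite_vertsOf (h : G.IsCycleSet C) : (G.vertsOf C).Finite := by
  obtain ⟨f, hf⟩ := h.nonempty
  obtain ⟨a, b, P, hP, -⟩ := h.exists_of_edge hf
  exact hP.finite.1

theorem IsCycleSet.ncard_vertsOf (h : G.IsCycleSet C) : (G.vertsOf C).ncard = C.ncard := by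
  obtain ⟨f, hf⟩ := h.nonempty
  obtain ⟨a, b, P, hP, hfP, hl, hC⟩ := h.exists_of_edge hf
  rw [hP.ncard_eq]
  conv_rhs => rw [hC]
  rw [Set.ncard_insert_of_notMem hfP hP.finite.2]

theorem disjoint_of_disjoint_vertsOf (hC : C ⊆ E(G)) (h : Disjoint (G.vertsOf C) (G.vertsOf D)) :
    Disjoint C D := by
  rw [Set.disjoint_left]
  intro f hf hf'
  obtain ⟨x, y, hl⟩ := G.exists_isLink_of_mem_edgeSet (hC hf)
  exact Set.disjoint_left.1 h ⟨f, hf, hl.inc_left⟩ ⟨f, hf', hl.inc_left⟩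

end Graph

namespace SignedGraph

variable {α β γ : Type*} {Ω : SignedGraph α β} {a b c x y z : α} {S T : Set α}
  {C C₁ C₂ D P Q : Set β} {e f : β} {o : β → α × α} {g : α → ℚ}

/-! ### Circuits are minimal dependent sets -/

/-- The function `g` is in the kernel of the transposed incidence matrix restricted to `D`. -/
def InKernel (Ω : SignedGraph α β) (g : α → ℚ) (D : Set β) : Prop :=
  ∀ e ∈ D, ∀ x y, Ω.graph.IsLink e x y → g x = Ω.sign e • g y

theorem InKernel.mono (h : Ω.InKernel g D) (hC : C ⊆ D) : Ω.InKernel g C := fun e he => h e (hC he)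

theorem units_smul_eq_zero {s : ℤˣ} {q : ℚ} : s • q = 0 ↔ q = 0 := by
  rcases Int.units_eq_one_or s with h | h <;> simp [h]

theorem InKernel.eq_zero_of_isPathOn (hg : Ω.InKernel g P) (h : Ω.graph.IsPathOn a b S P)
    (hc : c ∈ S) (h0 : g c = 0) : ∀ z ∈ S, g z = 0 := by
  have key : ∀ z ∈ S, g a = 0 ↔ g z = 0 := by
    intro z hz
    obtain ⟨S₁, P₁, S₂, P₂, h1, -, -, -, hP, -⟩ := h.split hz
    rw [eq_prodSign_smul h1 (hg.mono (hP ▸ Set.subset_union_left)), units_smul_eq_zero]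
  exact fun z hz => (key z hz).1 ((key c hc).2 h0)

theorem InKernel.eq_zero_of_unbalanced (hg : Ω.InKernel g C) (hC : Ω.graph.IsCycleSet C)
    (hb : C ∉ Ω.balancedCycles) : ∀ z ∈ Ω.graph.vertsOf C, g z = 0 := by
  intro z hz
  have h := eq_prodSign_smul_self hC hg hz
  rw [prodSign_eq_neg_one hC hb, Units.neg_smul, one_smul] at h
  linarith

/-- Every vertex remains joined to one of the two ends after `e` is removed, so the zeros at the
ends spread over the whole path. -/
theorem InKernel.eq_zero_of_isPathOn_sdiff (hg : Ω.InKernel g (P \ {e}))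
    (h : Ω.graph.IsPathOn a b S P) (ha : g a = 0) (hb : g b = 0) : ∀ z ∈ S, g z = 0 := by
  induction h with
  | nil => rintro z rfl; exact ha
  | @snoc b c S P f h hl hc ih =>
    have hf := h.notMem_of_inc hl.inc_right hc
    rintro z (rfl | hz)
    · exact hb
    by_cases hef : f = e
    · refine (hg.mono ?_).eq_zero_of_isPathOn h h.left_mem ha z hz
      exact fun k hk => ⟨Or.inr hk, fun hk' => hf (by rw [hef, ← hk']; exact hk)⟩
    · refine ih (hg.mono (Set.sdiff_subset_sdiff_left (Set.subset_insert _ _))) ?_ z hz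
      have := hg f ⟨Or.inl rfl, hef⟩ _ _ hl
      rwa [hb, smul_zero] at this

theorem InKernel.eq_zero_of_isCycleSet_sdiff (hg : Ω.InKernel g (C \ {e}))
    (hC : Ω.graph.IsCycleSet C) (he : e ∈ C) (hc : c ∈ Ω.graph.vertsOf C) (h0 : g c = 0) :
    ∀ z ∈ Ω.graph.vertsOf C, g z = 0 := by
  obtain ⟨a, b, P, hP, heP, -, hCP⟩ := hC.exists_of_edge he
  refine (hg.mono ?_).eq_zero_of_isPathOn hP hc h0
  rw [hCP]
  exact fun f hf => ⟨Or.inr hf, fun h => heP (h ▸ hf)⟩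

theorem exists_potential_of_isPathOn (h : Ω.graph.IsPathOn a b S P) :
    ∃ g : α → ℤˣ, ∀ e ∈ P, ∀ x y, Ω.graph.IsLink e x y → g x = Ω.sign e * g y := by
  classical
  induction h with
  | nil => exact ⟨1, by simp⟩
  | @snoc b c S P e h hl hc ih =>
    obtain ⟨g, hg⟩ := ih
    have hbc : b ≠ c := fun hh => hc (hh ▸ h.right_mem)
    refine ⟨Function.update g c (Ω.sign e * g b), ?_⟩
    rintro f (rfl | hf) x y hxy
    · rcases hxy.eq_and_eq_or_eq_and_eq hl with ⟨rfl, rfl⟩ | ⟨rfl, rfl⟩ <;>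
        simp [hbc, ← mul_assoc, Int.units_mul_self]
    · have hx : x ≠ c := fun hx => hc (hx ▸ h.inc_mem hf hxy.inc_left)
      have hy : y ≠ c := fun hx => hc (hx ▸ h.inc_mem hf hxy.inc_right)
      simpa [hx, hy] using hg f hf x y hxy

/-- A cycle has as many vertices as edges, and for a balanced one the potential is a kernel function
without zeros. -/
theorem not_free_of_balanced (ho : ∀ e ∈ E(Ω.graph), Ω.graph.IsLink e (o e).1 (o e).2)
    (hC : C ∈ Ω.balancedCycles) : ¬ Ω.Free o C := by
  obtain ⟨hC, hs⟩ := mem_balancedCycles.1 hC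
  obtain ⟨f, hf⟩ := hC.nonempty
  obtain ⟨a, b, P, hP, hfP, hl, hCP⟩ := hC.exists_of_edge hf
  obtain ⟨g, hg⟩ := exists_potential_of_isPathOn hP
  have hab := eq_prodSign_smul hP hg
  rw [hCP, prodSign_insert hP.finite.2 hfP] at hs
  have hgf : ∀ x y, Ω.graph.IsLink f x y → g x = Ω.sign f * g y := by
    have h1 : ∀ s t u v : ℤˣ, s * t = 1 → u = t * v → u = s * v ∧ v = s * u := by decide
    have h2 := h1 _ _ _ _ hs hab
    intro x y hxy
    rcases hxy.eq_and_eq_or_eq_and_eq hl with ⟨rfl, rfl⟩ | ⟨rfl, rfl⟩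
    exacts [h2.2, h2.1]
  refine not_free_of_kernel ho hC.subset hC.finite le_rfl hC.finite_vertsOf hC.ncard_vertsOf
    (g := fun u => ((g u : ℤ) : ℚ)) (a := a) (fun e he => ?_) hP.left_mem (by simp)
  rw [cobound_eq_zero_iff (ho e (hC.subset he))]
  intro x y hxy
  have : g x = Ω.sign e * g y := by
    rw [hCP] at he
    rcases he with rfl | he
    exacts [hgf x y hxy, hg e he x y hxy]
  rw [this, Units.smul_def, zsmul_eq_mul]
  push_cast
  rfl

theorem free_sdiff_of_isCycleSet (ho : ∀ e ∈ E(Ω.graph), Ω.graph.IsLink e (o e).1 (o e).2)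
    (hC : Ω.graph.IsCycleSet C) (he : e ∈ C) : Ω.Free o (C \ {e}) := by
  obtain ⟨a, b, P, hP, hfP, hl, hCP⟩ := hC.exists_of_edge he
  refine (free_of_isPathOn ho hP).mono ?_
  rintro x ⟨hx, hxe⟩
  rw [hCP] at hx
  exact hx.resolve_left hxe

/-- One edge too many prevents freeness of `C`, and removal of any edge leaves a square system,
which is free when its kernel is trivial. Both kinds of handcuffs have this edge count. -/
theorem minimal_of_kernel (ho : ∀ e ∈ E(Ω.graph), Ω.graph.IsLink e (o e).1 (o e).2)
    (hC : C ⊆ E(Ω.graph)) (hCf : C.Finite) (hS : (Ω.graph.vertsOf C).Finite)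
    (hcard : C.ncard = (Ω.graph.vertsOf C).ncard + 1)
    (h : ∀ e ∈ C, ∀ g, Ω.InKernel g (C \ {e}) → ∀ z ∈ Ω.graph.vertsOf C, g z = 0) :
    C ⊆ E(Ω.graph) ∧ ¬ Ω.Free o C ∧ ∀ e ∈ C, Ω.Free o (C \ {e}) := by
  refine ⟨hC, not_free_of_ncard_lt ho hC hCf le_rfl hS (by omega), fun e he => ?_⟩
  refine free_of_kernel ho (Set.sdiff_subset.trans hC) (hCf.subset Set.sdiff_subset)
    (Graph.vertsOf_mono Set.sdiff_subset) hS ?_ (h e he)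
  rw [Set.ncard_sdiff_singleton_of_mem he]
  omega

/-- When an edge is removed, the other cycle is intact and unbalanced, so kernel functions vanish on
it. The zero at the common vertex spreads over the damaged cycle, which has become a path. -/
theorem minimal_of_tight (ho : ∀ e ∈ E(Ω.graph), Ω.graph.IsLink e (o e).1 (o e).2)
    (hC₁ : Ω.graph.IsCycleSet C₁) (hb₁ : C₁ ∉ Ω.balancedCycles)
    (hC₂ : Ω.graph.IsCycleSet C₂) (hb₂ : C₂ ∉ Ω.balancedCycles) (hd : Disjoint C₁ C₂)
    (hi : Ω.graph.vertsOf C₁ ∩ Ω.graph.vertsOf C₂ = {a}) :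
    C₁ ∪ C₂ ⊆ E(Ω.graph) ∧ ¬ Ω.Free o (C₁ ∪ C₂) ∧ ∀ e ∈ C₁ ∪ C₂, Ω.Free o ((C₁ ∪ C₂) \ {e}) := by
  have ha : a ∈ Ω.graph.vertsOf C₁ ∩ Ω.graph.vertsOf C₂ := hi ▸ rfl
  refine minimal_of_kernel ho (Set.union_subset hC₁.subset hC₂.subset) (hC₁.finite.union hC₂.finite)
    ?_ ?_ ?_
  · rw [Graph.vertsOf_union]
    exact hC₁.finite_vertsOf.union hC₂.finite_vertsOf
  · rw [Graph.vertsOf_union, Set.ncard_union_eq hd hC₁.finite hC₂.finite]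
    have := Set.ncard_union_add_ncard_inter _ _ hC₁.finite_vertsOf hC₂.finite_vertsOf
    rw [hi, Set.ncard_singleton, hC₁.ncard_vertsOf, hC₂.ncard_vertsOf] at this
    exact this.symm
  · intro e he g hg
    rw [Graph.vertsOf_union]
    have h1 : C₁ \ {e} ⊆ (C₁ ∪ C₂) \ {e} := Set.sdiff_subset_sdiff_left Set.subset_union_left
    have h2 : C₂ \ {e} ⊆ (C₁ ∪ C₂) \ {e} := Set.sdiff_subset_sdiff_left Set.subset_union_right
    by_cases he1 : e ∈ C₁
    · have he2 : e ∉ C₂ := Set.disjoint_left.1 hd he1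
      rw [Set.sdiff_singleton_eq_self he2] at h2
      have z2 := (hg.mono h2).eq_zero_of_unbalanced hC₂ hb₂
      have z1 := (hg.mono h1).eq_zero_of_isCycleSet_sdiff hC₁ he1 ha.1 (z2 a ha.2)
      rintro z (hz | hz)
      exacts [z1 z hz, z2 z hz]
    · have he2 : e ∈ C₂ := he.resolve_left he1
      rw [Set.sdiff_singleton_eq_self he1] at h1
      have z1 := (hg.mono h1).eq_zero_of_unbalanced hC₁ hb₁
      have z2 := (hg.mono h2).eq_zero_of_isCycleSet_sdiff hC₂ he2 ha.2 (z1 a ha.1)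
      rintro z (hz | hz)
      exacts [z1 z hz, z2 z hz]

theorem minimal_of_loose (ho : ∀ e ∈ E(Ω.graph), Ω.graph.IsLink e (o e).1 (o e).2)
    (hC₁ : Ω.graph.IsCycleSet C₁) (hb₁ : C₁ ∉ Ω.balancedCycles)
    (hC₂ : Ω.graph.IsCycleSet C₂) (hb₂ : C₂ ∉ Ω.balancedCycles)
    (hd : Disjoint (Ω.graph.vertsOf C₁) (Ω.graph.vertsOf C₂)) (hP : Ω.graph.IsPathSet P a b)
    (h₁ : Ω.graph.vertsOf P ∩ Ω.graph.vertsOf C₁ = {a})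
    (h₂ : Ω.graph.vertsOf P ∩ Ω.graph.vertsOf C₂ = {b}) :
    C₁ ∪ C₂ ∪ P ⊆ E(Ω.graph) ∧ ¬ Ω.Free o (C₁ ∪ C₂ ∪ P) ∧
      ∀ e ∈ C₁ ∪ C₂ ∪ P, Ω.Free o ((C₁ ∪ C₂ ∪ P) \ {e}) := by
  have ha : a ∈ Ω.graph.vertsOf P ∩ Ω.graph.vertsOf C₁ := h₁ ▸ rfl
  have hb : b ∈ Ω.graph.vertsOf P ∩ Ω.graph.vertsOf C₂ := h₂ ▸ rfl
  have hab : a ≠ b := fun h => Set.disjoint_left.1 hd ha.2 (h ▸ hb.2)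
  obtain ⟨S, hp⟩ := hP.exists_isPathOn
  have hSP := hp.vertsOf_eq hab
  have d12 := Graph.disjoint_of_disjoint_vertsOf hC₁.subset hd
  have dP1 : Disjoint P C₁ := hp.disjoint_of_inter_subset (u := a) (by rw [← hSP, h₁])
  have dP2 : Disjoint P C₂ := hp.disjoint_of_inter_subset (u := b) (by rw [← hSP, h₂])
  have hfin := hC₁.finite_vertsOf.union hC₂.finite_vertsOf
  have hfinP : (Ω.graph.vertsOf P).Finite := hSP ▸ hp.finite.1
  refine minimal_of_kernel ho
    (Set.union_subset (Set.union_subset hC₁.subset hC₂.subset) hp.edge_subset)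
    ((hC₁.finite.union hC₂.finite).union hp.finite.2) ?_ ?_ ?_
  · rw [Graph.vertsOf_union, Graph.vertsOf_union]
    exact hfin.union hfinP
  · rw [Graph.vertsOf_union, Graph.vertsOf_union,
      Set.ncard_union_eq (Set.disjoint_union_left.2 ⟨dP1.symm, dP2.symm⟩)
        (hC₁.finite.union hC₂.finite) hp.finite.2, Set.ncard_union_eq d12 hC₁.finite hC₂.finite]
    have h3 := Set.ncard_union_add_ncard_inter _ _ hfin hfinP
    have h4 := Set.ncard_union_eq hd hC₁.finite_vertsOf hC₂.finite_vertsOf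
    rw [Set.inter_comm, Set.inter_union_distrib_left, h₁, h₂, Set.singleton_union,
      Set.ncard_pair hab, h4, hC₁.ncard_vertsOf, hC₂.ncard_vertsOf] at h3
    have h5 := hp.ncard_eq
    rw [← hSP] at h5
    omega
  · intro e he g hg
    rw [Graph.vertsOf_union, Graph.vertsOf_union]
    have s1 : C₁ \ {e} ⊆ (C₁ ∪ C₂ ∪ P) \ {e} := Set.sdiff_subset_sdiff_left
      (Set.subset_union_left.trans Set.subset_union_left)
    have s2 : C₂ \ {e} ⊆ (C₁ ∪ C₂ ∪ P) \ {e} := Set.sdiff_subset_sdiff_left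
      (Set.subset_union_right.trans Set.subset_union_left)
    have sP : P \ {e} ⊆ (C₁ ∪ C₂ ∪ P) \ {e} := Set.sdiff_subset_sdiff_left Set.subset_union_right
    have u1 : e ∉ C₁ → ∀ z ∈ Ω.graph.vertsOf C₁, g z = 0 := fun h => by
      rw [Set.sdiff_singleton_eq_self h] at s1
      exact (hg.mono s1).eq_zero_of_unbalanced hC₁ hb₁
    have u2 : e ∉ C₂ → ∀ z ∈ Ω.graph.vertsOf C₂, g z = 0 := fun h => by
      rw [Set.sdiff_singleton_eq_self h] at s2
      exact (hg.mono s2).eq_zero_of_unbalanced hC₂ hb₂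
    have uP : e ∉ P → ∀ c ∈ Ω.graph.vertsOf P, g c = 0 → ∀ z ∈ Ω.graph.vertsOf P, g z = 0 :=
      fun h => by
        rw [Set.sdiff_singleton_eq_self h] at sP
        rw [hSP]
        exact fun c hc => (hg.mono sP).eq_zero_of_isPathOn hp hc
    by_cases he1 : e ∈ C₁
    · have z2 := u2 (Set.disjoint_left.1 d12 he1)
      have zP := uP (Set.disjoint_right.1 dP1 he1) b hb.1 (z2 b hb.2)
      have z1 := (hg.mono s1).eq_zero_of_isCycleSet_sdiff hC₁ he1 ha.2 (zP a ha.1)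
      rintro z ((hz | hz) | hz)
      exacts [z1 z hz, z2 z hz, zP z hz]
    have z1 := u1 he1
    by_cases he2 : e ∈ C₂
    · have zP := uP (Set.disjoint_right.1 dP2 he2) a ha.1 (z1 a ha.2)
      have z2 := (hg.mono s2).eq_zero_of_isCycleSet_sdiff hC₂ he2 hb.2 (zP b hb.1)
      rintro z ((hz | hz) | hz)
      exacts [z1 z hz, z2 z hz, zP z hz]
    have z2 := u2 he2
    have zP := (hg.mono sP).eq_zero_of_isPathOn_sdiff hp (z1 a ha.2) (z2 b hb.2)
    rw [← hSP] at zP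
    rintro z ((hz | hz) | hz)
    exacts [z1 z hz, z2 z hz, zP z hz]

/-- Thetas with only unbalanced cycles do not occur in signed graphs; the other types are minimal
non-free by counting and kernel arguments. Conversely a non-free set contains a frame circuit. -/
theorem isFrameCircuit_iff (hE : E(Ω.graph).Finite)
    (ho : ∀ e ∈ E(Ω.graph), Ω.graph.IsLink e (o e).1 (o e).2) :
    Ω.graph.IsFrameCircuit Ω.balancedCycles C ↔
      C ⊆ E(Ω.graph) ∧ ¬ Ω.Free o C ∧ ∀ e ∈ C, Ω.Free o (C \ {e}) := by
  have hmp : ∀ C, Ω.graph.IsFrameCircuit Ω.balancedCycles C →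
      C ⊆ E(Ω.graph) ∧ ¬ Ω.Free o C ∧ ∀ e ∈ C, Ω.Free o (C \ {e}) := by
    rintro C (⟨hC, hb⟩ | ⟨C₁, C₂, u, hC₁, hb₁, hC₂, hb₂, hd, hi, rfl⟩ |
      ⟨C₁, C₂, P, u₁, u₂, hC₁, hb₁, hC₂, hb₂, hd, hP, h₁, h₂, rfl⟩ |
      ⟨P₁, P₂, P₃, x, y, hxy, h₁, h₂, h₃, d12, d13, d23, i12, i13, i23, rfl, h⟩)
    · exact ⟨hC.subset, not_free_of_balanced ho hb, fun e he => free_sdiff_of_isCycleSet ho hC he⟩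
    · exact minimal_of_tight ho hC₁ hb₁ hC₂ hb₂ hd hi
    · exact minimal_of_loose ho hC₁ hb₁ hC₂ hb₂ hd hP h₁ h₂
    · obtain ⟨S₁, h₁⟩ := h₁.exists_isPathOn
      obtain ⟨S₂, h₂⟩ := h₂.exists_isPathOn
      obtain ⟨S₃, h₃⟩ := h₃.exists_isPathOn
      rw [h₁.vertsOf_eq hxy, h₂.vertsOf_eq hxy] at i12
      rw [h₁.vertsOf_eq hxy, h₃.vertsOf_eq hxy] at i13
      rw [h₂.vertsOf_eq hxy, h₃.vertsOf_eq hxy] at i23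
      exact (false_of_theta h₁ h₂ h₃ hxy d12 d13 d23 i12.subset i13.subset i23.subset h).elim
  refine ⟨hmp C, fun ⟨hC, hF, hm⟩ => ?_⟩
  by_contra hcon
  -- A circuit properly inside `C` would omit an edge of `C` and hence be free.
  refine hF (free_of_forall_not_isFrameCircuit ho (hE.subset hC) hC fun D hD hDc => ?_)
  rcases hD.eq_or_ssubset with rfl | hss
  · exact hcon hDc
  · obtain ⟨e, heC, heD⟩ := Set.exists_of_ssubset hss
    exact (hmp D hDc).2.1 ((hm e heC).mono fun f hf => ⟨hD hf, fun h => heD (h ▸ hf)⟩)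

/-! ### Matroids -/

/-- This is the exchange property of independent columns. If no edge of `D` extends `C`, then every
function in the kernel of `C` is in the kernel of `D`, and rank-nullity gives `D.ncard ≤ C.ncard`.
-/
theorem Free.exists_insert (hE : E(Ω.graph).Finite)
    (ho : ∀ e ∈ E(Ω.graph), Ω.graph.IsLink e (o e).1 (o e).2) (hC : C ⊆ E(Ω.graph))
    (hD : D ⊆ E(Ω.graph)) (hCF : Ω.Free o C) (hDF : Ω.Free o D) (hCD : C.ncard < D.ncard) :
    ∃ e ∈ D, e ∉ C ∧ Ω.Free o (insert e C) := by
  by_contra! hcon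
  have hker : ∀ g, (∀ e ∈ C, Ω.cobound o g e = 0) → ∀ e ∈ D, Ω.cobound o g e = 0 := by
    intro g hg e he
    by_contra hne
    by_cases heC : e ∈ C
    · exact hne (hg e heC)
    · exact hcon e he heC (hCF.free_insert hg hne)
  let S := (fun e => (o e).1) '' E(Ω.graph) ∪ (fun e => (o e).2) '' E(Ω.graph)
  have hS : Ω.graph.vertsOf E(Ω.graph) ⊆ S := by
    rintro x ⟨e, he, hx⟩
    rcases hx.eq_or_eq_of_isLink (ho e he) with rfl | rfl
    exacts [Or.inl ⟨e, he, rfl⟩, Or.inr ⟨e, he, rfl⟩]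
  have hSf : S.Finite := (hE.image _).union (hE.image _)
  obtain ⟨L, hL, hL'⟩ := exists_linearMap ho hC ((Graph.vertsOf_mono hC).trans hS)
  obtain ⟨M, hM, hM'⟩ := exists_linearMap ho hD ((Graph.vertsOf_mono hD).trans hS)
  have := hSf.fintype
  have := (hE.subset hC).fintype
  have := (hE.subset hD).fintype
  have hle : LinearMap.ker L ≤ LinearMap.ker M := by
    classical
    intro g hg
    let g' : α → ℚ := fun u => if hu : u ∈ S then g ⟨u, hu⟩ else 0
    have hgg : g = fun u : S => g' u := by
      funext u; simp [g', u.2]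
    rw [LinearMap.mem_ker] at hg ⊢
    rw [hgg] at hg ⊢
    rw [hL'] at hg
    rw [hM']
    exact funext fun e => hker g' (fun e he => congrFun hg ⟨e, he⟩) e e.2
  have h1 := LinearMap.finrank_range_add_finrank_ker L
  have h2 := LinearMap.finrank_range_add_finrank_ker M
  rw [LinearMap.range_eq_top.2 (hL.2 hCF), finrank_top] at h1
  rw [LinearMap.range_eq_top.2 (hM.2 hDF), finrank_top] at h2
  rw [Module.finrank_fintype_fun_eq_card, Fintype.card_eq_nat_card] at h1 h2
  have h3 := Submodule.finrank_mono hle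
  have h4 : Nat.card C < Nat.card D := hCD
  omega

theorem exists_isFrameMatroid (hE : E(Ω.graph).Finite)
    (ho : ∀ e ∈ E(Ω.graph), Ω.graph.IsLink e (o e).1 (o e).2) :
    ∃ M : Matroid β, M.E = E(Ω.graph) ∧
      (∀ C, M.IsCircuit C ↔ C ⊆ E(Ω.graph) ∧ ¬ Ω.Free o C ∧ ∀ e ∈ C, Ω.Free o (C \ {e})) ∧
      Ω.graph.IsFrameMatroid Ω.balancedCycles M := by
  let I := IndepMatroid.ofFinite hE (fun D => D ⊆ E(Ω.graph) ∧ Ω.Free o D)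
    ⟨Set.empty_subset _, fun t => ⟨0, by simp⟩⟩
    (fun _ _ hJ hIJ => ⟨hIJ.trans hJ.1, hJ.2.mono hIJ⟩)
    (fun _ _ hI hJ hlt => by
      obtain ⟨e, he, heI, hF⟩ := hI.2.exists_insert hE ho hI.1 hJ.1 hJ.2 hlt
      exact ⟨e, he, heI, Set.insert_subset (hJ.1 he) hI.1, hF⟩)
    (fun _ hI => hI.1)
  have hM : ∀ C, I.matroid.IsCircuit C ↔
      C ⊆ E(Ω.graph) ∧ ¬ Ω.Free o C ∧ ∀ e ∈ C, Ω.Free o (C \ {e}) := by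
    intro C
    rw [Matroid.isCircuit_iff_dep_forall_sdiff_singleton_indep, Matroid.dep_iff]
    simp only [I, IndepMatroid.matroid_Indep, IndepMatroid.ofFinite_indep, IndepMatroid.matroid_E,
      IndepMatroid.ofFinite_E]
    constructor
    · rintro ⟨⟨h1, h2⟩, h3⟩
      exact ⟨h2, fun h => h1 ⟨h2, h⟩, fun e he => (h3 e he).2⟩
    · rintro ⟨h1, h2, h3⟩
      exact ⟨⟨fun h => h2 h.2, h1⟩, fun e he => ⟨Set.sdiff_subset.trans h1, h3 e he⟩⟩
  exact ⟨I.matroid, rfl, hM, rfl, fun C => (hM C).trans (isFrameCircuit_iff hE ho).symm⟩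

/-- The graph `G` with all edges labelled `1`. -/
def positive (G : Graph α β) : SignedGraph α β := ⟨G, 1⟩

/-- There are no unbalanced cycles, so neither handcuffs nor thetas contribute; cycle matroids can
therefore be treated as frame matroids. -/
theorem positive_isFrameCircuit_iff {G : Graph α β} :
    (positive G).graph.IsFrameCircuit (positive G).balancedCycles C ↔ G.IsCycleSet C := by
  have hb : ∀ C, G.IsCycleSet C → C ∈ (positive G).balancedCycles := by
    intro C hC
    rw [mem_balancedCycles]
    exact ⟨hC, prodSign_eq_one (g := 1) hC fun _ _ _ _ _ => rfl⟩
  constructor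
  · rintro (⟨hC, -⟩ | ⟨C₁, C₂, u, hC₁, hb₁, -⟩ | ⟨C₁, C₂, P, u₁, u₂, hC₁, hb₁, -⟩ |
      ⟨P₁, P₂, P₃, x, y, hxy, h₁, h₂, -, d12, -, -, i12, -, -, rfl, h⟩)
    · exact hC
    · exact absurd (hb _ hC₁) hb₁
    · exact absurd (hb _ hC₁) hb₁
    · obtain ⟨S₁, h₁⟩ := h₁.exists_isPathOn
      obtain ⟨S₂, h₂⟩ := h₂.exists_isPathOn
      rw [h₁.vertsOf_eq hxy, h₂.vertsOf_eq hxy] at i12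
      have := h₁.union_isCycleSet h₂ hxy i12.subset d12
      exact absurd (hb _ this) (h _ Set.subset_union_left this)
  · exact fun h => Or.inl ⟨h, hb C h⟩

/-- If the incidence matrices of `Ω` and of `H` have the same row space up to a scaling of the
columns, then the frame matroid of `Ω` is the cycle matroid of `H`. -/
theorem frameEqCycle_of_cobound {H : Graph γ β} {oH : β → γ × γ} {r : β → ℚ}
    (hE : E(Ω.graph).Finite)
    (ho : ∀ e ∈ E(Ω.graph), Ω.graph.IsLink e (o e).1 (o e).2) (hEH : E(H) = E(Ω.graph))
    (hoH : ∀ e ∈ E(H), H.IsLink e (oH e).1 (oH e).2) (hr : ∀ e, r e ≠ 0)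
    (h₁ : ∀ h : α → ℚ, ∃ g : γ → ℚ, ∀ e ∈ E(H), g (oH e).1 - g (oH e).2 = r e * Ω.cobound o h e)
    (h₂ : ∀ g : γ → ℚ, ∃ h : α → ℚ, ∀ e ∈ E(H), g (oH e).1 - g (oH e).2 = r e * Ω.cobound o h e) :
    Ω.FrameEqCycle H := by
  have hF : ∀ D ⊆ E(H), (positive H).Free oH D ↔ Ω.Free o D := by
    have hc : ∀ g e, (positive H).cobound oH g e = g (oH e).1 - g (oH e).2 := fun g e => by
      simp [cobound, positive]
    intro D hD
    constructor
    · intro h t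
      obtain ⟨g, hg⟩ := h fun e => r e * t e
      obtain ⟨k, hk⟩ := h₂ g
      refine ⟨k, fun e he => mul_left_cancel₀ (hr e) ?_⟩
      rw [← hk e (hD he), ← hc, hg e he]
    · intro h t
      obtain ⟨k, hk⟩ := h fun e => (r e)⁻¹ * t e
      obtain ⟨g, hg⟩ := h₁ k
      refine ⟨g, fun e he => ?_⟩
      rw [hc, hg e (hD he), hk e he, mul_inv_cancel_left₀ (hr e)]
  obtain ⟨M, hME, hMC, hM⟩ := exists_isFrameMatroid hE ho
  refine ⟨M, hM, hME.trans hEH.symm, fun C => ?_⟩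
  rw [hMC, ← positive_isFrameCircuit_iff,
    isFrameCircuit_iff (o := oH) (Ω := positive H) (hEH ▸ hE) hoH]
  change _ ↔ C ⊆ E(H) ∧ _
  rw [hEH]
  refine and_congr_right fun hC => ?_
  rw [← hEH] at hC
  rw [hF C hC]
  exact and_congr_right fun _ => forall₂_congr fun e _ =>
    (hF _ (Set.sdiff_subset.trans hC)).symm

end SignedGraph

namespace Graph

variable {α β γ : Type*} {G K L : Graph α β} {a b u w x y : α} {S T : Set α}
  {A B C D P Q X Y Z X₁ X₂ : Set β} {e f : β}

/-! ### Separations of edge sets -/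

/-- The edge set `X` is connected: any two complementary parts share a vertex. -/
def EdgeConn (G : Graph α β) (X : Set β) : Prop :=
  ∀ X₁ X₂ : Set β, X₁.Nonempty → X₂.Nonempty → Disjoint X₁ X₂ → X₁ ∪ X₂ = X →
    (G.vertsOf X₁ ∩ G.vertsOf X₂).Nonempty

/-- The edge set `X` is nonseparable: any two complementary parts share two vertices. -/
def NonSep (G : Graph α β) (X : Set β) : Prop :=
  ∀ X₁ X₂ : Set β, X₁.Nonempty → X₂.Nonempty → Disjoint X₁ X₂ → X₁ ∪ X₂ = X →
    (G.vertsOf X₁ ∩ G.vertsOf X₂).Nontrivial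

theorem NonSep.edgeConn (h : G.NonSep X) : G.EdgeConn X := fun A B hA hB hd hu =>
  (h A B hA hB hd hu).nonempty

theorem vertsOf_eq_of_le (h : K ≤ G) (hX : X ⊆ E(K)) : K.vertsOf X = G.vertsOf X := by
  ext x
  exact exists_congr fun e => and_congr_right fun he => h.inc_congr (hX he)

theorem edgeConn_iff_of_le (h : K ≤ G) (hX : X ⊆ E(K)) : K.EdgeConn X ↔ G.EdgeConn X := by
  refine forall₂_congr fun A B => forall₄_congr fun _ _ _ hu => ?_
  rw [vertsOf_eq_of_le h (Set.subset_union_left.trans (hu.subset.trans hX)),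
    vertsOf_eq_of_le h (Set.subset_union_right.trans (hu.subset.trans hX))]

theorem nonSep_iff_of_le (h : K ≤ G) (hX : X ⊆ E(K)) : K.NonSep X ↔ G.NonSep X := by
  refine forall₂_congr fun A B => forall₄_congr fun _ _ _ hu => ?_
  rw [vertsOf_eq_of_le h (Set.subset_union_left.trans (hu.subset.trans hX)),
    vertsOf_eq_of_le h (Set.subset_union_right.trans (hu.subset.trans hX))]

theorem NonSep.subset_or_subset (h : G.NonSep X) (hX : X ⊆ A ∪ B) (hd : Disjoint A B)
    (hs : (G.vertsOf A ∩ G.vertsOf B).Subsingleton) : X ⊆ A ∨ X ⊆ B := by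
  by_contra! hcon
  obtain ⟨h1, h2⟩ := hcon
  obtain ⟨e, he, heA⟩ := Set.not_subset.1 h1
  obtain ⟨f, hf, hfB⟩ := Set.not_subset.1 h2
  have := h (X ∩ A) (X ∩ B) ⟨f, hf, (hX hf).resolve_right hfB⟩ ⟨e, he, (hX he).resolve_left heA⟩
    (hd.mono Set.inter_subset_right Set.inter_subset_right)
    (by rw [← Set.inter_union_distrib_left, Set.inter_eq_left.2 hX])
  exact Set.not_subsingleton_iff.2 (this.mono (Set.inter_subset_inter
    (vertsOf_mono Set.inter_subset_right) (vertsOf_mono Set.inter_subset_right))) hs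

theorem nonSep_singleton : G.NonSep {e} := by
  rintro A B ⟨f, hf⟩ ⟨g, hg⟩ hd hu
  obtain rfl : f = e := hu.subset (Or.inl hf)
  obtain rfl : g = f := hu.subset (Or.inr hg)
  exact (Set.disjoint_left.1 hd hf hg).elim

theorem NonSep.union (hX : G.NonSep X) (hY : G.NonSep Y) (he : (X ∩ Y).Nonempty) :
    G.NonSep (X ∪ Y) := by
  intro A B hA hB hd hu
  by_contra hs
  rw [Set.not_nontrivial_iff] at hs
  obtain ⟨e, he, he'⟩ := he
  rcases hX.subset_or_subset (hu ▸ Set.subset_union_left) hd hs with h1 | h1 <;>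
    rcases hY.subset_or_subset (hu ▸ Set.subset_union_right) hd hs with h2 | h2
  · obtain ⟨f, hf⟩ := hB
    exact Set.disjoint_left.1 hd (Set.union_subset h1 h2 (hu ▸ Or.inr hf)) hf
  · exact Set.disjoint_left.1 hd (h1 he) (h2 he')
  · exact Set.disjoint_left.1 hd (h2 he') (h1 he)
  · obtain ⟨f, hf⟩ := hA
    exact Set.disjoint_left.1 hd hf (Set.union_subset h1 h2 (hu ▸ Or.inl hf))

/-- If `A` fell into two parts without common vertices, the connectivity of `X` would make both
parts meet `B`. Their common vertices with `B` coincide, a contradiction. -/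
theorem EdgeConn.of_separation (hX : G.EdgeConn X) (hd : Disjoint A B) (hu : A ∪ B = X)
    (hs : (G.vertsOf A ∩ G.vertsOf B).Subsingleton) : G.EdgeConn A := by
  intro A₁ A₂ h₁ h₂ hd' hu'
  by_contra hcon
  rw [Set.not_nonempty_iff_eq_empty] at hcon
  have key : ∀ A₁ A₂ : Set β, A₁.Nonempty → A₂.Nonempty → Disjoint A₁ A₂ → A₁ ∪ A₂ = A →
      G.vertsOf A₁ ∩ G.vertsOf A₂ = ∅ → (G.vertsOf A₂ ∩ G.vertsOf B).Nonempty := by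
    intro A₁ A₂ h₁ h₂ hd' hu' h0
    obtain ⟨z, hz, hz'⟩ := hX (A₁ ∪ B) A₂ (h₁.mono Set.subset_union_left) h₂
      (Set.disjoint_union_left.2 ⟨hd', (hd.mono_left (hu' ▸ Set.subset_union_right)).symm⟩)
      (by rw [← hu, ← hu', Set.union_right_comm])
    rw [vertsOf_union] at hz
    rcases hz with hz | hz
    · exact absurd (show z ∈ G.vertsOf A₁ ∩ G.vertsOf A₂ from ⟨hz, hz'⟩) (by simp [h0])
    · exact ⟨z, hz', hz⟩
  obtain ⟨z, hz⟩ := key A₁ A₂ h₁ h₂ hd' hu' hcon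
  obtain ⟨y, hy⟩ := key A₂ A₁ h₂ h₁ hd'.symm (by rwa [Set.union_comm])
    (by rwa [Set.inter_comm])
  have hm1 : G.vertsOf A₁ ⊆ G.vertsOf A := vertsOf_mono (hu' ▸ Set.subset_union_left)
  have hm2 : G.vertsOf A₂ ⊆ G.vertsOf A := vertsOf_mono (hu' ▸ Set.subset_union_right)
  obtain rfl := hs ⟨hm2 hz.1, hz.2⟩ ⟨hm1 hy.1, hy.2⟩
  exact absurd (show z ∈ G.vertsOf A₁ ∩ G.vertsOf A₂ from ⟨hy.1, hz.1⟩) (by simp [hcon])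

theorem EdgeConn.exists_inter_eq_singleton (hX : G.EdgeConn X) (hA : A.Nonempty) (hB : B.Nonempty)
    (hd : Disjoint A B) (hu : A ∪ B = X) (hs : (G.vertsOf A ∩ G.vertsOf B).Subsingleton) :
    ∃ w, G.vertsOf A ∩ G.vertsOf B = {w} := by
  obtain ⟨w, hw⟩ := hX A B hA hB hd hu
  exact ⟨w, Set.eq_singleton_iff_unique_mem.2 ⟨hw, fun z hz => hs hz hw⟩⟩

/-- Two edges which are not separated by a cut-vertex lie in a common nonseparable set. -/
theorem EdgeConn.separation_or_nonSep (hXf : X.Finite) (hX : G.EdgeConn X) (he : e ∈ X)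
    (hf : f ∈ X) :
    (∃ A B w, Disjoint A B ∧ A ∪ B = X ∧ G.vertsOf A ∩ G.vertsOf B = {w} ∧ e ∈ A ∧ f ∈ B) ∨
      ∃ Z ⊆ X, G.NonSep Z ∧ e ∈ Z ∧ f ∈ Z := by
  induction hn : X.ncard using Nat.strong_induction_on generalizing X with
  | _ n ih =>
  subst hn
  by_cases hN : G.NonSep X
  · exact Or.inr ⟨X, le_rfl, hN, he, hf⟩
  -- If a separation keeps `e` and `f` on the same side `A`, induction applies to `A`, and a
  -- separation found there is extended to `X`.
  have key : ∀ A B : Set β, B.Nonempty → Disjoint A B → A ∪ B = X →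
      (G.vertsOf A ∩ G.vertsOf B).Subsingleton → e ∈ A → f ∈ A →
      (∃ A B w, Disjoint A B ∧ A ∪ B = X ∧ G.vertsOf A ∩ G.vertsOf B = {w} ∧ e ∈ A ∧ f ∈ B) ∨
      ∃ Z ⊆ X, G.NonSep Z ∧ e ∈ Z ∧ f ∈ Z := by
    intro A B hB hd hu hs heA hfA
    have hAX : A ⊆ X := hu ▸ Set.subset_union_left
    have hlt : A.ncard < X.ncard := by
      refine Set.ncard_lt_ncard ⟨hAX, fun h => ?_⟩ hXf
      obtain ⟨g, hg⟩ := hB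
      exact Set.disjoint_left.1 hd (h (hu ▸ Or.inr hg)) hg
    obtain ⟨w, hw⟩ := hX.exists_inter_eq_singleton ⟨e, heA⟩ hB hd hu hs
    have hww : ∀ z, z ∈ G.vertsOf A → z ∈ G.vertsOf B → z = w := fun z h h' => by
      have : z ∈ G.vertsOf A ∩ G.vertsOf B := ⟨h, h'⟩
      rwa [hw] at this
    rcases ih _ hlt (hXf.subset hAX) (hX.of_separation hd hu hs) heA hfA rfl with
      ⟨A₁, A₂, w', hd', hu', hw', he', hf'⟩ | ⟨Z, hZ, h⟩
    · left
      have hA₁ : A₁ ⊆ A := hu' ▸ Set.subset_union_left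
      have hA₂ : A₂ ⊆ A := hu' ▸ Set.subset_union_right
      by_cases hwA : w ∈ G.vertsOf A₁
      · refine ⟨A₁ ∪ B, A₂, w', Set.disjoint_union_left.2 ⟨hd', (hd.mono_left hA₂).symm⟩,
          by rw [← hu, ← hu', Set.union_right_comm], ?_, Or.inl he', hf'⟩
        rw [vertsOf_union, Set.union_inter_distrib_right, hw', Set.union_eq_left]
        rintro z ⟨hz, hz'⟩
        obtain rfl := hww z (vertsOf_mono hA₂ hz') hz
        rw [← hw']
        exact ⟨hwA, hz'⟩
      · refine ⟨A₁, A₂ ∪ B, w', Set.disjoint_union_right.2 ⟨hd', hd.mono_left hA₁⟩,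
          by rw [← hu, ← hu', Set.union_assoc], ?_, he', Or.inl hf'⟩
        rw [vertsOf_union, Set.inter_union_distrib_left, hw', Set.union_eq_left]
        rintro z ⟨hz, hz'⟩
        obtain rfl := hww z (vertsOf_mono hA₁ hz) hz'
        exact absurd hz hwA
    · exact Or.inr ⟨Z, hZ.trans hAX, h⟩
  simp only [NonSep, not_forall] at hN
  obtain ⟨A, B, hA, hB, hd, hu, hs⟩ := hN
  rw [Set.not_nontrivial_iff] at hs
  obtain ⟨w, hw⟩ := hX.exists_inter_eq_singleton hA hB hd hu hs
  rw [← hu] at he hf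
  rcases he with he | he <;> rcases hf with hf | hf
  · exact key A B hB hd hu hs he hf
  · exact Or.inl ⟨A, B, w, hd, hu, hw, he, hf⟩
  · exact Or.inl ⟨B, A, w, hd.symm, by rwa [Set.union_comm], by rwa [Set.inter_comm], he, hf⟩
  · exact key B A hA hd.symm (by rwa [Set.union_comm]) (by rwa [Set.inter_comm]) he hf

/-! ### Connected subgraphs and blocks -/

theorem Connected.edgeConn (h : K.Connected) : K.EdgeConn E(K) := by
  rintro A B ⟨e, he⟩ ⟨f, hf⟩ hd hu
  by_contra hcon
  rw [Set.not_nonempty_iff_eq_empty] at hcon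
  obtain ⟨x, x', hx⟩ := K.exists_isLink_of_mem_edgeSet (hu.subset (Or.inl he))
  obtain ⟨y, y', hy⟩ := K.exists_isLink_of_mem_edgeSet (hu.subset (Or.inr hf))
  have hno : ∀ z, z ∈ K.vertsOf A → z ∈ K.vertsOf B → False := fun z h h' => by
    have : z ∈ K.vertsOf A ∩ K.vertsOf B := ⟨h, h'⟩
    rwa [hcon] at this
  have hr : ∀ z, Relation.ReflTransGen K.Adj x z → z ∈ K.vertsOf A := by
    intro z hz
    induction hz with
    | refl => exact ⟨e, he, hx.inc_left⟩
    | tail _ h ih =>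
      obtain ⟨g, hg⟩ := h
      rcases hu.symm.subset hg.edge_mem with hgA | hgB
      · exact ⟨g, hgA, hg.inc_right⟩
      · exact (hno _ ih ⟨g, hgB, hg.inc_left⟩).elim
  exact hno y (hr y (h.2 x hx.left_mem y hy.left_mem)) ⟨f, hf, hy.inc_left⟩

end Graph

namespace Graph

variable {α β γ : Type*} {G K L : Graph α β} {a b u w x y : α} {S T : Set α}
  {A B C D P Q X Y Z X₁ X₂ : Set β} {e f : β}

theorem Connected.vertsOf_eq (h : K.Connected) (hE : E(K).Nonempty) : K.vertsOf E(K) = V(K) := by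
  refine Set.Subset.antisymm (fun x ⟨e, _, hx⟩ => hx.vertex_mem) fun x hx => ?_
  obtain ⟨e, he⟩ := hE
  obtain ⟨u, w, hl⟩ := K.exists_isLink_of_mem_edgeSet he
  rcases (h.2 u hl.left_mem x hx).cases_tail with rfl | ⟨z, -, f, hf⟩
  · exact ⟨e, he, hl.inc_left⟩
  · exact ⟨f, hf.edge_mem, hf.inc_right⟩

theorem connected_of_edgeConn (h : K.EdgeConn E(K)) (hV : V(K) ⊆ K.vertsOf E(K))
    (hne : V(K).Nonempty) : K.Connected := by
  refine ⟨hne, fun x hx y hy => ?_⟩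
  let A := {e ∈ E(K) | ∃ u, K.Inc e u ∧ Relation.ReflTransGen K.Adj x u}
  have hA : ∀ e ∈ A, ∀ u, K.Inc e u → Relation.ReflTransGen K.Adj x u := by
    rintro e ⟨-, u, ⟨z, hz⟩, hu⟩ w hw
    rcases hw.eq_or_eq_of_isLink hz with rfl | rfl
    exacts [hu, hu.tail hz.adj]
  by_contra hcon
  obtain ⟨e, he, hex⟩ := hV hx
  obtain ⟨f, hf, hfy⟩ := hV hy
  obtain ⟨z, ⟨g, hg, hgz⟩, ⟨g', hg', hgz'⟩⟩ := h A (E(K) \ A) ⟨e, he, x, hex, .refl⟩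
    ⟨f, hf, fun h => hcon (hA f h y hfy)⟩ Set.disjoint_sdiff_right
    (Set.union_sdiff_cancel fun e he => he.1)
  exact hg'.2 ⟨hg'.1, z, hgz', hA g hg z hgz⟩

/-- The subgraph formed by the edges in `X` and their ends. -/
def edgeSubgraph (G : Graph α β) (X : Set β) : Graph α β where
  vertexSet := G.vertsOf X
  IsLink e x y := e ∈ X ∧ G.IsLink e x y
  isLink_symm := fun _ _ => ⟨fun _ _ h => ⟨h.1, h.2.symm⟩⟩
  eq_or_eq_of_isLink_of_isLink := fun _ _ _ _ _ h h' => G.eq_or_eq_of_isLink_of_isLink h.2 h'.2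
  left_mem_of_isLink := fun e _ _ h => ⟨e, h.1, h.2.inc_left⟩

theorem edgeSet_edgeSubgraph (hX : X ⊆ E(G)) : E(G.edgeSubgraph X) = X := by
  ext e
  constructor
  · intro h
    obtain ⟨x, y, hl⟩ := exists_isLink_of_mem_edgeSet h
    exact hl.1
  · intro h
    obtain ⟨x, y, hl⟩ := exists_isLink_of_mem_edgeSet (hX h)
    exact IsLink.edge_mem (G := G.edgeSubgraph X) (x := x) (y := y) ⟨h, hl⟩

theorem edgeSubgraph_le : G.edgeSubgraph X ≤ G :=
  ⟨fun _ ⟨_, _, h⟩ => h.vertex_mem, fun _ _ _ h => h.2⟩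

theorem edgeSubgraph_le_of_le (hK : K ≤ G) (hX : X ⊆ E(K)) : G.edgeSubgraph X ≤ K := by
  refine (Compatible.of_le_le edgeSubgraph_le hK).le_iff.2 ⟨?_, ?_⟩
  · rintro x ⟨e, he, hx⟩
    exact ((hK.inc_congr (hX he)).2 hx).vertex_mem
  · rwa [edgeSet_edgeSubgraph (hX.trans hK.edgeSet_mono)]

theorem Connected.eq_edgeSubgraph (hK : K.Connected) (hKG : K ≤ G) (hE : E(K).Nonempty) :
    K = G.edgeSubgraph E(K) := by
  refine le_antisymm ((Compatible.of_le_le hKG edgeSubgraph_le).le_iff.2 ⟨?_, ?_⟩)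
    (edgeSubgraph_le_of_le hKG le_rfl)
  · rw [← hK.vertsOf_eq hE, vertsOf_eq_of_le hKG le_rfl]
    exact le_rfl
  · rw [edgeSet_edgeSubgraph hKG.edgeSet_mono]

theorem not_isCutVertex_iff_nonSep (hK : K.Connected) : (∀ w, ¬ K.IsCutVertex w) ↔ K.NonSep E(K) := by
  constructor
  · intro h A B hA hB hd hu
    by_contra hs
    rw [Set.not_nontrivial_iff] at hs
    obtain ⟨w, hw⟩ := hK.edgeConn.exists_inter_eq_singleton hA hB hd hu hs
    exact h w ⟨A, B, by simp, by simp, hA, hB, hd, hu, hw⟩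
  · rintro h w ⟨A, B, -, -, hA, hB, hd, hu, hw⟩
    have := h A B hA hB hd hu
    rw [hw] at this
    exact Set.not_nontrivial_singleton this

theorem connected_edgeSubgraph (hX : X ⊆ E(G)) (hne : X.Nonempty) (h : G.EdgeConn X) :
    (G.edgeSubgraph X).Connected := by
  have hE := edgeSet_edgeSubgraph hX
  refine connected_of_edgeConn ?_ ?_ ?_
  · rw [hE, edgeConn_iff_of_le edgeSubgraph_le hE.superset]
    exact h
  · rw [hE, vertsOf_eq_of_le edgeSubgraph_le hE.superset]
    exact le_rfl
  · obtain ⟨e, he⟩ := hne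
    obtain ⟨x, y, hl⟩ := exists_isLink_of_mem_edgeSet (hX he)
    exact ⟨x, e, he, hl.inc_left⟩

theorem IsBlock.le (h : G.IsBlock K) : K ≤ G := h.prop.1

theorem IsBlock.connected (h : G.IsBlock K) : K.Connected := h.prop.2.1

theorem IsBlock.nonSep (h : G.IsBlock K) : G.NonSep E(K) := by
  have := (not_isCutVertex_iff_nonSep h.connected).1 h.prop.2.2
  rwa [nonSep_iff_of_le h.le le_rfl] at this

theorem edgeSubgraph_prop (hX : X ⊆ E(G)) (hne : X.Nonempty) (h : G.NonSep X) :
    G.edgeSubgraph X ≤ G ∧ (G.edgeSubgraph X).Connected ∧ ∀ w, ¬ (G.edgeSubgraph X).IsCutVertex w := by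
  have hc := connected_edgeSubgraph hX hne h.edgeConn
  have hE := edgeSet_edgeSubgraph hX
  refine ⟨edgeSubgraph_le, hc, (not_isCutVertex_iff_nonSep hc).2 ?_⟩
  rw [hE, nonSep_iff_of_le edgeSubgraph_le hE.superset]
  exact h

theorem IsBlock.eq_of_subset (h : G.IsBlock K) (hne : E(K).Nonempty) (hKX : E(K) ⊆ X)
    (hX : X ⊆ E(G)) (hN : G.NonSep X) : X = E(K) := by
  have hle : K ≤ G.edgeSubgraph X := by
    conv_lhs => rw [h.connected.eq_edgeSubgraph h.le hne]
    exact edgeSubgraph_le_of_le edgeSubgraph_le (by rwa [edgeSet_edgeSubgraph hX])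
  have := h.le_of_ge (edgeSubgraph_prop hX (hne.mono hKX) hN) hle
  have := this.edgeSet_mono
  rw [edgeSet_edgeSubgraph hX] at this
  exact this.antisymm hKX

theorem isBlock_edgeSubgraph (hX : X ⊆ E(G)) (hne : X.Nonempty) (hN : G.NonSep X)
    (hmax : ∀ Y, X ⊆ Y → Y ⊆ E(G) → G.NonSep Y → Y ⊆ X) : G.IsBlock (G.edgeSubgraph X) := by
  refine ⟨edgeSubgraph_prop hX hne hN, fun K hK hle => ?_⟩
  have hXK : X ⊆ E(K) := by
    have := hle.edgeSet_mono
    rwa [edgeSet_edgeSubgraph hX] at this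
  have hKN := (not_isCutVertex_iff_nonSep hK.2.1).1 hK.2.2
  rw [nonSep_iff_of_le hK.1 le_rfl] at hKN
  have := (hmax _ hXK hK.1.edgeSet_mono hKN).antisymm hXK
  rw [hK.2.1.eq_edgeSubgraph hK.1 (hne.mono hXK), this]

theorem exists_isBlock (hE : E(G).Finite) (hX : X ⊆ E(G)) (hne : X.Nonempty) (hN : G.NonSep X) :
    ∃ K, G.IsBlock K ∧ X ⊆ E(K) := by
  obtain ⟨Y, hXY, hY⟩ := (hE.finite_subsets.subset (fun Y (hY : Y ⊆ E(G) ∧ G.NonSep Y) =>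
    hY.1)).exists_le_maximal (a := X) ⟨hX, hN⟩
  refine ⟨G.edgeSubgraph Y, isBlock_edgeSubgraph hY.prop.1 (hne.mono hXY) hY.prop.2
    fun Z hYZ hZ hZN => hY.le_of_ge ⟨hZ, hZN⟩ hYZ, ?_⟩
  rwa [edgeSet_edgeSubgraph hY.prop.1]

/-- The union of nonseparable sets with a common edge is nonseparable, so both blocks equal it by
maximality. -/
theorem IsBlock.eq_of_mem (h : G.IsBlock K) (h' : G.IsBlock L) (he : e ∈ E(K)) (he' : e ∈ E(L)) :
    K = L := by
  have hU := h.nonSep.union h'.nonSep ⟨e, he, he'⟩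
  have hUE := Set.union_subset h.le.edgeSet_mono h'.le.edgeSet_mono
  have h1 := h.eq_of_subset ⟨e, he⟩ Set.subset_union_left hUE hU
  have h2 := h'.eq_of_subset ⟨e, he'⟩ Set.subset_union_right hUE hU
  exact (h.connected.eq_edgeSubgraph h.le ⟨e, he⟩).trans ((congrArg _ (h1.symm.trans h2)).trans
    (h'.connected.eq_edgeSubgraph h'.le ⟨e, he'⟩).symm)

/-- A block without edges would be a single vertex, and it could be enlarged by an edge at this
vertex. -/
theorem Connected.isBlock_nonempty (hG : G.Connected) (hne : E(G).Nonempty) (h : G.IsBlock K) :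
    E(K).Nonempty := by
  by_contra hcon
  rw [Set.not_nonempty_iff_eq_empty] at hcon
  obtain ⟨x, hx⟩ := h.connected.1
  have hV : V(K) ⊆ {x} := by
    intro y hy
    rcases (h.connected.2 y hy x hx).cases_head with rfl | ⟨z, ⟨f, hf⟩, -⟩
    · rfl
    · exact absurd hf.edge_mem (by simp [hcon])
  obtain ⟨e, he, hex⟩ := (hG.vertsOf_eq hne).superset (h.le.vertexSet_mono hx)
  have heE : ({e} : Set β) ⊆ E(G) := by simpa using he
  have hle : K ≤ G.edgeSubgraph {e} := by
    refine (Compatible.of_le_le h.le edgeSubgraph_le).le_iff.2 ⟨?_, by simp [hcon]⟩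
    intro y hy
    obtain rfl := hV hy
    exact ⟨e, rfl, hex⟩
  have := (h.le_of_ge (edgeSubgraph_prop heE ⟨e, rfl⟩ nonSep_singleton) hle).edgeSet_mono
  rw [edgeSet_edgeSubgraph heE, hcon] at this
  exact this rfl

theorem IsBlock.vertsOf_eq (h : G.IsBlock K) (hne : E(K).Nonempty) : G.vertsOf E(K) = V(K) := by
  rw [← h.connected.vertsOf_eq hne, vertsOf_eq_of_le h.le le_rfl]

/-- An edge of the block and an edge outside it lie in no common nonseparable set, so some
cut-vertex separates them; being an end of both, `x` is that cut-vertex. -/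
theorem IsBlock.isCutVertex (hG : G.Connected) (hE : E(G).Finite) (h : G.IsBlock K)
    (hx : x ∈ G.vertsOf E(K)) (hx' : x ∈ G.vertsOf (E(G) \ E(K))) : G.IsCutVertex x := by
  obtain ⟨e, he, hex⟩ := hx
  obtain ⟨f, hf, hfx⟩ := hx'
  rcases hG.edgeConn.separation_or_nonSep hE (h.le.edgeSet_mono he) hf.1 with
    ⟨A, B, w, hd, hu, hw, heA, hfB⟩ | ⟨Z, hZ, hN, heZ, hfZ⟩
  · have : x ∈ G.vertsOf A ∩ G.vertsOf B := ⟨⟨e, heA, hex⟩, ⟨f, hfB, hfx⟩⟩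
    rw [hw] at this
    obtain rfl := this
    exact ⟨A, B, by simp, by simp, ⟨e, heA⟩, ⟨f, hfB⟩, hd, hu, hw⟩
  · obtain ⟨L, hL, hZL⟩ := exists_isBlock hE hZ ⟨e, heZ⟩ hN
    obtain rfl := h.eq_of_mem hL he (hZL heZ)
    exact absurd (hZL hfZ) hf.2

/-- Each side of a separation contains an end-block. -/
theorem Connected.exists_isEndBlock (hG : G.Connected) (hE : E(G).Finite) (hX : X.Nonempty)
    (hY : Y.Nonempty) (hd : Disjoint X Y) (hu : X ∪ Y = E(G))
    (hw : G.vertsOf X ∩ G.vertsOf Y = {w}) : ∃ K, G.IsEndBlock K ∧ E(K) ⊆ Y := by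
  induction hn : Y.ncard using Nat.strong_induction_on generalizing X Y w with
  | _ n ih =>
  subst hn
  have hYE : Y ⊆ E(G) := hu ▸ Set.subset_union_right
  have hXE : X ⊆ E(G) := hu ▸ Set.subset_union_left
  have hs : (G.vertsOf X ∩ G.vertsOf Y).Subsingleton := by rw [hw]; exact Set.subsingleton_singleton
  have hww : ∀ z, z ∈ G.vertsOf X → z ∈ G.vertsOf Y → z = w := fun z h h' => by
    have : z ∈ G.vertsOf X ∩ G.vertsOf Y := ⟨h, h'⟩
    rwa [hw] at this
  have hwm : w ∈ G.vertsOf X ∩ G.vertsOf Y := hw ▸ rfl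
  -- A nonseparable side is itself a block: its only possible cut-vertex is `w`, since any other
  -- separation leaves `Y` whole. A separable side is cut again, and the search continues in a part
  -- away from `w`.
  by_cases hN : G.NonSep Y
  · refine ⟨G.edgeSubgraph Y, ⟨isBlock_edgeSubgraph hYE hY hN fun Z hYZ hZ hZN => ?_, ?_⟩, ?_⟩
    · rcases hZN.subset_or_subset (hZ.trans hu.superset) hd hs with h | h
      · obtain ⟨e, he⟩ := hY
        exact (Set.disjoint_left.1 hd (h (hYZ he)) he).elim
      · exact h
    · have key : ∀ u, G.IsCutVertex u ∧ u ∈ G.vertsOf Y → u = w := by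
        rintro u ⟨⟨A, B, -, -, hA, hB, hd', hu', huw⟩, hu⟩
        have hum : u ∈ G.vertsOf A ∩ G.vertsOf B := huw ▸ rfl
        have side : ∀ A B : Set β, Disjoint A B → A ∪ B = E(G) → u ∈ G.vertsOf B → Y ⊆ A →
            u = w := by
          rintro A B hd' hu' ⟨f, hf, hfu⟩ hYA
          refine hww u ⟨f, ?_, hfu⟩ hu
          refine (‹X ∪ Y = E(G)›.superset (hu'.subset (Or.inr hf))).resolve_right fun h => ?_
          exact Set.disjoint_left.1 hd' (hYA h) hf
        rcases hN.subset_or_subset (hYE.trans hu'.superset) hd'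
          (by rw [huw]; exact Set.subsingleton_singleton) with h | h
        · exact side A B hd' hu' hum.2 h
        · exact side B A hd'.symm (by rwa [Set.union_comm]) hum.1 h
      intro u hu u' hu'
      rw [key u hu, key u' hu']
    · rw [edgeSet_edgeSubgraph hYE]
  -- The part `A` containing `w` joins the far side `X`; then `B` still meets the rest in a single
  -- vertex, and is smaller than `Y`.
  · have key : ∀ A B : Set β, A.Nonempty → B.Nonempty → Disjoint A B → A ∪ B = Y →
        (G.vertsOf A ∩ G.vertsOf B).Subsingleton → w ∈ G.vertsOf A →
        ∃ K, G.IsEndBlock K ∧ E(K) ⊆ Y := by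
      intro A B hA hB hd' hu' hs' hwA
      have hYc : G.EdgeConn Y := hG.edgeConn.of_separation hd.symm (by rwa [Set.union_comm])
        (by rwa [Set.inter_comm])
      obtain ⟨w', hw'⟩ := hYc.exists_inter_eq_singleton hA hB hd' hu' hs'
      have hBY : B ⊆ Y := hu' ▸ Set.subset_union_right
      have hlt : B.ncard < Y.ncard := by
        refine Set.ncard_lt_ncard ⟨hBY, fun h => ?_⟩ (hE.subset hYE)
        obtain ⟨g, hg⟩ := hA
        exact Set.disjoint_left.1 hd' hg (h (hu' ▸ Or.inl hg))
      obtain ⟨K, hK, hKB⟩ := ih _ hlt (X := X ∪ A) (Y := B) (w := w')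
        (hX.mono Set.subset_union_left) hB
        (Set.disjoint_union_left.2 ⟨hd.mono_right hBY, hd'⟩)
        (by rw [Set.union_assoc, hu', hu]) (by
          rw [vertsOf_union, Set.union_inter_distrib_right, hw', Set.union_eq_right]
          rintro z ⟨hz, hz'⟩
          obtain rfl := hww z hz (vertsOf_mono hBY hz')
          rw [← hw']
          exact ⟨hwA, hz'⟩) rfl
      exact ⟨K, hK, hKB.trans hBY⟩
    simp only [NonSep, not_forall] at hN
    obtain ⟨A, B, hA, hB, hd', hu', hs'⟩ := hN
    rw [Set.not_nontrivial_iff] at hs'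
    have hwY := hwm.2
    rw [← hu', vertsOf_union] at hwY
    rcases hwY with h | h
    · exact key A B hA hB hd' hu' hs' h
    · exact key B A hB hA hd'.symm (by rwa [Set.union_comm]) (by rwa [Set.inter_comm]) h

/-! ### Potentials on separable sets -/

/-- Since there is at most one common vertex, adding a constant on one side makes the two functions
agree there without changing differences. -/
theorem exists_glued_potential (h₁ h₂ : α → ℚ)
    (hs : (G.vertsOf A ∩ G.vertsOf B).Subsingleton) :
    ∃ (h : α → ℚ) (c : ℚ), (∀ x ∈ G.vertsOf A, h x = h₁ x) ∧ ∀ x ∈ G.vertsOf B, h x = h₂ x + c := by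
  classical
  obtain ⟨c, hc⟩ : ∃ c, ∀ x ∈ G.vertsOf A ∩ G.vertsOf B, h₁ x = h₂ x + c := by
    rcases hs.eq_empty_or_singleton with h | ⟨w, h⟩
    · exact ⟨0, by simp [h]⟩
    · exact ⟨h₁ w - h₂ w, by simp [h]⟩
  refine ⟨fun x => if x ∈ G.vertsOf A then h₁ x else h₂ x + c, c, fun x hx => by simp [hx],
    fun x hx => ?_⟩
  by_cases hA : x ∈ G.vertsOf A
  · simp [hA, hc x ⟨hA, hx⟩]
  · simp [hA]

/-- A function on the edges which is a coboundary on each nonseparable set is a coboundary. -/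
theorem exists_potential_of_nonSep {o : β → α × α} {t : β → ℚ}
    (ho : ∀ e ∈ E(G), G.IsLink e (o e).1 (o e).2) (hXf : X.Finite) (hX : X ⊆ E(G))
    (h : ∀ Z ⊆ X, G.NonSep Z → Z.Nonempty → ∃ h : α → ℚ, ∀ e ∈ Z, t e = h (o e).1 - h (o e).2) :
    ∃ h : α → ℚ, ∀ e ∈ X, t e = h (o e).1 - h (o e).2 := by
  induction hn : X.ncard using Nat.strong_induction_on generalizing X with
  | _ n ih =>
  subst hn
  rcases X.eq_empty_or_nonempty with rfl | hne
  · exact ⟨0, by simp⟩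
  by_cases hN : G.NonSep X
  · exact h X le_rfl hN hne
  simp only [NonSep, not_forall] at hN
  obtain ⟨A, B, hA, hB, hd, hu, hs⟩ := hN
  rw [Set.not_nontrivial_iff] at hs
  have hAX : A ⊆ X := hu ▸ Set.subset_union_left
  have hBX : B ⊆ X := hu ▸ Set.subset_union_right
  have hAlt : A.ncard < X.ncard := by
    refine Set.ncard_lt_ncard ⟨hAX, fun h => ?_⟩ hXf
    obtain ⟨g, hg⟩ := hB
    exact Set.disjoint_left.1 hd (h (hBX hg)) hg
  have hBlt : B.ncard < X.ncard := by
    refine Set.ncard_lt_ncard ⟨hBX, fun h => ?_⟩ hXf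
    obtain ⟨g, hg⟩ := hA
    exact Set.disjoint_left.1 hd hg (h (hAX hg))
  obtain ⟨h₁, hh₁⟩ := ih _ hAlt (hXf.subset hAX) (hAX.trans hX) (fun Z hZ => h Z (hZ.trans hAX)) rfl
  obtain ⟨h₂, hh₂⟩ := ih _ hBlt (hXf.subset hBX) (hBX.trans hX) (fun Z hZ => h Z (hZ.trans hBX)) rfl
  obtain ⟨k, c, hkA, hkB⟩ := exists_glued_potential h₁ h₂ hs
  refine ⟨k, fun e he => ?_⟩
  have hl := ho e (hX he)
  rw [← hu] at he
  rcases he with he | he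
  · rw [hkA _ ⟨e, he, hl.inc_left⟩, hkA _ ⟨e, he, hl.inc_right⟩, hh₁ e he]
  · rw [hkB _ ⟨e, he, hl.inc_left⟩, hkB _ ⟨e, he, hl.inc_right⟩, hh₂ e he]
    ring

theorem exists_orientation [Nonempty α] (G : Graph α β) :
    ∃ o : β → α × α, ∀ e ∈ E(G), G.IsLink e (o e).1 (o e).2 := by
  classical
  have : ∀ e, ∃ p : α × α, e ∈ E(G) → G.IsLink e p.1 p.2 := by
    intro e
    by_cases he : e ∈ E(G)
    · obtain ⟨x, y, h⟩ := exists_isLink_of_mem_edgeSet he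
      exact ⟨(x, y), fun _ => h⟩
    · exact ⟨Classical.arbitrary _, fun h => absurd h he⟩
  choose o ho using this
  exact ⟨o, ho⟩

/-- Each part of a division of the cycle omits an edge and is therefore free. If the parts met in at
most one vertex, functions prescribed on them could be glued, making the whole cycle free. -/
theorem IsCycleSet.nonSep (h : G.IsCycleSet C) : G.NonSep C := by
  intro A B hA hB hd hu
  by_contra hs
  rw [Set.not_nontrivial_iff] at hs
  have hne : Nonempty α := by
    obtain ⟨n, x, -⟩ := h
    exact ⟨x 0⟩
  obtain ⟨o, ho⟩ := G.exists_orientation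
  have hc : C ∈ (SignedGraph.positive G).balancedCycles :=
    SignedGraph.mem_balancedCycles.2
      ⟨h, SignedGraph.prodSign_eq_one (g := 1) h fun _ _ _ _ _ => rfl⟩
  refine SignedGraph.not_free_of_balanced (Ω := SignedGraph.positive G) (o := o) ho hc ?_
  have hval : ∀ g e, (SignedGraph.positive G).cobound o g e = g (o e).1 - g (o e).2 := fun g e => by
    simp [SignedGraph.cobound, SignedGraph.positive]
  obtain ⟨a, ha⟩ := hA
  obtain ⟨b, hb⟩ := hB
  have haC : a ∈ C := hu ▸ Or.inl ha
  have hbC : b ∈ C := hu ▸ Or.inr hb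
  have hFA := SignedGraph.free_sdiff_of_isCycleSet (Ω := SignedGraph.positive G) (o := o) ho h hbC
  have hFB := SignedGraph.free_sdiff_of_isCycleSet (Ω := SignedGraph.positive G) (o := o) ho h haC
  intro t
  obtain ⟨h₁, hh₁⟩ := hFA t
  obtain ⟨h₂, hh₂⟩ := hFB t
  obtain ⟨k, c, hkA, hkB⟩ := exists_glued_potential h₁ h₂ hs
  refine ⟨k, fun e he => ?_⟩
  have hl := ho e (h.subset he)
  have he' := hu.superset he
  rw [hval]
  rcases he' with heA | heB
  · rw [hkA _ ⟨e, heA, hl.inc_left⟩, hkA _ ⟨e, heA, hl.inc_right⟩, ← hval]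
    exact hh₁ e ⟨he, fun h => Set.disjoint_left.1 hd heA (h ▸ hb)⟩
  · rw [hkB _ ⟨e, heB, hl.inc_left⟩, hkB _ ⟨e, heB, hl.inc_right⟩, add_sub_add_right_eq_sub, ← hval]
    exact hh₂ e ⟨he, fun h => Set.disjoint_left.1 hd ha (h ▸ heB)⟩

end Graph

namespace Graph

variable {α β γ : Type*} {G H K L : Graph α β} {a₁ a₂ b₁ b₂ x y : α} {e f : β} {o o' : β → α × α}
  {t : β → ℚ}

/-! ### Row spaces and 2-isomorphism -/

/-- `o` orients the edges of `G`. -/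
def Orients (o : β → α × α) (G : Graph α β) : Prop := ∀ e ∈ E(G), G.IsLink e (o e).1 (o e).2

/-- `t` is a potential difference on the oriented edges of `G`. -/
def IsCobound (G : Graph α β) (o : β → α × α) (t : β → ℚ) : Prop :=
  ∃ h : α → ℚ, ∀ e ∈ E(G), t e = h (o e).1 - h (o e).2

/-- The incidence matrices of `G` and `H` have the same row space up to a scaling of columns. -/
def RowEquiv (G : Graph α β) (H : Graph γ β) : Prop :=
  E(G) = E(H) ∧ ∀ oG oH, Orients oG G → Orients oH H →
    ∃ c : β → ℚ, (∀ e, c e ≠ 0) ∧ ∀ t, G.IsCobound oG t ↔ H.IsCobound oH fun e => c e * t e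

theorem Orients.exists_scale (h : Orients o G) (h' : Orients o' G) :
    ∃ c : β → ℚ, (∀ e, c e * c e = 1) ∧
      ∀ e ∈ E(G), ∀ k : α → ℚ, k (o' e).1 - k (o' e).2 = c e * (k (o e).1 - k (o e).2) := by
  classical
  refine ⟨fun e => if o e = o' e then 1 else -1, fun e => by dsimp only; split_ifs <;> norm_num,
    fun e he k => ?_⟩
  dsimp only
  split_ifs with heq
  · rw [heq, one_mul]
  · rcases (h e he).eq_and_eq_or_eq_and_eq (h' e he) with ⟨h1, h2⟩ | ⟨h1, h2⟩
    · exact absurd (Prod.ext h1 h2) heq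
    · rw [h1, h2]; ring

theorem ne_zero_of_sq {q : ℚ} (h : q * q = 1) : q ≠ 0 := by
  rintro rfl
  norm_num at h

/-- Reorienting edges scales columns by `1` or `-1`, so one choice of orientations suffices. -/
theorem rowEquiv_of_potentials {H : Graph γ β} {oG : β → α × α} {oH : β → γ × γ} {c : β → ℚ}
    (hE : E(G) = E(H)) (hoG : Orients oG G) (hoH : Orients oH H) (hc : ∀ e, c e ≠ 0)
    (h₁ : ∀ h : α → ℚ, ∃ g : γ → ℚ, ∀ e ∈ E(G),
      g (oH e).1 - g (oH e).2 = c e * (h (oG e).1 - h (oG e).2))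
    (h₂ : ∀ g : γ → ℚ, ∃ h : α → ℚ, ∀ e ∈ E(G),
      g (oH e).1 - g (oH e).2 = c e * (h (oG e).1 - h (oG e).2)) : G.RowEquiv H := by
  refine ⟨hE, fun oG' oH' hoG' hoH' => ?_⟩
  obtain ⟨s, hs, hs'⟩ := hoG.exists_scale hoG'
  obtain ⟨r, hr, hr'⟩ := hoH.exists_scale hoH'
  refine ⟨fun e => r e * c e * s e, fun e => mul_ne_zero (mul_ne_zero (ne_zero_of_sq (hr e)) (hc e))
    (ne_zero_of_sq (hs e)), fun t => ⟨?_, ?_⟩⟩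
  · rintro ⟨h, hh⟩
    obtain ⟨g, hg⟩ := h₁ h
    refine ⟨g, fun e he => ?_⟩
    change r e * c e * s e * t e = _
    rw [hr' e he, hg e (hE ▸ he), hh e (hE ▸ he), hs' e (hE ▸ he)]
    linear_combination (r e * c e * (h (oG e).1 - h (oG e).2)) * hs e
  · rintro ⟨g, hg⟩
    obtain ⟨h, hh⟩ := h₂ g
    refine ⟨h, fun e he => ?_⟩
    have h1 := hg e (hE ▸ he)
    rw [hr' e (hE ▸ he), hh e he] at h1
    rw [hs' e he]
    refine mul_left_cancel₀ (mul_ne_zero (ne_zero_of_sq (hr e)) (hc e)) ?_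
    linear_combination s e * h1 - (r e * c e * t e) * hs e

theorem RowEquiv.refl (G : Graph α β) [Nonempty α] : G.RowEquiv G := by
  obtain ⟨o, ho⟩ := G.exists_orientation
  exact rowEquiv_of_potentials (c := 1) rfl ho ho (fun _ => one_ne_zero) (fun h => ⟨h, by simp⟩)
    (fun h => ⟨h, by simp⟩)

theorem RowEquiv.trans [Nonempty α] (h : G.RowEquiv H) (h' : H.RowEquiv K) : G.RowEquiv K := by
  refine ⟨h.1.trans h'.1, fun oG oK hoG hoK => ?_⟩
  obtain ⟨o, ho⟩ := H.exists_orientation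
  obtain ⟨c, hc, hc'⟩ := h.2 oG o hoG ho
  obtain ⟨d, hd, hd'⟩ := h'.2 o oK ho hoK
  refine ⟨fun e => d e * c e, fun e => mul_ne_zero (hd e) (hc e), fun t => ?_⟩
  rw [hc', hd']
  simp only [mul_assoc]

theorem rowEquiv_map [Nonempty α] {g : α → α} (hg : Set.InjOn g V(G)) : G.RowEquiv (G.map g) := by
  obtain ⟨o, ho⟩ := G.exists_orientation
  refine rowEquiv_of_potentials (c := 1) (oG := o) (oH := fun e => (g (o e).1, g (o e).2)) rfl ho
    (fun e he => (ho e he).map g) (fun _ => one_ne_zero)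
    (fun h => ⟨fun u => h (Function.invFunOn g V(G) u), fun e he => ?_⟩)
    (fun h => ⟨h ∘ g, fun e he => by simp⟩)
  have hl := hg.leftInvOn_invFunOn
  simp only [hl (ho e he).left_mem, hl (ho e he).right_mem, Pi.one_apply, one_mul]

/-- On the flipped part a function `h` is replaced by its reflection `h u₁ + h u₂ - h`. This
interchanges the values at `u₁` and `u₂`, matching the exchange of these vertices, and only reverses
the differences. -/
theorem IsWhitneyFlip.rowEquiv [Nonempty α] (h : G.IsWhitneyFlip H) : G.RowEquiv H := by
  classical
  obtain ⟨X₁, X₂, u₁, u₂, hne, hd, hu, hv, -, hl⟩ := h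
  obtain ⟨o, ho⟩ := G.exists_orientation
  have hX₁ : X₁ ⊆ E(G) := hu ▸ Set.subset_union_left
  have hu₁ : u₁ ∈ G.vertsOf X₂ := (hv.superset (Or.inl rfl)).2
  have hu₂ : u₂ ∈ G.vertsOf X₂ := (hv.superset (Or.inr rfl)).2
  have hE : E(G) = E(H) := by
    ext e
    constructor
    · intro he
      have hl' := ho e he
      rcases hu.superset he with h | h
      · exact ((hl e (Equiv.swap u₁ u₂ (o e).1) (Equiv.swap u₁ u₂ (o e).2)).2
          (Or.inr ⟨h, by simpa using hl'⟩)).edge_mem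
      · exact ((hl e (o e).1 (o e).2).2 (Or.inl ⟨h, hl'⟩)).edge_mem
    · intro he
      obtain ⟨x, y, hxy⟩ := H.exists_isLink_of_mem_edgeSet he
      rcases (hl e x y).1 hxy with h | h
      exacts [h.2.edge_mem, h.2.edge_mem]
  let s : Equiv.Perm α := Equiv.swap u₁ u₂
  have key : ∀ h : α → ℚ, ∃ g : α → ℚ, (∀ x ∈ G.vertsOf X₂, g x = h x) ∧
      (∀ x ∈ G.vertsOf X₁, g (s x) = h u₁ + h u₂ - h x) ∧
      (∀ x ∈ G.vertsOf X₁, g x = h u₁ + h u₂ - h (s x)) := by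
    intro h
    refine ⟨fun x => if x ∈ G.vertsOf X₂ then h x else h u₁ + h u₂ - h x, fun x hx => if_pos hx,
      fun x hx => ?_, fun x hx => ?_⟩
    all_goals
      by_cases hx2 : x ∈ G.vertsOf X₂
      · rcases hv.subset ⟨hx, hx2⟩ with rfl | rfl
        · simp [s, hu₁, hu₂]
        · simp [s, hu₁, hu₂]
      · have : s x = x := Equiv.swap_apply_of_ne_of_ne (fun h => hx2 (h ▸ hu₁))
          (fun h => hx2 (h ▸ hu₂))
        simp [this, hx2]
  refine rowEquiv_of_potentials (c := fun e => if e ∈ X₂ then 1 else -1) (oG := o)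
    (oH := fun e => if e ∈ X₂ then o e else (s (o e).1, s (o e).2)) hE ho ?_
    (fun e => by split_ifs <;> norm_num) ?_ ?_
  · intro e he
    rw [← hE] at he
    rw [hl]
    by_cases h2 : e ∈ X₂
    · simp only [h2, if_true]
      exact Or.inl ⟨trivial, ho e he⟩
    · simp only [h2, if_false]
      exact Or.inr ⟨(hu.superset he).resolve_right h2, by simpa [s] using ho e he⟩
  · intro h
    obtain ⟨g, hg2, hg1, -⟩ := key h
    refine ⟨g, fun e he => ?_⟩
    by_cases h2 : e ∈ X₂
    · simp only [h2, if_true]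
      rw [hg2 _ ⟨e, h2, (ho e he).inc_left⟩, hg2 _ ⟨e, h2, (ho e he).inc_right⟩, one_mul]
    · have h1 := (hu.superset he).resolve_right h2
      simp only [h2, if_false]
      rw [hg1 _ ⟨e, h1, (ho e he).inc_left⟩, hg1 _ ⟨e, h1, (ho e he).inc_right⟩]
      ring
  · intro h
    obtain ⟨g, hg2, -, hg1⟩ := key h
    refine ⟨g, fun e he => ?_⟩
    by_cases h2 : e ∈ X₂
    · simp only [h2, if_true]
      rw [hg2 _ ⟨e, h2, (ho e he).inc_left⟩, hg2 _ ⟨e, h2, (ho e he).inc_right⟩, one_mul]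
    · have h1 := (hu.superset he).resolve_right h2
      simp only [h2, if_false]
      rw [hg1 _ ⟨e, h1, (ho e he).inc_left⟩, hg1 _ ⟨e, h1, (ho e he).inc_right⟩]
      ring

/-- A constant added on the component of `x` makes the values at `x` and `y` equal, and this
component does not contain `y`. -/
theorem IsComponentIdentification.rowEquiv [Nonempty α] (h : G.IsComponentIdentification H) :
    G.RowEquiv H := by
  classical
  obtain ⟨x, -, y, -, hxy, rfl⟩ := h
  obtain ⟨o, ho⟩ := G.exists_orientation
  refine rowEquiv_of_potentials (c := 1) (oG := o)
    (oH := fun e => (Function.update id y x (o e).1, Function.update id y x (o e).2)) rfl ho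
    (fun e he => (ho e he).map _) (fun _ => one_ne_zero) (fun h => ?_)
    (fun g => ⟨g ∘ Function.update id y x, fun e he => by simp⟩)
  let g : α → ℚ := fun u => if Relation.ReflTransGen G.Adj x u then h u - h x + h y else h u
  have hg : ∀ u, g (Function.update id y x u) = g u := by
    intro u
    by_cases hu : u = y
    · subst hu
      have : Relation.ReflTransGen G.Adj x x := .refl
      simp [g, hxy, this]
    · simp [hu]
  refine ⟨g, fun e he => ?_⟩
  simp only [hg]
  have hr : Relation.ReflTransGen G.Adj x (o e).1 ↔ Relation.ReflTransGen G.Adj x (o e).2 :=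
    ⟨fun h => h.tail (ho e he).adj, fun h => h.tail (ho e he).symm.adj⟩
  simp only [g, hr]
  split_ifs <;> simp

theorem isComponent_induce (hx : x ∈ V(G)) :
    G.IsComponent (G.induce {u | Relation.ReflTransGen G.Adj x u}) := by
  have hV : {u | Relation.ReflTransGen G.Adj x u} ⊆ V(G) := by
    intro u hu
    rcases hu.cases_tail with rfl | ⟨z, -, h⟩
    exacts [hx, h.right_mem]
  have hr : ∀ u, Relation.ReflTransGen G.Adj x u →
      Relation.ReflTransGen (G.induce {u | Relation.ReflTransGen G.Adj x u}).Adj x u := by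
    intro u hu
    induction hu with
    | refl => exact .refl
    | tail h1 h ih =>
      obtain ⟨e, he⟩ := h
      exact ih.tail ⟨e, he, h1, h1.tail he.adj⟩
  refine ⟨⟨induce_le hV, ⟨x, .refl⟩, fun u hu w hw => ?_⟩, fun K hK hle => ⟨?_, ?_⟩⟩
  · exact (Std.Symm.symm _ _ (hr u hu)).trans (hr w hw)
  · intro u hu
    have hxK : x ∈ V(K) := hle.vertexSet_mono .refl
    exact Relation.ReflTransGen.mono (fun _ _ h => h.mono hK.1) _ _ (hK.2.2 x hxK u hu)
  · intro e u w hl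
    have hxK : x ∈ V(K) := hle.vertexSet_mono .refl
    exact ⟨hl.mono hK.1,
      Relation.ReflTransGen.mono (fun _ _ h => h.mono hK.1) _ _ (hK.2.2 x hxK u hl.left_mem),
      Relation.ReflTransGen.mono (fun _ _ h => h.mono hK.1) _ _ (hK.2.2 x hxK w hl.right_mem)⟩

/-- Functions on `G` are pulled back along `f`. Conversely a nonseparable set lies in one block,
which is an injective image of a component of `H`; functions on `H` can be transported there, and
`exists_potential_of_nonSep` assembles the results. -/
theorem IsBlockPartition.rowEquiv [Nonempty α] (hE : E(G).Finite) (h : G.IsBlockPartition H) :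
    G.RowEquiv H := by
  obtain ⟨f, rfl, hK, -⟩ := h
  obtain ⟨o, ho⟩ := H.exists_orientation
  have hof : ∀ e ∈ E(H.map f), (H.map f).IsLink e (f (o e).1) (f (o e).2) :=
    fun e he => (ho e he).map f
  refine rowEquiv_of_potentials (c := 1) (oG := fun e => (f (o e).1, f (o e).2)) (oH := o) rfl
    hof ho (fun _ => one_ne_zero) (fun h => ⟨h ∘ f, fun e he => by simp⟩) (fun g => ?_)
  suffices ∃ h : α → ℚ, ∀ e ∈ E(H.map f), g (o e).1 - g (o e).2 = h (f (o e).1) - h (f (o e).2) by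
    simpa using this
  refine exists_potential_of_nonSep (o := fun e => (f (o e).1, f (o e).2))
    (t := fun e => g (o e).1 - g (o e).2) hof hE le_rfl (fun Z hZ hN hne => ?_)
  obtain ⟨L, hL, hZL⟩ := exists_isBlock hE hZ hne hN
  obtain ⟨e, he⟩ := hne
  have hle := ho e (hZ he)
  obtain ⟨hinj, hB⟩ := hK _ (isComponent_induce hle.left_mem)
  have heK : e ∈ E((H.induce {u | Relation.ReflTransGen H.Adj (o e).1 u}).map f) :=
    IsLink.edge_mem (G := H.induce _) (x := (o e).1) (y := (o e).2)
      ⟨hle, .refl, .single hle.adj⟩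
  obtain rfl := hB.eq_of_mem hL heK (hZL he)
  refine ⟨fun u => g (Function.invFunOn f {u | Relation.ReflTransGen H.Adj (o e).1 u} u),
    fun e' he' => ?_⟩
  have hl' := ((isComponent_induce hle.left_mem).prop.1.isLink_iff (hZL he')).2 (ho e' (hZ he'))
  have h1 := hinj.leftInvOn_invFunOn hl'.left_mem
  have h2 := hinj.leftInvOn_invFunOn hl'.right_mem
  rw [vertexSet_induce] at h1 h2
  dsimp only
  rw [h1, h2]

theorem TwoIsomorphic.rowEquiv [Nonempty α] (hE : E(G).Finite) (h : G.TwoIsomorphic H) :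
    G.RowEquiv H := by
  induction h with
  | refl => exact .refl G
  | tail _ h ih =>
    refine ih.trans ?_
    rcases h with ⟨f, hf, rfl⟩ | h | h | h
    exacts [rowEquiv_map hf, h.rowEquiv, h.rowEquiv, h.rowEquiv (ih.1 ▸ hE)]

theorem some_mem_addNewEdge : some e ∈ E(G.addNewEdge x y) ↔ e ∈ E(G) := by
  constructor
  · intro h
    obtain ⟨u, w, ⟨f, hf, hl⟩ | ⟨h, -⟩⟩ := exists_isLink_of_mem_edgeSet h
    · obtain rfl : e = f := by simpa using hf
      exact hl.edge_mem
    · simp at h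
  · intro h
    obtain ⟨u, w, hl⟩ := exists_isLink_of_mem_edgeSet h
    exact IsLink.edge_mem (G := G.addNewEdge x y) (x := u) (y := w) (Or.inl ⟨e, rfl, hl⟩)

theorem isLink_none_addNewEdge : (G.addNewEdge x y).IsLink none x y := Or.inr ⟨rfl, rfl⟩

theorem orients_addNewEdge (ho : Orients o G) :
    Orients (fun e => e.elim (x, y) o) (G.addNewEdge x y) := by
  rintro (_ | e) he
  · exact isLink_none_addNewEdge
  · exact Or.inl ⟨e, rfl, ho e (some_mem_addNewEdge.1 he)⟩

/-- The additional edge records the potential difference of the terminals. Scaling all columns by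
the inverse of its factor makes this difference the same in both graphs, so either piece can be
glued to the same surroundings. -/
theorem PathTwoIsomorphic.exists_potentials {oG : β → α × α} (hE : E(G).Finite)
    (hoG : Orients oG G) (h : G.PathTwoIsomorphic a₁ a₂ H b₁ b₂) :
    E(H) = E(G) ∧ ∃ (oH : β → α × α) (c : β → ℚ), Orients oH H ∧ (∀ e, c e ≠ 0) ∧
      (∀ h : α → ℚ, h a₁ = 0 → ∃ g : α → ℚ, g b₁ = 0 ∧ g b₂ = h a₂ ∧ ∀ e ∈ E(G),
        g (oH e).1 - g (oH e).2 = c e * (h (oG e).1 - h (oG e).2)) ∧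
      ∀ g : α → ℚ, g b₁ = 0 → ∃ h : α → ℚ, h a₁ = 0 ∧ h a₂ = g b₂ ∧ ∀ e ∈ E(G),
        g (oH e).1 - g (oH e).2 = c e * (h (oG e).1 - h (oG e).2) := by
  have : Nonempty α := ⟨a₁⟩
  have hE' : E(G.addNewEdge a₁ a₂).Finite := by
    refine ((hE.image some).insert none).subset ?_
    rintro (_ | e) he
    · exact Or.inl rfl
    · exact Or.inr ⟨e, some_mem_addNewEdge.1 he, rfl⟩
  obtain ⟨hEE, hrow⟩ := TwoIsomorphic.rowEquiv hE' h.2.2.2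
  have hEH : E(H) = E(G) := by
    ext e
    rw [← some_mem_addNewEdge (x := b₁) (y := b₂), ← hEE, some_mem_addNewEdge]
  obtain ⟨oH, hoH⟩ := H.exists_orientation
  obtain ⟨c, hc, hcob⟩ := hrow _ _ (orients_addNewEdge hoG) (orients_addNewEdge hoH)
  have hn : none ∈ E(G.addNewEdge a₁ a₂) := isLink_none_addNewEdge.edge_mem
  refine ⟨hEH, oH, fun e => c (some e) / c none, hoH, fun e => div_ne_zero (hc _) (hc _), ?_, ?_⟩
  · intro h h0
    obtain ⟨g, hg⟩ := (hcob _).1 ⟨h, fun _ _ => rfl⟩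
    have hgn := hg none (hEE ▸ hn)
    simp only [Option.elim] at hgn
    -- Subtracting `g b₁` gives `b₁` the value `0`, and dividing by `c none` makes the value at `b₂`
    -- equal to `h a₂`.
    refine ⟨fun u => (g u - g b₁) / c none, by simp, ?_, fun e he => ?_⟩
    · rw [div_eq_iff (hc none)]
      linear_combination hgn - c none * h0
    · have := hg (some e) (hEE ▸ some_mem_addNewEdge.2 he)
      simp only [Option.elim] at this
      rw [div_mul_eq_mul_div, this]
      ring
  · intro g g0
    -- The factor `c none` is put in so that the entry at the new edge is exactly `g b₁ - g b₂`.
    obtain ⟨h, hh⟩ := (hcob fun e => c none * (g (e.elim (b₁, b₂) oH).1 - g (e.elim (b₁, b₂) oH).2) /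
      c e).2 ⟨fun u => c none * g u, fun e he => by
        field_simp [hc e]⟩
    have hhn := hh none hn
    simp only [Option.elim] at hhn
    rw [mul_div_cancel_left₀ _ (hc none)] at hhn
    refine ⟨fun u => h u - h a₁, by simp, ?_, fun e he => ?_⟩
    · linear_combination hhn - g0
    · have := hh (some e) (some_mem_addNewEdge.2 he)
      simp only [Option.elim] at this
      rw [sub_sub_sub_cancel_right, ← this]
      field_simp [hc none, hc (some e)]

end Graph

namespace Graph

variable {α β γ κ : Type*} {G H K L : Graph α β} {x y : α} {e f : β}

/-! ### The pieces and their gluing -/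

/-- The blocks `B i` of `G` meet the rest of `G` in the single vertices `v i`. -/
structure PendantBlocks (G : Graph α β) (B : κ → Graph α β) (v : κ → α) : Prop where
  connected : G.Connected
  finite : E(G).Finite
  isBlock : ∀ i, G.IsBlock (B i)
  nonempty : ∀ i, E(B i).Nonempty
  inter : ∀ i, G.vertsOf E(B i) ∩ G.vertsOf (E(G) \ E(B i)) = {v i}
  disjoint : ∀ i j, i ≠ j → Disjoint E(B i) E(B j)

namespace PendantBlocks

variable {B : κ → Graph α β} {v : κ → α} {i j : κ}

theorem vertsOf_eq (h : G.PendantBlocks B v) (i : κ) : G.vertsOf E(B i) = V(B i) :=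
  (h.isBlock i).vertsOf_eq (h.nonempty i)

theorem eq_of_mem (h : G.PendantBlocks B v) (hx : x ∈ V(B i)) (he : G.Inc e x) (hei : e ∉ E(B i)) :
    x = v i := by
  rw [← h.vertsOf_eq] at hx
  exact (h.inter i).subset ⟨hx, e, ⟨he.edge_mem, hei⟩, he⟩

theorem mem (h : G.PendantBlocks B v) (i : κ) : v i ∈ V(B i) := by
  rw [← h.vertsOf_eq]
  exact ((h.inter i).superset rfl).1

theorem eq_of_mem_of_mem (h : G.PendantBlocks B v) (hij : i ≠ j) (hi : x ∈ V(B i))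
    (hj : x ∈ V(B j)) : x = v i := by
  rw [← h.vertsOf_eq j] at hj
  obtain ⟨e, he, hx⟩ := hj
  exact h.eq_of_mem hi hx fun h' => Set.disjoint_left.1 (h.disjoint i j hij) h' he

/-- Deleting the vertices of `B i` other than `v i` removes no further edges, because an edge
outside the block can meet it only in `v i`. -/
theorem remainder_isLink (h : G.PendantBlocks B v) :
    (G.remainder B v).IsLink e x y ↔ G.IsLink e x y ∧ ∀ i, e ∉ E(B i) := by
  simp only [remainder, deleteVerts_isLink, deleteEdges_isLink, Set.mem_iUnion, not_exists]
  constructor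
  · exact fun h => h.1
  · rintro ⟨hl, he⟩
    exact ⟨⟨hl, he⟩, fun i hx => hx.2 (h.eq_of_mem hx.1 hl.inc_left (he i)),
      fun i hx => hx.2 (h.eq_of_mem hx.1 hl.inc_right (he i))⟩

theorem edgeSet_remainder (h : G.PendantBlocks B v) :
    E(G.remainder B v) = E(G) \ ⋃ i, E(B i) := by
  ext e
  simp only [Set.mem_sdiff, Set.mem_iUnion, not_exists]
  constructor
  · intro he
    obtain ⟨x, y, hl⟩ := exists_isLink_of_mem_edgeSet he
    have := h.remainder_isLink.1 hl
    exact ⟨this.1.edge_mem, this.2⟩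
  · rintro ⟨he, hi⟩
    obtain ⟨x, y, hl⟩ := exists_isLink_of_mem_edgeSet he
    exact (h.remainder_isLink.2 ⟨hl, hi⟩).edge_mem

end PendantBlocks

/-- The graph obtained by gluing the graphs `K i` to `G` and to a new vertex. -/
noncomputable def glue (G : Graph α β) (v : κ → α) (K : κ → Graph γ β) (p q : κ → γ)
    (hG : ∀ i, Disjoint E(G) E(K i)) (hK : ∀ i j, i ≠ j → Disjoint E(K i) E(K j)) :
    Graph (Option (α ⊕ κ × γ)) β where
  vertexSet := {none} ∪ (fun x => some (Sum.inl x)) '' V(G) ∪ ⋃ i, glueVertex v p q i '' V(K i)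
  IsLink e x y := (∃ a b, G.IsLink e a b ∧ x = some (Sum.inl a) ∧ y = some (Sum.inl b)) ∨
    (∃ i a b, (K i).IsLink e a b ∧ x = glueVertex v p q i a ∧ y = glueVertex v p q i b)
  isLink_symm := by
    intro e _
    constructor
    rintro x y (⟨a, b, h, rfl, rfl⟩ | ⟨i, a, b, h, rfl, rfl⟩)
    · exact Or.inl ⟨b, a, h.symm, rfl, rfl⟩
    · exact Or.inr ⟨i, b, a, h.symm, rfl, rfl⟩
  eq_or_eq_of_isLink_of_isLink := by
    rintro e x y z w (⟨a, b, h, rfl, rfl⟩ | ⟨i, a, b, h, rfl, rfl⟩)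
      (⟨a', b', h', rfl, rfl⟩ | ⟨j, a', b', h', rfl, rfl⟩)
    · rcases h.left_eq_or_eq h' with rfl | rfl <;> simp
    · exact absurd h'.edge_mem (Set.disjoint_left.1 (hG j) h.edge_mem)
    · exact absurd h.edge_mem (Set.disjoint_left.1 (hG i) h'.edge_mem)
    · obtain rfl : i = j := by
        by_contra hij
        exact Set.disjoint_left.1 (hK i j hij) h.edge_mem h'.edge_mem
      rcases h.left_eq_or_eq h' with rfl | rfl <;> simp
  left_mem_of_isLink := by
    rintro e x y (⟨a, b, h, rfl, rfl⟩ | ⟨i, a, b, h, rfl, rfl⟩)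
    · exact Or.inl (Or.inr ⟨a, h.left_mem, rfl⟩)
    · exact Or.inr (Set.mem_iUnion.2 ⟨i, a, h.left_mem, rfl⟩)

/-- `IsGluing` prescribes all vertices and links and thus determines the graph. Disjointness of the
edge sets ensures that no edge receives two different pairs of ends. -/
theorem exists_isGluing {v : κ → α} {K : κ → Graph γ β} {p q : κ → γ}
    (hG : ∀ i, Disjoint E(G) E(K i)) (hK : ∀ i j, i ≠ j → Disjoint E(K i) E(K j)) :
    ∃ H, G.IsGluing v K p q H :=
  ⟨glue G v K p q hG hK, rfl, fun _ _ _ => Iff.rfl⟩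

theorem PendantBlocks.exists_isGluing {B : κ → Graph α β} {v : κ → α} {K : κ → Graph γ β}
    {p q : κ → γ} (h : G.PendantBlocks B v) (hK : ∀ i, E(K i) = E(B i)) :
    ∃ H, (G.remainder B v).IsGluing v K p q H := by
  refine Graph.exists_isGluing (fun i => ?_) fun i j hij => ?_
  · rw [h.edgeSet_remainder, hK]
    exact Set.disjoint_left.2 fun e he he' => he.2 (Set.mem_iUnion.2 ⟨i, he'⟩)
  · rw [hK, hK]
    exact h.disjoint i j hij

theorem PendantBlocks.edgeSet_gluing {B : κ → Graph α β} {v : κ → α} {K : κ → Graph γ β}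
    {p q : κ → γ} {H : Graph (Option (α ⊕ κ × γ)) β} (h : G.PendantBlocks B v)
    (hK : ∀ i, E(K i) = E(B i)) (hH : (G.remainder B v).IsGluing v K p q H) : E(H) = E(G) := by
  ext e
  constructor
  · intro he
    obtain ⟨x, y, hl⟩ := exists_isLink_of_mem_edgeSet he
    rcases (hH.2 e x y).1 hl with ⟨a, b, hab, -⟩ | ⟨i, a, b, hab, -⟩
    · exact (h.remainder_isLink.1 hab).1.edge_mem
    · exact (h.isBlock i).le.edgeSet_mono (hK i ▸ hab.edge_mem)
  · intro he
    by_cases hi : ∃ i, e ∈ E(B i)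
    · obtain ⟨i, hi⟩ := hi
      obtain ⟨a, b, hab⟩ := exists_isLink_of_mem_edgeSet (hK i ▸ hi)
      exact ((hH.2 e _ _).2 (Or.inr ⟨i, a, b, hab, rfl, rfl⟩)).edge_mem
    · push Not at hi
      obtain ⟨a, b, hab⟩ := exists_isLink_of_mem_edgeSet he
      exact ((hH.2 e _ _).2 (Or.inl ⟨a, b, h.remainder_isLink.2 ⟨hab, hi⟩, rfl, rfl⟩)).edge_mem

theorem glueVertex_left {v : κ → α} {p q : κ → γ} {i : κ} :
    glueVertex v p q i (p i) = (none : Option (α ⊕ κ × γ)) := by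
  simp [glueVertex]

theorem glueVertex_right {v : κ → α} {p q : κ → γ} {i : κ} (h : p i ≠ q i) :
    glueVertex v p q i (q i) = (some (Sum.inl (v i)) : Option (α ⊕ κ × γ)) := by
  simp [glueVertex, h.symm]

theorem glueVertex_of_ne {v : κ → α} {p q : κ → γ} {i : κ} {y : γ} (hp : y ≠ p i) (hq : y ≠ q i) :
    glueVertex v p q i y = (some (Sum.inr (i, y)) : Option (α ⊕ κ × γ)) := by
  simp [glueVertex, hp, hq]

end Graph

namespace SignedGraph

variable {α β γ κ : Type*} {Ω : SignedGraph α β} {a b x y v : α} {S : Set α} {C D P : Set β}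
  {e f : β} {o : β → α × α} {δ : α → ℤˣ} {K : Graph α β} {H : Graph γ β} {p q : γ}

/-! ### Switching -/

theorem switch_prodSign_of_isPathOn (h : Ω.graph.IsPathOn a b S P) :
    (Ω.switch δ).prodSign P = δ a * Ω.prodSign P * δ b := by
  induction h with
  | nil => simp [prodSign]
  | snoc h hl hc ih =>
    have he := h.notMem_of_inc hl.inc_right hc
    rw [prodSign_insert h.finite.2 he, prodSign_insert h.finite.2 he, ih, switch_sign hl]
    have : ∀ a b c d s : ℤˣ, b * s * c * (a * d * b) = a * (s * d) * c := by decide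
    exact this _ _ _ _ _

theorem switch_balancedCycles : (Ω.switch δ).balancedCycles = Ω.balancedCycles := by
  ext C
  rw [mem_balancedCycles, mem_balancedCycles]
  refine and_congr_right fun (hC : Ω.graph.IsCycleSet C) => ?_
  obtain ⟨f, hf⟩ := hC.nonempty
  obtain ⟨a, b, P, hP, hfP, hl, hCP⟩ := hC.exists_of_edge hf
  rw [hCP, prodSign_insert hP.finite.2 hfP, prodSign_insert hP.finite.2 hfP,
    switch_prodSign_of_isPathOn hP, switch_sign hl]
  have : ∀ a b c d : ℤˣ, b * c * a * (a * d * b) = c * d := by decide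
  rw [this]

theorem mem_on_balancedCycles :
    C ∈ (Ω.on K).balancedCycles ↔ K.IsCycleSet C ∧ Ω.prodSign C = 1 :=
  mem_balancedCycles

theorem switch_on_balancedCycles (hK : K ≤ Ω.graph) :
    ((Ω.switch δ).on K).balancedCycles = (Ω.on K).balancedCycles := by
  ext C
  rw [mem_on_balancedCycles, mem_on_balancedCycles]
  refine and_congr_right fun hC => ?_
  have h1 : C ∈ (Ω.switch δ).balancedCycles ↔ C ∈ Ω.balancedCycles := by rw [switch_balancedCycles]
  rw [mem_balancedCycles, mem_balancedCycles] at h1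
  exact ⟨fun h => (h1.1 ⟨hC.mono hK, h⟩).2, fun h => (h1.2 ⟨hC.mono hK, h⟩).2⟩

/-- A cycle without edges that are allowed to be negative lies in one block. This block is balanced,
or it is some `B i` and the cycle avoids `v i`; so a potential on these edges exists, and it serves
as the switching function. -/
theorem exists_switch_of_pendantBlocks {B : κ → Graph α β} {v : κ → α} (hE : E(Ω.graph).Finite)
    (hblock : ∀ K, Ω.graph.IsBlock K → (¬ (Ω.on K).IsBalanced ↔ Ω.graph.IsEndBlock K))
    (hBend : ∀ K, Ω.graph.IsEndBlock K ↔ ∃ i, B i = K)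
    (hvbal : ∀ i, (Ω.on ((B i).deleteVerts {v i})).IsBalanced) :
    ∃ δ : α → ℤˣ, ∀ e ∈ E(Ω.graph), (Ω.switch δ).sign e = -1 →
      ∃ i, e ∈ E(B i) ∧ Ω.graph.Inc e (v i) := by
  let D := {e ∈ E(Ω.graph) | ¬ ∃ i, e ∈ E(B i) ∧ Ω.graph.Inc e (v i)}
  have hD : D ⊆ E(Ω.graph) := fun e he => he.1
  obtain ⟨g, hg⟩ := exists_potential (hE.subset hD) hD fun C hC hCc => by
    obtain ⟨K, hK, hCK⟩ := Graph.exists_isBlock hE (hC.trans hD) hCc.nonempty hCc.nonSep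
    have hCK' := hCc.of_le hK.le hCK
    by_cases hb : (Ω.on K).IsBalanced
    · exact (mem_on_balancedCycles.1 (hb C hCK')).2
    · obtain ⟨i, rfl⟩ := (hBend K).1 ((hblock K hK).1 hb)
      refine (mem_on_balancedCycles.1 (hvbal i C (hCK'.of_le Graph.deleteVerts_le ?_))).2
      intro e he
      obtain ⟨x, y, hl⟩ := Graph.exists_isLink_of_mem_edgeSet (hCK he)
      change e ∈ E((B i).deleteVerts {v i})
      rw [Graph.edgeSet_deleteVerts]
      refine ⟨x, y, hl, ?_, ?_⟩
      · rintro rfl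
        exact (hC he).2 ⟨i, hCK he, (hl.mono hK.le).inc_left⟩
      · rintro rfl
        exact (hC he).2 ⟨i, hCK he, (hl.mono hK.le).inc_right⟩
  refine ⟨g, fun e he hs => ?_⟩
  by_contra hcon
  obtain ⟨x, y, hl⟩ := Graph.exists_isLink_of_mem_edgeSet he
  rw [switch_sign hl, hg e ⟨he, hcon⟩ x y hl] at hs
  have : ∀ s t : ℤˣ, s * t * s * t ≠ -1 := by decide
  exact this _ _ hs

/-! ### Pinching -/

theorem IsPinch.edgeSet_eq (h : Ω.IsPinch v H p q) : E(H) = E(Ω.graph) := by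
  obtain ⟨-, -, -, ⟨f, -, -, -, hf⟩, -⟩ := h
  rw [hf, Graph.edgeSet_map]

/-- A loop at `p` becomes a loop at `v`, and in a nonseparable graph this is the only edge. Then no
edge could connect `p` with `q`. -/
theorem IsPinch.not_isLink (h : Ω.IsPinch v H p q) (hH : H.Connected)
    (hN : Ω.graph.NonSep E(Ω.graph)) : ¬ H.IsLink e p p := by
  intro hl
  have hEq := h.edgeSet_eq
  obtain ⟨hp, hq, hpq, ⟨f, hfp, hfq, -, hf⟩, -⟩ := h
  by_cases hE : ∃ e' ∈ E(Ω.graph), e' ≠ e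
  · obtain ⟨e', he', hne⟩ := hE
    have hlv : Ω.graph.IsLink e v v := by
      have := hl.map f
      rwa [hfp, ← hf] at this
    obtain ⟨x, hx, y, hy, hxy⟩ := hN {e} (E(Ω.graph) \ {e}) ⟨e, rfl⟩ ⟨e', he', hne⟩
      Set.disjoint_sdiff_right (Set.union_sdiff_cancel (by simpa using hlv.edge_mem))
    have key : ∀ z ∈ Ω.graph.vertsOf {e}, z = v := by
      rintro z ⟨_, rfl, hz⟩
      rcases hz.eq_or_eq_of_isLink hlv with h | h <;> exact h
    exact hxy ((key x hx.1).trans (key y hy.1).symm)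
  · push Not at hE
    rcases (hH.2 p hp q hq).cases_tail with h | ⟨z, -, e', he'⟩
    · exact hpq h.symm
    · obtain rfl := hE e' (hEq ▸ he'.edge_mem)
      rcases he'.inc_right.eq_or_eq_of_isLink hl with h | h <;> exact hpq h.symm

/-- Row spaces under pinching. -/
theorem IsPinch.exists_potentials (h : Ω.IsPinch v H p q) (hloop : ∀ e, ¬ H.IsLink e p p)
    (ho : Graph.Orients o Ω.graph) :
    ∃ (oH : β → γ × γ) (c : β → ℚ), Graph.Orients oH H ∧ (∀ e, c e ≠ 0) ∧
      (∀ h : α → ℚ, ∃ g : γ → ℚ, g p = 0 ∧ g q = 2 * h v ∧ ∀ e ∈ E(H),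
        g (oH e).1 - g (oH e).2 = c e * Ω.cobound o h e) ∧
      ∀ g : γ → ℚ, g p = 0 → ∃ h : α → ℚ, g q = 2 * h v ∧ ∀ e ∈ E(H),
        g (oH e).1 - g (oH e).2 = c e * Ω.cobound o h e := by
  classical
  have hEq := h.edgeSet_eq
  obtain ⟨hp, hq, hpq, ⟨f, hfp, hfq, hinj, hf⟩, hs⟩ := h
  have : ∀ e, ∃ ab : γ × γ, e ∈ E(H) →
      H.IsLink e ab.1 ab.2 ∧ f ab.1 = (o e).1 ∧ f ab.2 = (o e).2 := by
    intro e
    by_cases he : e ∈ E(H)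
    · have hl := ho e (hEq ▸ he)
      rw [hf] at hl
      obtain ⟨a, b, hab, h1, h2⟩ := hl
      exact ⟨(a, b), fun _ => ⟨hab, h1, h2⟩⟩
    · exact ⟨(p, p), fun h => absurd h he⟩
  choose oH hoH using this
  -- Adding `h v` away from `p` leaves differences along positive edges unchanged and turns the sum
  -- along a negative edge into a difference from the value `0` at `p`. The factor `-1` is needed
  -- when the orientation starts at `p`.
  have key : ∀ (h : α → ℚ) (g : γ → ℚ), g p = 0 → (∀ y ∈ V(H), y ≠ p → g y = h (f y) + h v) →
      ∀ e ∈ E(H), g (oH e).1 - g (oH e).2 =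
        (if (oH e).1 = p then -1 else 1) * Ω.cobound o h e := by
    intro h g h0 hg e he
    obtain ⟨hl, h1, h2⟩ := hoH e he
    rw [cobound, ← h1, ← h2]
    by_cases ha : (oH e).1 = p
    · have hb : (oH e).2 ≠ p := fun hb => hloop e (by rw [ha, hb] at hl; exact hl)
      rw [if_pos ha, (hs e he).2 (ha ▸ hl.inc_left), hg _ hl.right_mem hb, ha, h0, hfp]
      simp only [Units.neg_smul, one_smul]
      ring
    · rw [if_neg ha, hg _ hl.left_mem ha]
      by_cases hb : (oH e).2 = p
      · rw [(hs e he).2 (hb ▸ hl.inc_right), hb, h0, hfp]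
        simp only [Units.neg_smul, one_smul]
        ring
      · have : Ω.sign e = 1 := (Int.units_eq_one_or _).resolve_right fun h' => by
          rcases ((hs e he).1 h').eq_or_eq_of_isLink hl with h | h
          exacts [ha h.symm, hb h.symm]
        rw [this, hg _ hl.right_mem hb, one_smul]
        ring
  refine ⟨oH, fun e => if (oH e).1 = p then -1 else 1, fun e he => (hoH e he).1,
    fun e => by dsimp only; split_ifs <;> norm_num, fun h => ?_, fun g h0 => ?_⟩
  · refine ⟨fun y => if y = p then 0 else h (f y) + h v, if_pos rfl, ?_,
      key h (fun y => if y = p then 0 else h (f y) + h v) (if_pos rfl) ?_⟩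
    · simp only [hpq.symm, if_false, hfq]; ring
    · intro y _ hy
      simp [hy]
  · have : Nonempty γ := ⟨p⟩
    have hinv := hinj.leftInvOn_invFunOn
    have hqv : Function.invFunOn f (V(H) \ {p}) v = q := by
      rw [← hfq]
      exact hinv ⟨hq, hpq.symm⟩
    refine ⟨fun x => g (Function.invFunOn f (V(H) \ {p}) x) - g q / 2, ?_, key _ g h0 ?_⟩
    · simp only [hqv]; ring
    · intro y hy hyp
      have := hinv (show y ∈ V(H) \ {p} from ⟨hy, hyp⟩)
      simp only [this, hqv]
      ring

theorem IsPinch.frameEqCycle (h : Ω.IsPinch v H p q) (hloop : ∀ e, ¬ H.IsLink e p p)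
    (hE : E(Ω.graph).Finite) : Ω.FrameEqCycle H := by
  have : Nonempty α := ⟨v⟩
  obtain ⟨o, ho⟩ := Ω.graph.exists_orientation
  obtain ⟨oH, c, hoH, hc, h₁, h₂⟩ := h.exists_potentials hloop ho
  refine frameEqCycle_of_cobound hE ho h.edgeSet_eq hoH hc
    (fun h => (h₁ h).imp fun _ hg => hg.2.2) fun g => ?_
  -- Constants do not affect differences, so the value at `p` may be assumed to be `0`.
  obtain ⟨h, -, hh⟩ := h₂ (fun u => g u - g p) (sub_self _)
  exact ⟨h, fun e he => by rw [← hh e he]; ring⟩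

/-- The row space of a signed graph with pendant blocks replaced by glued pieces. -/
theorem frameEqCycle_of_isGluing {B : κ → Graph α β} {v : κ → α} {H : κ → Graph γ β} {p q : κ → γ}
    {G : Graph (Option (α ⊕ κ × γ)) β} (hB : Ω.graph.PendantBlocks B v)
    (hs : ∀ e ∈ E(Ω.graph), (∀ i, e ∉ E(B i)) → Ω.sign e = 1) (hEH : ∀ i, E(H i) = E(B i))
    (hG : (Ω.graph.remainder B v).IsGluing v H p q G) (ho : Graph.Orients o Ω.graph)
    (hpieces : ∀ i, p i ≠ q i ∧ ∃ (oH : β → γ × γ) (c : β → ℚ), Graph.Orients oH (H i) ∧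
      (∀ e, c e ≠ 0) ∧
      (∀ h : α → ℚ, ∃ g : γ → ℚ, g (p i) = 0 ∧ g (q i) = 2 * h (v i) ∧ ∀ e ∈ E(B i),
        g (oH e).1 - g (oH e).2 = c e * Ω.cobound o h e) ∧
      ∀ g : γ → ℚ, g (p i) = 0 → ∃ h : α → ℚ, g (q i) = 2 * h (v i) ∧ ∀ e ∈ E(B i),
        g (oH e).1 - g (oH e).2 = c e * Ω.cobound o h e) : Ω.FrameEqCycle G := by
  classical
  choose hpq oH c hoH hc h₁ h₂ using hpieces
  -- Each edge gets its orientation in `G` and its column factor together: those of its piece, or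
  -- the old orientation with factor `2` outside the pieces.
  have hdec : ∀ e, ∃ t : (Option (α ⊕ κ × γ) × Option (α ⊕ κ × γ)) × ℚ, t.2 ≠ 0 ∧
      (∀ i, e ∈ E(B i) →
        t = ((Graph.glueVertex v p q i (oH i e).1, Graph.glueVertex v p q i (oH i e).2), c i e)) ∧
      ((∀ i, e ∉ E(B i)) → t = ((some (Sum.inl (o e).1), some (Sum.inl (o e).2)), 2)) := by
    intro e
    by_cases he : ∃ i, e ∈ E(B i)
    · obtain ⟨i, hi⟩ := he
      refine ⟨((Graph.glueVertex v p q i (oH i e).1, Graph.glueVertex v p q i (oH i e).2), c i e),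
        hc i e, fun j hj => ?_, fun h => absurd hi (h i)⟩
      obtain rfl : i = j := by
        by_contra hij
        exact Set.disjoint_left.1 (hB.disjoint i j hij) hi hj
      rfl
    · push Not at he
      exact ⟨((some (Sum.inl (o e).1), some (Sum.inl (o e).2)), 2), two_ne_zero,
        fun i hi => absurd hi (he i), fun _ => rfl⟩
  choose t ht0 ht1 ht2 using hdec
  have hEG := hB.edgeSet_gluing hEH hG
  refine frameEqCycle_of_cobound (oH := fun e => (t e).1) (r := fun e => (t e).2) hB.finite ho hEG
    (fun e he => ?_) ht0 (fun h => ?_) fun g => ?_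
  · rw [hG.2]
    by_cases hi : ∃ i, e ∈ E(B i)
    · obtain ⟨i, hi⟩ := hi
      rw [ht1 e i hi]
      exact Or.inr ⟨i, _, _, hoH i e (hEH i ▸ hi), rfl, rfl⟩
    · push Not at hi
      rw [ht2 e hi]
      exact Or.inl ⟨_, _, hB.remainder_isLink.2 ⟨ho e (hEG ▸ he), hi⟩, rfl, rfl⟩
  · choose g hgp hgq hg using fun i => h₁ i h
    -- Doubling on the old vertices matches the value `2 * h (v i)` of each piece at `q i`; the new
    -- vertex carries the common value `0` of all `p i`.
    let k : Option (α ⊕ κ × γ) → ℚ := fun u => u.elim 0 (Sum.elim (fun x => 2 * h x)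
      fun iy => g iy.1 iy.2)
    have hk : ∀ i y, k (Graph.glueVertex v p q i y) = g i y := by
      intro i y
      by_cases hyp : y = p i
      · rw [hyp, Graph.glueVertex_left, hgp]; rfl
      by_cases hyq : y = q i
      · rw [hyq, Graph.glueVertex_right (hpq i), hgq]; rfl
      · rw [Graph.glueVertex_of_ne hyp hyq]; rfl
    refine ⟨k, fun e he => ?_⟩
    by_cases hi : ∃ i, e ∈ E(B i)
    · obtain ⟨i, hi⟩ := hi
      rw [ht1 e i hi, hk, hk]
      exact hg i e hi
    · push Not at hi
      rw [ht2 e hi, cobound, hs e (hEG ▸ he) hi, one_smul]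
      simp only [k, Option.elim, Sum.elim_inl]
      ring
  · let g' : Option (α ⊕ κ × γ) → ℚ := fun u => g u - g none
    choose h hhv hh using fun i => h₂ i (fun y => g' (Graph.glueVertex v p q i y))
      (by rw [Graph.glueVertex_left]; exact sub_self _)
    have hhv' : ∀ i, h i (v i) = g' (some (Sum.inl (v i))) / 2 := by
      intro i
      have := hhv i
      rw [Graph.glueVertex_right (hpq i)] at this
      linarith
    -- Interior vertices of a block take the value from that block, all other vertices half of the
    -- glued value. The two rules agree at `v i`.
    let k : α → ℚ := fun x => if hx : ∃ i, x ∈ V(B i) ∧ x ≠ v i then h hx.choose x else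
      g' (some (Sum.inl x)) / 2
    have hk0 : ∀ x, (∀ i, x ∈ V(B i) → x = v i) → k x = g' (some (Sum.inl x)) / 2 := by
      intro x hx
      exact dif_neg fun ⟨i, hi, hne⟩ => hne (hx i hi)
    have hk : ∀ i, ∀ x ∈ V(B i), k x = h i x := by
      intro i x hx
      by_cases hxv : x = v i
      · rw [hk0 x fun j hj => ?_, hxv, hhv']
        by_cases hij : j = i
        · rw [hij, hxv]
        · exact hB.eq_of_mem_of_mem hij hj hx
      · have hex : ∃ i, x ∈ V(B i) ∧ x ≠ v i := ⟨i, hx, hxv⟩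
        have : hex.choose = i := by
          by_contra hne
          exact hxv (hB.eq_of_mem_of_mem (Ne.symm hne) hx hex.choose_spec.1)
        simp only [k, dif_pos hex, this]
    refine ⟨k, fun e he => ?_⟩
    have hgg : ∀ u w, g u - g w = g' u - g' w := fun u w => by simp [g']
    have hl := ho e (hEG ▸ he)
    rw [hgg]
    by_cases hi : ∃ i, e ∈ E(B i)
    · obtain ⟨i, hi⟩ := hi
      have hl' := ((hB.isBlock i).le.isLink_iff hi).2 hl
      rw [ht1 e i hi, cobound, hk i _ hl'.left_mem, hk i _ hl'.right_mem]
      exact hh i e hi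
    · push Not at hi
      rw [ht2 e hi, cobound, hs e (hEG ▸ he) hi, one_smul,
        hk0 _ fun i hx => hB.eq_of_mem hx hl.inc_left (hi i),
        hk0 _ fun i hx => hB.eq_of_mem hx hl.inc_right (hi i)]
      simp only
      ring

end SignedGraph

namespace Graph

variable {α β γ κ : Type*} {G H K L : Graph α β} {p q u w x y : α} {A B C D X Y : Set β} {e f : β}

/-! ### A criterion for path graphs -/

/-- The parts `A` and `B` of the edge set meet in the vertex `w` only, and `w` strictly separates
`p` from `q`. -/
structure StrictSep (G : Graph α β) (p q w : α) (A B : Set β) : Prop where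
  disjoint : Disjoint A B
  union : A ∪ B = E(G)
  inter : G.vertsOf A ∩ G.vertsOf B = {w}
  left : p ∈ G.vertsOf A
  notMem_right : p ∉ G.vertsOf B
  right : q ∈ G.vertsOf B
  notMem_left : q ∉ G.vertsOf A

namespace StrictSep

variable {A' B' : Set β} {w' : α}

theorem symm (h : G.StrictSep p q w A B) : G.StrictSep q p w B A :=
  ⟨h.disjoint.symm, by rw [Set.union_comm, h.union], by rw [Set.inter_comm, h.inter], h.right,
    h.notMem_left, h.left, h.notMem_right⟩

theorem eq_of_mem (h : G.StrictSep p q w A B) (hA : x ∈ G.vertsOf A) (hB : x ∈ G.vertsOf B) :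
    x = w := h.inter.subset ⟨hA, hB⟩

theorem mem_left (h : G.StrictSep p q w A B) : w ∈ G.vertsOf A := (h.inter.superset rfl).1

theorem mem_right (h : G.StrictSep p q w A B) : w ∈ G.vertsOf B := (h.inter.superset rfl).2

theorem subset_left (h : G.StrictSep p q w A B) : A ⊆ E(G) := h.union ▸ Set.subset_union_left

theorem subset_right (h : G.StrictSep p q w A B) : B ⊆ E(G) := h.union ▸ Set.subset_union_right

/-- The connected set `A` avoids `w'`, so it cannot be divided by the second separation; an edge of
`A` at `p` shows which side contains it. -/
theorem subset_of_notMem (hG : G.Connected) (h : G.StrictSep p q w A B)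
    (h' : G.StrictSep p q w' A' B') (hw : w' ∉ G.vertsOf A) : A ⊆ A' := by
  have hA : G.EdgeConn A := hG.edgeConn.of_separation h.disjoint h.union
    (by rw [h.inter]; exact Set.subsingleton_singleton)
  by_contra hcon
  obtain ⟨f, hf, hfA⟩ := Set.not_subset.1 hcon
  have hu : A ∩ A' ∪ A ∩ B' = A := by
    rw [← Set.inter_union_distrib_left, h'.union, Set.inter_eq_left]
    exact h.subset_left
  have hfB : f ∈ B' := (h'.union.superset (h.subset_left hf)).resolve_left hfA
  obtain ⟨e, he, hep⟩ := h.left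
  have heA : e ∈ A' := (h'.union.superset (h.subset_left he)).resolve_right fun hb =>
    h'.notMem_right ⟨e, hb, hep⟩
  obtain ⟨z, hz, hz'⟩ := hA (A ∩ A') (A ∩ B') ⟨e, he, heA⟩ ⟨f, hf, hfB⟩
    (h'.disjoint.mono Set.inter_subset_right Set.inter_subset_right) hu
  obtain rfl := h'.eq_of_mem (vertsOf_mono Set.inter_subset_right hz)
    (vertsOf_mono Set.inter_subset_right hz')
  exact hw (vertsOf_mono Set.inter_subset_left hz)

/-- A cut-vertex has only one separation. Otherwise `A ∩ B'` would be a side of a separation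
incident with neither `p` nor `q`. -/
theorem eq_left_of_eq (hG : G.Connected)
    (hs : ∀ A B w, Disjoint A B → A ∪ B = E(G) → G.vertsOf A ∩ G.vertsOf B = {w} →
      G.StrictSep p q w A B ∨ G.StrictSep q p w A B)
    (h : G.StrictSep p q w A B) (h' : G.StrictSep p q w A' B') : A ⊆ A' := by
  by_contra hcon
  obtain ⟨f, hf, hfA⟩ := Set.not_subset.1 hcon
  have hfB : f ∈ B' := (h'.union.superset (h.subset_left hf)).resolve_left hfA
  have hsub : A ∩ B' ⊆ E(G) := Set.inter_subset_left.trans h.subset_left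
  have hsing : (G.vertsOf (A ∩ B') ∩ G.vertsOf (E(G) \ (A ∩ B'))).Subsingleton := by
    refine Set.subsingleton_of_subset_singleton (a := w) ?_
    rintro z ⟨hz, e, he, hez⟩
    by_cases heA : e ∈ A
    · have : e ∈ A' := (h'.union.superset he.1).resolve_right fun hb => he.2 ⟨heA, hb⟩
      exact h'.eq_of_mem ⟨e, this, hez⟩ (vertsOf_mono Set.inter_subset_right hz)
    · exact h.eq_of_mem (vertsOf_mono Set.inter_subset_left hz)
        ⟨e, (h.union.superset he.1).resolve_left heA, hez⟩
  obtain ⟨g, hg, -⟩ := h.right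
  have hgA : g ∉ A := fun h' => Set.disjoint_left.1 h.disjoint h' hg
  obtain ⟨z, hz⟩ := hG.edgeConn.exists_inter_eq_singleton (A := A ∩ B')
    (B := E(G) \ (A ∩ B')) ⟨f, hf, hfB⟩
    ⟨g, h.subset_right hg, fun h => hgA h.1⟩ Set.disjoint_sdiff_right (Set.union_sdiff_cancel hsub)
    hsing
  rcases hs _ _ z Set.disjoint_sdiff_right (Set.union_sdiff_cancel hsub) hz with h1 | h1
  · exact h'.notMem_right (vertsOf_mono Set.inter_subset_right h1.left)
  · exact h.notMem_left (vertsOf_mono Set.inter_subset_left h1.left)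

end StrictSep

/-- The cut-vertices are linearly ordered by inclusion of their sides at `p`, and a block is located
by the number of cut-vertices having it on the side of `q`. Blocks and cut-vertices then alternate
along a path. -/
theorem isPathGraph_of_strictSep (hG : G.Connected) (hE : E(G).Finite) (hne : E(G).Nonempty)
    (hs : ∀ A B w, Disjoint A B → A ∪ B = E(G) → G.vertsOf A ∩ G.vertsOf B = {w} →
      G.StrictSep p q w A B ∨ G.StrictSep q p w A B) : G.IsPathGraph := by
  classical
  refine ⟨hG, ?_⟩
  have : ∀ w : {w : α // G.IsCutVertex w}, ∃ XY : Set β × Set β,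
      G.StrictSep p q w.1 XY.1 XY.2 := by
    rintro ⟨w, A, B, -, -, -, -, hd, hu, hw⟩
    rcases hs A B w hd hu hw with h | h
    exacts [⟨(A, B), h⟩, ⟨(B, A), h.symm⟩]
  choose XY hXY using this
  let X := fun w => (XY w).1
  let Y := fun w => (XY w).2
  have hX : ∀ w, G.StrictSep p q w.1 (X w) (Y w) := hXY
  clear_value X Y
  have hYc : ∀ w e, e ∈ E(G) → (e ∈ Y w ↔ e ∉ X w) := fun w e he =>
    ⟨fun h h' => Set.disjoint_left.1 (hX w).disjoint h' h,
      fun h => ((hX w).union.superset he).resolve_left h⟩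
  have hXinj : ∀ w w', X w = X w' → w = w' := by
    intro w w' h
    have hY : Y w = Y w' := by
      ext e
      constructor
      · intro he
        have heE := (hX w).subset_right he
        rwa [hYc _ _ heE, ← h, ← hYc _ _ heE]
      · intro he
        have heE := (hX w').subset_right he
        rwa [hYc _ _ heE, h, ← hYc _ _ heE]
    have := (hX w).inter
    rw [h, hY, (hX w').inter, Set.singleton_eq_singleton_iff] at this
    exact Subtype.ext this.symm
  have lt_of_left : ∀ w w', w'.1 ∈ G.vertsOf (X w) → w ≠ w' → X w' ⊂ X w := by
    intro w w' h hne
    refine (Set.ssubset_iff_subset_ne).2 ⟨?_, fun h => hne (hXinj _ _ h).symm⟩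
    have hn : w'.1 ∉ G.vertsOf (Y w) := fun h' => hne (Subtype.ext ((hX w).eq_of_mem h h').symm)
    have := StrictSep.subset_of_notMem hG (hX w).symm (hX w').symm hn
    intro e he
    by_contra hcon
    exact Set.disjoint_left.1 (hX w').disjoint he
      (this ((hYc w e ((hX w').subset_left he)).2 hcon))
  have lt_of_right : ∀ w w', w'.1 ∈ G.vertsOf (Y w) → w ≠ w' → X w ⊂ X w' := by
    intro w w' h hne
    refine (Set.ssubset_iff_subset_ne).2 ⟨?_, fun h => hne (hXinj _ _ h)⟩
    exact StrictSep.subset_of_notMem hG (hX w) (hX w') fun h' =>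
      hne (Subtype.ext ((hX w).eq_of_mem h' h).symm)
  have total : ∀ w w', w ≠ w' → X w ⊂ X w' ∨ X w' ⊂ X w := by
    intro w w' hne
    obtain ⟨e, he, hew⟩ := (hX w').mem_left
    rcases (hX w).union.superset ((hX w').subset_left he) with h | h
    exacts [Or.inr (lt_of_left w w' ⟨e, h, hew⟩ hne), Or.inl (lt_of_right w w' ⟨e, h, hew⟩ hne)]
  have : Finite {w : α // G.IsCutVertex w} := by
    have : Finite (𝒫 E(G)) := hE.finite_subsets.to_subtype
    exact Finite.of_injective (fun w => (⟨X w, (hX w).subset_left⟩ : 𝒫 E(G)))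
      fun w w' h => hXinj _ _ (congrArg Subtype.val h)
  -- `r w` counts the cut-vertices before `w`, and `s K` those before the block `K`.
  let r : {w : α // G.IsCutVertex w} → ℕ := fun w => {w' | X w' ⊂ X w}.ncard
  let s : {B : Graph α β // G.IsBlock B} → ℕ := fun K => {w | E(K.1) ⊆ Y w}.ncard
  have hr : ∀ w, r w < Nat.card {w : α // G.IsCutVertex w} := by
    intro w
    rw [← Set.ncard_univ]
    refine Set.ncard_lt_ncard ((Set.ssubset_univ_iff).2 fun h => ?_)
    exact (show X w ⊂ X w from h.superset (Set.mem_univ w)).ne rfl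
  have hrmono : ∀ w w', X w ⊂ X w' → r w < r w' := by
    intro w w' h
    refine Set.ncard_lt_ncard ⟨fun u hu => hu.trans h, fun h' => ?_⟩
    exact (show X w ⊂ X w from h' h).ne rfl
  have hrinj : r.Injective := by
    intro w w' h
    by_contra hne
    rcases total w w' hne with h' | h'
    · exact (hrmono _ _ h').ne h
    · exact (hrmono _ _ h').ne' h
  have hsle : ∀ K, s K ≤ Nat.card {w : α // G.IsCutVertex w} := by
    intro K
    rw [← Set.ncard_univ]
    exact Set.ncard_le_ncard (Set.subset_univ _)
  have hside : ∀ (K : {B : Graph α β // G.IsBlock B}) w, E(K.1) ⊆ X w ∨ E(K.1) ⊆ Y w := by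
    intro K w
    refine K.2.nonSep.subset_or_subset (K.2.le.edgeSet_mono.trans (hX w).union.superset)
      (hX w).disjoint ?_
    rw [(hX w).inter]
    exact Set.subsingleton_singleton
  have hKne : ∀ K : {B : Graph α β // G.IsBlock B}, E(K.1).Nonempty := fun K =>
    hG.isBlock_nonempty hne K.2
  have hnot : ∀ (K : {B : Graph α β // G.IsBlock B}) w, E(K.1) ⊆ X w → ¬ E(K.1) ⊆ Y w := by
    intro K w h h'
    obtain ⟨e, he⟩ := hKne K
    exact Set.disjoint_left.1 (hX w).disjoint (h he) (h' he)
  -- The cut-vertices before `K` form an initial segment of the linear order.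
  have hrs : ∀ K w, E(K.1) ⊆ Y w ↔ r w < s K := by
    intro K w
    have hdown : ∀ w w', X w ⊂ X w' → E(K.1) ⊆ Y w' → E(K.1) ⊆ Y w := by
      intro w w' h hK e he
      have heE := K.2.le.edgeSet_mono he
      rw [hYc _ _ heE]
      exact fun h' => (hYc _ _ heE).1 (hK he) (h.subset h')
    constructor
    · intro h
      refine Set.ncard_lt_ncard ⟨fun w' hw' => hdown _ _ hw' h, fun h' => ?_⟩
      exact (show X w ⊂ X w from h' h).ne rfl
    · intro h
      by_contra hcon
      refine h.not_ge (Set.ncard_le_ncard fun w' hw' => ?_)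
      by_contra hcon'
      by_cases hww : w = w'
      · exact hcon (hww ▸ hw')
      · rcases total w w' hww with h1 | h1
        exacts [hcon (hdown _ _ h1 hw'), hcon' h1]
  -- Blocks in the same position have edges which no cut-vertex separates, so these edges lie in a
  -- common block.
  have hsinj : s.Injective := by
    intro K L h
    obtain ⟨e, he⟩ := hKne K
    obtain ⟨f, hf⟩ := hKne L
    have heE := K.2.le.edgeSet_mono he
    have hfE := L.2.le.edgeSet_mono hf
    have hKL : ∀ w, e ∈ Y w ↔ f ∈ Y w := by
      intro w
      have h1 : e ∈ Y w ↔ E(K.1) ⊆ Y w := ⟨fun h => (hside K w).resolve_left fun h' =>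
        Set.disjoint_left.1 (hX w).disjoint (h' he) h, fun h => h he⟩
      have h2 : f ∈ Y w ↔ E(L.1) ⊆ Y w := ⟨fun h => (hside L w).resolve_left fun h' =>
        Set.disjoint_left.1 (hX w).disjoint (h' hf) h, fun h => h hf⟩
      rw [h1, h2, hrs, hrs, h]
    rcases hG.edgeConn.separation_or_nonSep hE heE hfE with
      ⟨A, B, w, hd, hu, hw, heA, hfB⟩ | ⟨Z, hZ, hN, heZ, hfZ⟩
    · have key : ∀ A B : Set β, ∀ e f, e ∈ A → f ∈ B → G.StrictSep p q w A B →
          (∀ w, e ∈ Y w ↔ f ∈ Y w) → False := by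
        intro A B e f heA hfB hAB hef
        let w' : {w : α // G.IsCutVertex w} :=
          ⟨w, A, B, by simp, by simp, ⟨e, heA⟩, ⟨f, hfB⟩, hAB.disjoint, hAB.union, hAB.inter⟩
        have h1 := StrictSep.eq_left_of_eq hG hs hAB (hX w') heA
        have h2 := StrictSep.eq_left_of_eq hG (fun A B w h1 h2 h3 => (hs A B w h1 h2 h3).symm)
          hAB.symm (hX w').symm hfB
        exact (hYc w' e (hAB.subset_left heA)).1 ((hef w').2 h2) h1
      rcases hs A B w hd hu hw with h' | h'
      · exact (key A B e f heA hfB h' hKL).elim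
      · exact (key B A f e hfB heA h'.symm fun w => (hKL w).symm).elim
    · obtain ⟨M, hM, hZM⟩ := exists_isBlock hE hZ ⟨e, heZ⟩ hN
      exact Subtype.ext ((K.2.eq_of_mem hM he (hZM heZ)).trans (L.2.eq_of_mem hM hf (hZM hfZ)).symm)
  have hKmem : ∀ (K : {B : Graph α β // G.IsBlock B}) x, x ∈ V(K.1) → ∃ e ∈ E(K.1), G.Inc e x := by
    intro K x hx
    rwa [← K.2.vertsOf_eq (hKne K)] at hx
  have hadj_left : ∀ (K : {B : Graph α β // G.IsBlock B}) w, w.1 ∈ V(K.1) → E(K.1) ⊆ X w →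
      s K = r w := by
    intro K w hw hK
    obtain ⟨e, he, hew⟩ := hKmem K _ hw
    have h1 : ¬ r w < s K := fun h => hnot K w hK ((hrs K w).2 h)
    refine le_antisymm (not_lt.1 h1) (Set.ncard_le_ncard fun w' hw' => ?_)
    refine (hside K w').resolve_left fun h => ?_
    exact (lt_of_left w' w ⟨e, h he, hew⟩ fun h => (h ▸ hw' : X w ⊂ X w).ne rfl).asymm hw'
  have hadj_right : ∀ (K : {B : Graph α β // G.IsBlock B}) w, w.1 ∈ V(K.1) → E(K.1) ⊆ Y w →
      s K = r w + 1 := by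
    intro K w hw hK
    obtain ⟨e, he, hew⟩ := hKmem K _ hw
    have h1 : r w < s K := (hrs K w).1 hK
    refine le_antisymm ?_ h1
    have hnw : w ∉ {w' | X w' ⊂ X w} := fun h : X w ⊂ X w => h.ne rfl
    rw [← Set.ncard_insert_of_notMem hnw]
    refine Set.ncard_le_ncard fun w' hw' => ?_
    by_cases hww : w' = w
    · exact Or.inl hww
    · exact Or.inr (lt_of_right w' w ⟨e, hw' he, hew⟩ hww)
  have hexK : ∀ e ∈ E(G), ∃ K : {B : Graph α β // G.IsBlock B}, e ∈ E(K.1) := by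
    intro e he
    obtain ⟨K, hK, h⟩ := exists_isBlock hE (Set.singleton_subset_iff.2 he) ⟨e, rfl⟩ nonSep_singleton
    exact ⟨⟨K, hK⟩, h rfl⟩
  have hVK : ∀ (K : {B : Graph α β // G.IsBlock B}) e x, e ∈ E(K.1) → G.Inc e x → x ∈ V(K.1) := by
    intro K e x he hx
    rw [← K.2.vertsOf_eq (hKne K)]
    exact ⟨e, he, hx⟩
  have hex_left : ∀ w : {w : α // G.IsCutVertex w}, ∃ K : {B : Graph α β // G.IsBlock B},
      w.1 ∈ V(K.1) ∧ s K = r w := by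
    intro w
    obtain ⟨e, he, hew⟩ := (hX w).mem_left
    obtain ⟨K, hK⟩ := hexK e ((hX w).subset_left he)
    have hw := hVK K e _ hK hew
    exact ⟨K, hw, hadj_left K w hw ((hside K w).resolve_right fun h =>
      Set.disjoint_left.1 (hX w).disjoint he (h hK))⟩
  have hex_right : ∀ w : {w : α // G.IsCutVertex w}, ∃ K : {B : Graph α β // G.IsBlock B},
      w.1 ∈ V(K.1) ∧ s K = r w + 1 := by
    intro w
    obtain ⟨e, he, hew⟩ := (hX w).mem_right
    obtain ⟨K, hK⟩ := hexK e ((hX w).subset_right he)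
    have hw := hVK K e _ hK hew
    exact ⟨K, hw, hadj_right K w hw ((hside K w).resolve_left fun h =>
      Set.disjoint_left.1 (hX w).disjoint (h hK) he)⟩
  have hadj : ∀ (K : {B : Graph α β // G.IsBlock B}) (w : {w : α // G.IsCutVertex w}),
      w.1 ∈ V(K.1) ↔ s K = r w ∨ s K = r w + 1 := by
    intro K w
    constructor
    · intro h
      exact (hside K w).imp (hadj_left K w h) (hadj_right K w h)
    · rintro (h | h)
      · obtain ⟨L, hL, hLs⟩ := hex_left w
        rwa [hsinj (h.trans hLs.symm)]
      · obtain ⟨L, hL, hLs⟩ := hex_right w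
        rwa [hsinj (h.trans hLs.symm)]
  set m := Nat.card {w : α // G.IsCutVertex w} with hm
  have hrsurj : ∀ n < m, ∃ w, r w = n := by
    intro n hn
    have hinj : (fun w => (⟨r w, hr w⟩ : Fin m)).Injective := fun w w' h =>
      hrinj (congrArg Fin.val h)
    have hbij := (Nat.bijective_iff_injective_and_card _).2 ⟨hinj, by simp [hm]⟩
    obtain ⟨w, hw⟩ := hbij.2 ⟨n, hn⟩
    exact ⟨w, congrArg Fin.val hw⟩
  have hssurj : ∀ n ≤ m, ∃ K, s K = n := by
    intro n hn
    rcases hn.lt_or_eq with h | h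
    · obtain ⟨w, hw⟩ := hrsurj n h
      obtain ⟨K, -, hK⟩ := hex_left w
      exact ⟨K, hK.trans hw⟩
    · rcases n with _ | n
      · obtain ⟨e, he⟩ := hne
        obtain ⟨K, -⟩ := hexK e he
        exact ⟨K, le_antisymm (h ▸ hsle K) (Nat.zero_le _)⟩
      · obtain ⟨w, hw⟩ := hrsurj n (by omega)
        obtain ⟨K, -, hK⟩ := hex_right w
        exact ⟨K, by rw [hK, hw]⟩
  -- Blocks take the even positions and cut-vertices the odd ones; with `m` cut-vertices there are
  -- `m + 1` blocks.
  let pos : {B : Graph α β // G.IsBlock B} ⊕ {w : α // G.IsCutVertex w} → Fin (2 * m + 1) :=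
    Sum.elim (fun K => ⟨2 * s K, by have := hsle K; omega⟩)
      fun w => ⟨2 * r w + 1, by have := hr w; omega⟩
  have hpos : pos.Bijective := by
    constructor
    · rintro (K | w) (L | w') h
      · have : 2 * s K = 2 * s L := congrArg Fin.val h
        rw [hsinj (show s K = s L by omega)]
      · have : 2 * s K = 2 * r w' + 1 := congrArg Fin.val h
        omega
      · have : 2 * r w + 1 = 2 * s L := congrArg Fin.val h
        omega
      · have : 2 * r w + 1 = 2 * r w' + 1 := congrArg Fin.val h
        rw [hrinj (show r w = r w' by omega)]
    · rintro ⟨n, hn⟩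
      rcases Nat.even_or_odd' n with ⟨j, rfl | rfl⟩
      · obtain ⟨K, hK⟩ := hssurj j (by omega)
        exact ⟨Sum.inl K, Fin.ext (by simp [pos, hK])⟩
      · obtain ⟨w, hw⟩ := hrsurj j (by omega)
        exact ⟨Sum.inr w, Fin.ext (by simp [pos, hw])⟩
  refine ⟨2 * m + 1, ⟨⟨Equiv.ofBijective pos hpos, ?_⟩⟩⟩
  rintro (K | w) (L | w')
  · simp only [Equiv.ofBijective_apply, SimpleGraph.pathGraph_adj, blockCutGraph,
      SimpleGraph.fromRel_adj, pos, Sum.elim_inl]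
    constructor
    · intro h
      omega
    · rintro ⟨-, ⟨_, _, _, h, _⟩ | ⟨_, _, _, h, _⟩⟩ <;> simp at h
  · simp only [Equiv.ofBijective_apply, SimpleGraph.pathGraph_adj, blockCutGraph,
      SimpleGraph.fromRel_adj, pos, Sum.elim_inl, Sum.elim_inr]
    constructor
    · intro h
      exact ⟨by simp, Or.inl ⟨K, w', rfl, rfl, (hadj K w').2 (by omega)⟩⟩
    · rintro ⟨-, ⟨_, _, h1, h2, h⟩ | ⟨_, _, h, _⟩⟩
      · cases h1; cases h2
        have := (hadj K w').1 h
        omega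
      · simp at h
  · simp only [Equiv.ofBijective_apply, SimpleGraph.pathGraph_adj, blockCutGraph,
      SimpleGraph.fromRel_adj, pos, Sum.elim_inl, Sum.elim_inr]
    constructor
    · intro h
      exact ⟨by simp, Or.inr ⟨L, w, rfl, rfl, (hadj L w).2 (by omega)⟩⟩
    · rintro ⟨-, ⟨_, _, h, _⟩ | ⟨_, _, h1, h2, h⟩⟩
      · simp at h
      · cases h1; cases h2
        have := (hadj L w).1 h
        omega
  · simp only [Equiv.ofBijective_apply, SimpleGraph.pathGraph_adj, blockCutGraph,
      SimpleGraph.fromRel_adj, pos, Sum.elim_inr]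
    constructor
    · intro h
      omega
    · rintro ⟨-, ⟨_, _, h, _⟩ | ⟨_, _, h, _⟩⟩ <;> simp at h

end Graph

namespace SignedGraph

variable {α β γ κ : Type*} {Ω : SignedGraph α β} {v : α} {A B : Set β} {e : β} {H : Graph γ β}
  {p q w x y : γ}

/-! ### Splitting a vertex -/

/-- Two parts share two vertices of the pinched graph. A common vertex other than `v` has a unique
preimage and stays common. If the parts share at most one vertex of `H`, then `v` is also common to
them in the pinched graph, so each part reaches `p` or `q`. -/
theorem IsPinch.exists_mem (h : Ω.IsPinch v H p q) (hA : A.Nonempty) (hB : B.Nonempty)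
    (hd : Disjoint A B) (hu : A ∪ B = E(H)) (hN : Ω.graph.NonSep E(Ω.graph)) :
    (∃ x ∈ H.vertsOf A ∩ H.vertsOf B, x ≠ p ∧ x ≠ q) ∧
      ((H.vertsOf A ∩ H.vertsOf B).Subsingleton → (p ∈ H.vertsOf A ∨ q ∈ H.vertsOf A) ∧
        (p ∈ H.vertsOf B ∨ q ∈ H.vertsOf B)) := by
  have hEq := h.edgeSet_eq
  obtain ⟨hp, hq, hpq, ⟨f, hfp, hfq, hinj, hf⟩, -⟩ := h
  have hvert : ∀ (X : Set β) x, x ∈ Ω.graph.vertsOf X → ∃ a ∈ H.vertsOf X, f a = x := by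
    rintro X x ⟨e, he, hex⟩
    rw [hf, Graph.map_inc] at hex
    obtain ⟨a, ha, rfl⟩ := hex
    exact ⟨a, ⟨e, he, ha⟩, rfl⟩
  have hmem : ∀ (X : Set β) a, a ∈ H.vertsOf X → a ∈ V(H) := fun X a ⟨e, _, he⟩ => he.vertex_mem
  have hv : ∀ (X : Set β) a, a ∈ H.vertsOf X → f a = v → a = p ∨ a = q := by
    intro X a ha hav
    by_contra! hcon
    exact hcon.2 (hinj ⟨hmem X a ha, hcon.1⟩ ⟨hq, hpq.symm⟩ (hav.trans hfq.symm))
  have hcom : ∀ x, x ∈ Ω.graph.vertsOf A → x ∈ Ω.graph.vertsOf B → x ≠ v →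
      ∃ a ∈ H.vertsOf A ∩ H.vertsOf B, f a = x := by
    intro x hxA hxB hx
    obtain ⟨a, ha, rfl⟩ := hvert A x hxA
    obtain ⟨b, hb, hab⟩ := hvert B _ hxB
    have hap : a ≠ p := fun h => hx (h ▸ hfp)
    have hbp : b ≠ p := fun h => hx (hab ▸ h ▸ hfp)
    obtain rfl := hinj ⟨hmem B b hb, hbp⟩ ⟨hmem A a ha, hap⟩ hab
    exact ⟨b, ⟨ha, hb⟩, rfl⟩
  have hne : ∀ a, f a ≠ v → a ≠ p ∧ a ≠ q := fun a ha => ⟨fun h => ha (h ▸ hfp), fun h => ha (h ▸ hfq)⟩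
  obtain ⟨x, hx, y, hy, hxy⟩ := hN A B hA hB hd (hu.trans hEq)
  constructor
  · by_cases hxv : x = v
    · obtain ⟨a, ha, rfl⟩ := hcom y hy.1 hy.2 fun h => hxy (hxv.trans h.symm)
      exact ⟨a, ha, hne a fun h => hxy (hxv.trans h.symm)⟩
    · obtain ⟨a, ha, rfl⟩ := hcom x hx.1 hx.2 hxv
      exact ⟨a, ha, hne a hxv⟩
  · intro hs
    have key : v ∈ Ω.graph.vertsOf A ∩ Ω.graph.vertsOf B := by
      by_cases hxv : x = v
      · exact hxv ▸ hx
      by_cases hyv : y = v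
      · exact hyv ▸ hy
      obtain ⟨a, ha, rfl⟩ := hcom x hx.1 hx.2 hxv
      obtain ⟨b, hb, rfl⟩ := hcom y hy.1 hy.2 hyv
      exact absurd (congrArg f (hs ha hb)) hxy
    obtain ⟨a, ha, hav⟩ := hvert A v key.1
    obtain ⟨b, hb, hbv⟩ := hvert B v key.2
    exact ⟨(hv A a ha hav).imp (fun h : a = p => h ▸ ha) fun h : a = q => h ▸ ha,
      (hv B b hb hbv).imp (fun h : b = p => h ▸ hb) fun h : b = q => h ▸ hb⟩

theorem IsPinch.strictSep (h : Ω.IsPinch v H p q) (hd : Disjoint A B) (hu : A ∪ B = E(H))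
    (hw : H.vertsOf A ∩ H.vertsOf B = {w}) (hN : Ω.graph.NonSep E(Ω.graph)) :
    H.StrictSep p q w A B ∨ H.StrictSep q p w A B := by
  have hwm := hw.superset rfl
  obtain ⟨⟨x, hx, hxp, hxq⟩, hs⟩ := h.exists_mem (hwm.1.imp fun _ h => h.1)
    (hwm.2.imp fun _ h => h.1) hd hu hN
  rw [hw] at hx
  obtain rfl := hx
  have hnot : ∀ z, z ≠ x → z ∈ H.vertsOf A → z ∉ H.vertsOf B := fun z hz hA hB =>
    hz (hw.subset ⟨hA, hB⟩)
  obtain ⟨h1 | h1, h2 | h2⟩ := hs (by rw [hw]; exact Set.subsingleton_singleton)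
  · exact absurd h2 (hnot p hxp.symm h1)
  · exact Or.inl ⟨hd, hu, hw, h1, hnot p hxp.symm h1, h2, fun h => hnot q hxq.symm h h2⟩
  · exact Or.inr ⟨hd, hu, hw, h1, hnot q hxq.symm h1, h2, fun h => hnot p hxp.symm h h2⟩
  · exact absurd h2 (hnot q hxq.symm h1)

theorem IsPinch.isPathGraph (h : Ω.IsPinch v H p q) (hN : Ω.graph.NonSep E(Ω.graph))
    (hE : E(Ω.graph).Finite) (hV : V(H) ⊆ H.vertsOf E(H)) : H.IsPathGraph := by
  obtain ⟨e, he, -⟩ := hV h.1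
  refine Graph.isPathGraph_of_strictSep (p := p) (q := q)
    (Graph.connected_of_edgeConn (fun A B hA hB hd hu => ?_) hV ⟨p, h.1⟩)
    (h.edgeSet_eq ▸ hE) ⟨e, he⟩ fun A B w hd hu hw => h.strictSep hd hu hw hN
  obtain ⟨⟨x, hx, -⟩, -⟩ := h.exists_mem hA hB hd hu hN
  exact ⟨x, hx⟩

/-- The graph obtained from a signed graph by splitting the vertex `f p`: the edges labelled `-1`
are made incident with the new vertex `p`. The names of the vertices are given by the map `f`, which
is injective on the set `S` of the old vertices. -/
def split (Ω : SignedGraph α β) (f : γ → α) (S : Set γ) (p : γ) (hS : Set.InjOn f S)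
    (hp : p ∉ S) : Graph γ β where
  vertexSet := insert p S
  IsLink e a b := Ω.graph.IsLink e (f a) (f b) ∧
    (Ω.sign e = 1 ∧ a ∈ S ∧ b ∈ S ∨ Ω.sign e = -1 ∧ a = p ∧ b ∈ S ∨ Ω.sign e = -1 ∧ a ∈ S ∧ b = p)
  isLink_symm := by
    intro e _
    constructor
    rintro a b ⟨h, h'⟩
    exact ⟨h.symm, by tauto⟩
  eq_or_eq_of_isLink_of_isLink := by
    have hne : (1 : ℤˣ) ≠ -1 := by decide
    rintro e a b c d ⟨h, ⟨hs, ha, hb⟩ | ⟨hs, rfl, hb⟩ | ⟨hs, ha, rfl⟩⟩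
      ⟨h', ⟨hs', hc, hd⟩ | ⟨hs', rfl, hd⟩ | ⟨hs', hc, rfl⟩⟩
    · exact (h.left_eq_or_eq h').imp (hS ha hc) (hS ha hd)
    · exact absurd (hs.symm.trans hs') hne
    · exact absurd (hs.symm.trans hs') hne
    · exact absurd (hs'.symm.trans hs) hne
    · exact Or.inl rfl
    · exact Or.inr rfl
    · exact absurd (hs'.symm.trans hs) hne
    · refine Or.inr (hS ha hd ?_)
      rcases h.eq_and_eq_or_eq_and_eq h' with ⟨h1, h2⟩ | ⟨h1, h2⟩
      exacts [h1.trans h2, h1]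
    · refine Or.inl (hS ha hc ?_)
      rcases h.eq_and_eq_or_eq_and_eq h' with ⟨h1, h2⟩ | ⟨h1, h2⟩
      exacts [h1, h1.trans h2]
  left_mem_of_isLink := by
    rintro e a b ⟨h, ⟨hs, ha, hb⟩ | ⟨hs, rfl, hb⟩ | ⟨hs, ha, rfl⟩⟩
    exacts [Or.inr ha, Or.inl rfl, Or.inr ha]

/-- Splitting `v` by the signs of its edges gives the unpinched graph. That both new vertices have
edges, as connectedness requires, follows because the block is unbalanced. -/
theorem exists_isPinch [Infinite γ] (hV : V(Ω.graph).Finite) (hE : E(Ω.graph).Finite)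
    (hc : Ω.graph.Connected) (hN : Ω.graph.NonSep E(Ω.graph)) (hv : v ∈ V(Ω.graph))
    (hs : ∀ e ∈ E(Ω.graph), Ω.sign e = -1 → Ω.graph.Inc e v) (hub : ¬ Ω.IsBalanced) :
    ∃ (H : Graph γ β) (p q : γ), H.IsPathGraph ∧ Ω.IsPinch v H p q := by
  classical
  -- The infinite type `γ` provides names for the finitely many old vertices and one further name
  -- for the new vertex.
  obtain ⟨g, p, hg, hp⟩ : ∃ (g : α → γ) (p : γ), Set.InjOn g V(Ω.graph) ∧ p ∉ g '' V(Ω.graph) := by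
    have := hV.to_subtype
    obtain ⟨n, ⟨φ⟩⟩ := Finite.exists_equiv_fin V(Ω.graph)
    let N := Infinite.natEmbedding γ
    refine ⟨fun x => if hx : x ∈ V(Ω.graph) then N (φ ⟨x, hx⟩) else N 0, N n, ?_, ?_⟩
    · intro x hx y hy hxy
      simp only [dif_pos hx, dif_pos hy] at hxy
      exact congrArg Subtype.val (φ.injective (Fin.ext (N.injective hxy)))
    · rintro ⟨x, hx, h⟩
      simp only [dif_pos hx] at h
      exact (φ ⟨x, hx⟩).2.ne (N.injective h)
  have : Nonempty α := ⟨v⟩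
  let f : γ → α := fun y => if y = p then v else Function.invFunOn g V(Ω.graph) y
  have hfp : f p = v := if_pos rfl
  have hfg : ∀ x ∈ V(Ω.graph), f (g x) = x := by
    intro x hx
    have : g x ≠ p := fun h => hp ⟨x, hx, h⟩
    simp only [f, if_neg this]
    exact hg.leftInvOn_invFunOn hx
  have hinj : Set.InjOn f (g '' V(Ω.graph)) := by
    rintro _ ⟨x, hx, rfl⟩ _ ⟨y, hy, rfl⟩ h
    rw [hfg x hx, hfg y hy] at h
    rw [h]
  let H := Ω.split f (g '' V(Ω.graph)) p hinj hp
  have hlink : ∀ e x y, Ω.graph.IsLink e x y → ∃ a b, H.IsLink e a b ∧ f a = x ∧ f b = y ∧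
      (x ≠ v → a = g x) ∧ (y ≠ v → b = g y) := by
    intro e x y hl
    have hx := hl.left_mem
    have hy := hl.right_mem
    rcases Int.units_eq_one_or (Ω.sign e) with h1 | h1
    · exact ⟨g x, g y, ⟨by rwa [hfg x hx, hfg y hy], Or.inl ⟨h1, ⟨x, hx, rfl⟩, ⟨y, hy, rfl⟩⟩⟩,
        hfg x hx, hfg y hy, fun _ => rfl, fun _ => rfl⟩
    · rcases (hs e hl.edge_mem h1).eq_or_eq_of_isLink hl with rfl | rfl
      · exact ⟨p, g y, ⟨by rwa [hfp, hfg y hy], Or.inr (Or.inl ⟨h1, rfl, ⟨y, hy, rfl⟩⟩)⟩,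
          hfp, hfg y hy, fun h => absurd rfl h, fun _ => rfl⟩
      · exact ⟨g x, p, ⟨by rwa [hfp, hfg x hx], Or.inr (Or.inr ⟨h1, ⟨x, hx, rfl⟩, rfl⟩)⟩,
          hfg x hx, hfp, fun _ => rfl, fun h => absurd rfl h⟩
  have hEH : ∀ e, e ∈ E(H) ↔ e ∈ E(Ω.graph) := by
    intro e
    constructor
    · intro he
      obtain ⟨a, b, hab⟩ := Graph.exists_isLink_of_mem_edgeSet he
      exact hab.1.edge_mem
    · intro he
      obtain ⟨x, y, hl⟩ := Graph.exists_isLink_of_mem_edgeSet he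
      obtain ⟨a, b, hab, -⟩ := hlink e x y hl
      exact hab.edge_mem
  have hincp : ∀ e ∈ E(Ω.graph), Ω.sign e = -1 → H.Inc e p ∧ ∃ y ∈ V(Ω.graph), H.IsLink e p (g y) := by
    intro e he h1
    obtain ⟨y, hy⟩ := hs e he h1
    have : H.IsLink e p (g y) := ⟨by rwa [hfp, hfg y hy.right_mem],
      Or.inr (Or.inl ⟨h1, rfl, ⟨y, hy.right_mem, rfl⟩⟩)⟩
    exact ⟨this.inc_left, y, hy.right_mem, this⟩
  have hpinch : Ω.IsPinch v H p (g v) := by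
    refine ⟨Or.inl rfl, Or.inr ⟨v, hv, rfl⟩, fun h => hp ⟨v, hv, h.symm⟩,
      ⟨f, hfp, hfg v hv, ?_, ?_⟩, fun e he => ⟨fun h => (hincp e ((hEH e).1 he) h).1, ?_⟩⟩
    · refine hinj.mono ?_
      rintro y ⟨rfl | hy, hne⟩
      exacts [absurd rfl hne, hy]
    · refine Graph.ext ?_ fun e x y => ?_
      · rw [Graph.vertexSet_map]
        ext x
        constructor
        · exact fun hx => ⟨g x, Or.inr ⟨x, hx, rfl⟩, hfg x hx⟩
        · rintro ⟨a, rfl | ⟨x, hx, rfl⟩, rfl⟩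
          · rwa [hfp]
          · rwa [hfg x hx]
      · rw [Graph.map_isLink]
        constructor
        · intro hl
          obtain ⟨a, b, hab, ha, hb, -⟩ := hlink e x y hl
          exact ⟨a, b, hab, ha, hb⟩
        · rintro ⟨a, b, hab, rfl, rfl⟩
          exact hab.1
    · rintro ⟨b, hb⟩
      rcases hb.2 with ⟨-, h, -⟩ | ⟨h, -⟩ | ⟨h, -⟩
      exacts [absurd h hp, h, h]
  refine ⟨H, p, g v, hpinch.isPathGraph hN hE ?_, hpinch⟩
  have hbal : ∀ δ : α → ℤˣ, (∀ e x y, Ω.graph.IsLink e x y → δ x = Ω.sign e * δ y) → False :=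
    fun δ hδ => hub fun C hC => mem_balancedCycles.2
      ⟨hC, prodSign_eq_one hC fun e _ x y hl => hδ e x y hl⟩
  have hneg : ∃ e ∈ E(Ω.graph), Ω.sign e = -1 := by
    by_contra! hcon
    refine hbal (fun _ => 1) fun e x y hl => ?_
    rw [(Int.units_eq_one_or _).resolve_right (hcon e hl.edge_mem), one_mul]
  obtain ⟨e₀, he₀, hs₀⟩ := hneg
  rintro y (rfl | ⟨x, hx, rfl⟩)
  · exact ⟨e₀, (hEH _).2 he₀, (hincp e₀ he₀ hs₀).1⟩
  -- If the positive half of `v` had no edges, then all edges at `v` would be negative and none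
  -- would be a loop; switching at `v` alone would make the graph balanced.
  by_cases hxv : x = v
  · subst hxv
    by_contra hcon
    have hno : ∀ e b, ¬ H.IsLink e (g x) b := fun e b h => hcon ⟨e, h.edge_mem, h.inc_left⟩
    have hloop : ∀ e, ¬ Ω.graph.IsLink e x x := by
      intro e hl
      rcases Int.units_eq_one_or (Ω.sign e) with h1 | h1
      · exact hno e (g x) ⟨by rwa [hfg x hx], Or.inl ⟨h1, ⟨x, hx, rfl⟩, ⟨x, hx, rfl⟩⟩⟩
      · exact hno e p ⟨by rwa [hfg x hx, hfp], Or.inr (Or.inr ⟨h1, ⟨x, hx, rfl⟩, rfl⟩)⟩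
    have hsx : ∀ e y, Ω.graph.IsLink e x y → Ω.sign e = -1 := fun e y hl =>
      (Int.units_eq_one_or _).resolve_left fun h1 => hno e (g y)
        ⟨by rwa [hfg x hx, hfg y hl.right_mem], Or.inl ⟨h1, ⟨x, hx, rfl⟩, ⟨y, hl.right_mem, rfl⟩⟩⟩
    refine hbal (fun y => if y = x then -1 else 1) fun e y z hl => ?_
    by_cases hy : y = x
    · subst hy
      have hz : z ≠ y := fun h => hloop e (h ▸ hl)
      simp [hsx e z hl, hz]
    · by_cases hz : z = x
      · subst hz
        simp [hsx e y hl.symm, hy]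
      · have : Ω.sign e = 1 := (Int.units_eq_one_or _).resolve_right fun h => by
          rcases (hs e hl.edge_mem h).eq_or_eq_of_isLink hl with h | h
          exacts [hy h.symm, hz h.symm]
        simp [this, hy, hz]
  · have := (hc.vertsOf_eq ⟨e₀, he₀⟩).superset hx
    obtain ⟨e, he, y, hl⟩ := this
    obtain ⟨a, b, hab, -, -, ha, -⟩ := hlink e x y hl
    exact ⟨e, hab.edge_mem, ha hxv ▸ hab.inc_left⟩

end SignedGraph

/-! ### Pendant end-blocks and their replacement by 2-isomorphic pieces -/

namespace Graph

/-- A vertex shared by an end-block and the remaining edges is a cut-vertex. Since `v i` is a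
cut-vertex in the same end-block, the two coincide. -/
theorem pendantBlocks_of_separates {α β κ : Type*} {G : Graph α β} {B : κ → Graph α β} {v : κ → α}
    (hG : G.Connected) (hE : E(G).Finite) (hB : B.Injective) (hend : ∀ i, G.IsEndBlock (B i))
    (hv : ∀ i, v i ∈ V(B i))
    (hsep : ∀ i, G.Separates (v i) E(B i) (⋃ j ∈ {j | j ≠ i}, E(B j))) : G.PendantBlocks B v := by
  have hne : ∀ i, E(B i).Nonempty := fun i => by
    obtain ⟨X, Y, -, -, ⟨e, he⟩, -, -, hu, -⟩ := hsep i
    exact hG.isBlock_nonempty ⟨e, hu.subset (Or.inl he)⟩ (hend i).1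
  refine ⟨hG, hE, fun i => (hend i).1, hne, fun i => ?_, fun i j hij => ?_⟩
  · have hsub : ∀ z ∈ G.vertsOf E(B i) ∩ G.vertsOf (E(G) \ E(B i)), z = v i := by
      rintro z ⟨hz, hz'⟩
      obtain ⟨X, Y, hX, -, hX', hY', hd, hu, hw⟩ := hsep i
      refine (hend i).2 ⟨(hend i).1.isCutVertex hG hE hz hz', ?_⟩
        ⟨⟨X, Y, by simp, by simp, hX', hY', hd, hu, hw⟩, hv i⟩
      rwa [← (hend i).1.vertsOf_eq (hne i)]
    obtain ⟨X, Y, hX, -, -, ⟨f, hf⟩, hd, hu, -⟩ := hsep i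
    obtain ⟨z, hz⟩ := hG.edgeConn E(B i) (E(G) \ E(B i)) (hne i)
      ⟨f, hu.subset (Or.inr hf), fun h => Set.disjoint_left.1 hd (hX h) hf⟩
      Set.disjoint_sdiff_right (Set.union_sdiff_cancel (hend i).1.le.edgeSet_mono)
    exact Set.eq_singleton_iff_unique_mem.2 ⟨hsub z hz ▸ hz, hsub⟩
  · refine Set.disjoint_left.2 fun e he he' => hij (hB ?_)
    exact (hend i).1.eq_of_mem (hend j).1 he he'

theorem IsBlock.nonSep_self {α β : Type*} {G K : Graph α β} (h : G.IsBlock K) : K.NonSep E(K) :=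
  (nonSep_iff_of_le h.le le_rfl).2 h.nonSep

end Graph

namespace SignedGraph

variable {α β γ κ : Type*} {Ω : SignedGraph α β} {B : κ → Graph α β} {v : κ → α}

/-- The correspondences for pinching and for 2-isomorphism are composed. Both give the first
terminal the value `0` and keep the value of the second terminal, which is what the gluing needs. -/
theorem frameEqCycle_of_pathTwoIsomorphic {H' H : κ → Graph γ β} {p' q' p q : κ → γ}
    (hB : Ω.graph.PendantBlocks B v)
    (hs : ∀ e ∈ E(Ω.graph), (∀ i, e ∉ E(B i)) → Ω.sign e = 1)
    (hH' : ∀ i, (H' i).IsPathGraph ∧ (Ω.on (B i)).IsPinch (v i) (H' i) (p' i) (q' i))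
    (hH : ∀ i, (H' i).PathTwoIsomorphic (p' i) (q' i) (H i) (p i) (q i)) :
    ∃ G : Graph (Option (α ⊕ κ × γ)) β,
      (Ω.graph.remainder B v).IsGluing v H p q G ∧ Ω.FrameEqCycle G := by
  classical
  obtain ⟨x, -⟩ := hB.connected.1
  have : Nonempty α := ⟨x⟩
  obtain ⟨o, ho⟩ := Ω.graph.exists_orientation
  have hEH' : ∀ i, E(H' i) = E(B i) := fun i => (hH' i).2.edgeSet_eq
  have hpiece : ∀ i, E(H i) = E(B i) ∧ p i ≠ q i ∧
      ∃ (oH : β → γ × γ) (c : β → ℚ), Graph.Orients oH (H i) ∧ (∀ e, c e ≠ 0) ∧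
      (∀ h : α → ℚ, ∃ g : γ → ℚ, g (p i) = 0 ∧ g (q i) = 2 * h (v i) ∧ ∀ e ∈ E(B i),
        g (oH e).1 - g (oH e).2 = c e * Ω.cobound o h e) ∧
      ∀ g : γ → ℚ, g (p i) = 0 → ∃ h : α → ℚ, g (q i) = 2 * h (v i) ∧ ∀ e ∈ E(B i),
        g (oH e).1 - g (oH e).2 = c e * Ω.cobound o h e := by
    intro i
    have hoB : Graph.Orients o (Ω.on (B i)).graph := fun e he =>
      ((hB.isBlock i).le.isLink_iff he).2 (ho e ((hB.isBlock i).le.edgeSet_mono he))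
    obtain ⟨oG, c, hoG, hc, h₁, h₂⟩ := (hH' i).2.exists_potentials
      (fun e => (hH' i).2.not_isLink (hH' i).1.1 (hB.isBlock i).nonSep_self) hoB
    obtain ⟨hEH, oH, d, hoH, hd, k₁, k₂⟩ := (hH i).exists_potentials
      (hEH' i ▸ hB.finite.subset (hB.isBlock i).le.edgeSet_mono) hoG
    rw [hEH' i] at hEH h₁ h₂ k₁ k₂
    refine ⟨hEH, ?_, oH, fun e => d e * c e, hoH, fun e => mul_ne_zero (hd e) (hc e), ?_, ?_⟩
    -- A function with value `0` at `p' i` and `1` at `q' i` has a counterpart with these values at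
    -- `p i` and `q i`, so the latter cannot coincide.
    · intro hpq
      obtain ⟨g, hg, hg', -⟩ := k₁ (fun y => if y = p' i then 0 else 1) (if_pos rfl)
      rw [if_neg (hH' i).2.2.2.1.symm, ← hpq, hg] at hg'
      exact zero_ne_one hg'
    · intro h
      obtain ⟨g', h0, hv, hg'⟩ := h₁ h
      obtain ⟨g, hg0, hgq, hg⟩ := k₁ g' h0
      exact ⟨g, hg0, hgq.trans hv, fun e he => by rw [hg e he, hg' e he, mul_assoc]; rfl⟩
    · intro g hg0
      obtain ⟨g', h0, hgq, hg⟩ := k₂ g hg0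
      obtain ⟨h, hv, hg'⟩ := h₂ g' h0
      exact ⟨h, hgq.symm.trans hv, fun e he => by rw [hg e he, hg' e he, mul_assoc]; rfl⟩
  obtain ⟨G, hG⟩ := hB.exists_isGluing (p := p) (q := q) fun i => (hpiece i).1
  exact ⟨G, hG, frameEqCycle_of_isGluing hB hs (fun i => (hpiece i).1) hG ho fun i => (hpiece i).2⟩

end SignedGraph

namespace SignedGraph

variable {α β γ κ : Type*} {Ω : SignedGraph α β} {B : κ → Graph α β} {v : κ → α} {G : Graph γ β}
  {n w : γ} {φ : α → γ} {X Y A C : Set β} {e : β} {x y z : α} {i j : κ}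

/-! ### Curlings -/

/-- The edges of `G` with the label `1` correspond to those of `Ω`, and an edge labelled `-1`, which
is in a piece `B i` and joins `v i` and `y`, say, joins in `G` the vertex `n` and `y`. -/
structure IsUncurling (Ω : SignedGraph α β) (B : κ → Graph α β) (v : κ → α) (G : Graph γ β) (n : γ)
    (φ : α → γ) : Prop where
  injOn : Set.InjOn φ V(Ω.graph)
  ne : ∀ x ∈ V(Ω.graph), φ x ≠ n
  vertexSet : V(G) = insert n (φ '' V(Ω.graph))
  edgeSet : E(G) = E(Ω.graph)
  isLink : ∀ e x y, Ω.sign e = 1 → Ω.graph.IsLink e x y → G.IsLink e (φ x) (φ y)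
  isLink_neg : ∀ i e y, e ∈ E(B i) → Ω.sign e = -1 → Ω.graph.IsLink e (v i) y → G.IsLink e n (φ y)
  inc_neg : ∀ e ∈ E(Ω.graph), Ω.sign e = -1 → ∃ i, e ∈ E(B i) ∧ Ω.graph.Inc e (v i)
  mem : ∀ i, n ∈ G.vertsOf E(B i)
  map_mem : ∀ i, φ (v i) ∈ G.vertsOf E(B i)

namespace IsUncurling

theorem inc_new_iff (h : Ω.IsUncurling B v G n φ) (he : e ∈ E(G)) : Ω.sign e = -1 ↔ G.Inc e n := by
  rw [h.edgeSet] at he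
  constructor
  · intro hs
    obtain ⟨i, hi, y, hy⟩ := h.inc_neg e he hs
    exact (h.isLink_neg i e y hi hs hy).inc_left
  · intro hn
    refine (Int.units_eq_one_or _).resolve_left fun hs => ?_
    obtain ⟨x, y, hl⟩ := Graph.exists_isLink_of_mem_edgeSet he
    rcases hn.eq_or_eq_of_isLink (h.isLink e x y hs hl) with h' | h'
    exacts [h.ne x hl.left_mem h'.symm, h.ne y hl.right_mem h'.symm]

theorem inc_of_inc (h : Ω.IsUncurling B v G n φ) (hx : x ∈ V(Ω.graph)) (hi : G.Inc e (φ x)) :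
    Ω.graph.Inc e x := by
  have he : e ∈ E(Ω.graph) := h.edgeSet ▸ hi.edge_mem
  rcases Int.units_eq_one_or (Ω.sign e) with hs | hs
  · obtain ⟨a, b, hl⟩ := Graph.exists_isLink_of_mem_edgeSet he
    rcases hi.eq_or_eq_of_isLink (h.isLink e a b hs hl) with h' | h'
    · exact h.injOn hx hl.left_mem h' ▸ hl.inc_left
    · exact h.injOn hx hl.right_mem h' ▸ hl.inc_right
  · obtain ⟨i, hei, y, hy⟩ := h.inc_neg e he hs
    rcases hi.eq_or_eq_of_isLink (h.isLink_neg i e y hei hs hy) with h' | h'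
    · exact absurd h' (h.ne x hx)
    · exact h.injOn hx hy.right_mem h' ▸ hy.inc_right

theorem mem_of_map_mem (h : Ω.IsUncurling B v G n φ) (hx : x ∈ V(Ω.graph))
    (hi : φ x ∈ G.vertsOf A) : x ∈ Ω.graph.vertsOf A :=
  hi.imp fun _ he => ⟨he.1, h.inc_of_inc hx he.2⟩

theorem inc_map (h : Ω.IsUncurling B v G n φ)
    (hi : Ω.graph.Inc e x) (hx : ∀ i, e ∈ E(B i) → x ≠ v i) : G.Inc e (φ x) := by
  rcases Int.units_eq_one_or (Ω.sign e) with hs | hs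
  · obtain ⟨y, hy⟩ := hi
    exact (h.isLink e x y hs hy).inc_left
  · obtain ⟨i, hei, y, hy⟩ := h.inc_neg e hi.edge_mem hs
    rcases hi.eq_or_eq_of_isLink hy with rfl | rfl
    · exact absurd rfl (hx i hei)
    · exact (h.isLink_neg i e _ hei hs hy).inc_right

/-- A negative edge at `v i` no longer meets `φ (v i)` in `G`, but its whole piece lies in `A` and
has another edge there. -/
theorem map_mem_of_mem (h : Ω.IsUncurling B v G n φ)
    (hA : ∀ i, (E(B i) ∩ A).Nonempty → E(B i) ⊆ A) (hx : x ∈ Ω.graph.vertsOf A) :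
    φ x ∈ G.vertsOf A := by
  obtain ⟨e, he, hex⟩ := hx
  by_cases hc : ∃ i, e ∈ E(B i) ∧ x = v i
  · obtain ⟨i, hi, rfl⟩ := hc
    exact Graph.vertsOf_mono (hA i ⟨e, hi, he⟩) (h.map_mem i)
  · push Not at hc
    exact ⟨e, he, h.inc_map hex hc⟩

/-- How a partition of the edges of a single piece looks like in `G`. -/
theorem exists_mem_of_nonSep (h : Ω.IsUncurling B v G n φ) (hB : Ω.graph.PendantBlocks B v)
    (hA : A.Nonempty) (hC : C.Nonempty) (hd : Disjoint A C) (hu : A ∪ C = E(B i)) :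
    (∃ x ∈ V(B i), x ≠ v i ∧ φ x ∈ G.vertsOf A ∩ G.vertsOf C) ∧
      ((G.vertsOf A ∩ G.vertsOf C).Subsingleton →
        (n ∈ G.vertsOf A ∨ φ (v i) ∈ G.vertsOf A) ∧ (n ∈ G.vertsOf C ∨ φ (v i) ∈ G.vertsOf C)) := by
  have hle := (hB.isBlock i).le
  have hcom : ∀ D ⊆ E(B i), ∀ x, x ≠ v i → x ∈ Ω.graph.vertsOf D → φ x ∈ G.vertsOf D := by
    rintro D hD x hx ⟨e, he, hex⟩
    refine ⟨e, he, h.inc_map hex fun j hj => ?_⟩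
    obtain rfl : i = j := by
      by_contra hij
      exact Set.disjoint_left.1 (hB.disjoint i j hij) (hD he) hj
    exact hx
  have hAB : A ⊆ E(B i) := hu ▸ Set.subset_union_left
  have hCB : C ⊆ E(B i) := hu ▸ Set.subset_union_right
  have hVB : ∀ x ∈ Ω.graph.vertsOf A, x ∈ V(B i) := fun x hx => by
    rw [← hB.vertsOf_eq]
    exact Graph.vertsOf_mono hAB hx
  have hv : ∀ D ⊆ E(B i), v i ∈ Ω.graph.vertsOf D → n ∈ G.vertsOf D ∨ φ (v i) ∈ G.vertsOf D := by
    rintro D hD ⟨e, he, hev⟩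
    rcases Int.units_eq_one_or (Ω.sign e) with hs | hs
    · obtain ⟨y, hy⟩ := hev
      exact Or.inr ⟨e, he, (h.isLink e _ y hs hy).inc_left⟩
    · exact Or.inl ⟨e, he, (h.inc_new_iff (h.edgeSet ▸ hev.edge_mem)).1 hs⟩
  obtain ⟨x, hx, y, hy, hxy⟩ := (hB.isBlock i).nonSep A C hA hC hd hu
  constructor
  · by_cases hxv : x = v i
    · have hyv : y ≠ v i := fun h => hxy (hxv.trans h.symm)
      exact ⟨y, hVB y hy.1, hyv, hcom A hAB y hyv hy.1, hcom C hCB y hyv hy.2⟩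
    · exact ⟨x, hVB x hx.1, hxv, hcom A hAB x hxv hx.1, hcom C hCB x hxv hx.2⟩
  · intro hs
    have key : v i ∈ Ω.graph.vertsOf A ∩ Ω.graph.vertsOf C := by
      by_cases hxv : x = v i
      · exact hxv ▸ hx
      by_cases hyv : y = v i
      · exact hyv ▸ hy
      refine absurd (h.injOn (hle.vertexSet_mono (hVB x hx.1)) (hle.vertexSet_mono (hVB y hy.1)) ?_) hxy
      exact hs ⟨hcom A hAB x hxv hx.1, hcom C hCB x hxv hx.2⟩
        ⟨hcom A hAB y hyv hy.1, hcom C hCB y hyv hy.2⟩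
    exact ⟨hv A hAB key.1, hv C hCB key.2⟩

theorem exists_mem_of_not_subset (h : Ω.IsUncurling B v G n φ) (hB : Ω.graph.PendantBlocks B v)
    (hd : Disjoint X Y) (hu : E(B i) ⊆ X ∪ Y) (hX : ¬ E(B i) ⊆ X) (hY : ¬ E(B i) ⊆ Y) :
    (∃ x ∈ V(B i), x ≠ v i ∧ φ x ∈ G.vertsOf X ∩ G.vertsOf Y) ∧
      ((G.vertsOf X ∩ G.vertsOf Y).Subsingleton →
        (n ∈ G.vertsOf X ∨ φ (v i) ∈ G.vertsOf X) ∧ (n ∈ G.vertsOf Y ∨ φ (v i) ∈ G.vertsOf Y)) := by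
  obtain ⟨e, he, heX⟩ := Set.not_subset.1 hX
  obtain ⟨f, hf, hfY⟩ := Set.not_subset.1 hY
  have hm := Set.inter_subset_inter (Graph.vertsOf_mono (G := G) (Set.inter_subset_right (s := E(B i)) (t := X)))
    (Graph.vertsOf_mono (G := G) (Set.inter_subset_right (s := E(B i)) (t := Y)))
  obtain ⟨⟨x, hx, hxv, hxm⟩, hs⟩ := h.exists_mem_of_nonSep hB (A := E(B i) ∩ X) (C := E(B i) ∩ Y)
    ⟨f, hf, (hu hf).resolve_right hfY⟩ ⟨e, he, (hu he).resolve_left heX⟩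
    (hd.mono Set.inter_subset_right Set.inter_subset_right)
    (by rw [← Set.inter_union_distrib_left, Set.inter_eq_left.2 hu])
  refine ⟨⟨x, hx, hxv, hm hxm⟩, fun hsub => ?_⟩
  obtain ⟨h1, h2⟩ := hs (hsub.anti hm)
  exact ⟨h1.imp (fun h => Graph.vertsOf_mono Set.inter_subset_right h)
    fun h => Graph.vertsOf_mono Set.inter_subset_right h,
    h2.imp (fun h => Graph.vertsOf_mono Set.inter_subset_right h)
    fun h => Graph.vertsOf_mono Set.inter_subset_right h⟩

theorem subset_of_inter (hd : Disjoint X Y) (hm : ∀ i, E(B i) ⊆ X ∨ E(B i) ⊆ Y) (i : κ)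
    (hi : (E(B i) ∩ X).Nonempty) : E(B i) ⊆ X := by
  obtain ⟨e, he, heX⟩ := hi
  exact (hm i).resolve_right fun h => Set.disjoint_left.1 hd heX (h he)

theorem connected (h : Ω.IsUncurling B v G n φ) (hB : Ω.graph.PendantBlocks B v) (i : κ) :
    G.Connected := by
  refine Graph.connected_of_edgeConn (fun X Y hX hY hd hu => ?_) ?_ ⟨n, h.vertexSet ▸ Or.inl rfl⟩
  · rw [h.edgeSet] at hu
    by_cases hm : ∀ i, E(B i) ⊆ X ∨ E(B i) ⊆ Y
    · obtain ⟨z, hz, hz'⟩ := hB.connected.edgeConn X Y hX hY hd hu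
      exact ⟨φ z, h.map_mem_of_mem (subset_of_inter hd hm) hz,
        h.map_mem_of_mem (subset_of_inter hd.symm fun i => (hm i).symm) hz'⟩
    · push Not at hm
      obtain ⟨j, hj⟩ := hm
      obtain ⟨⟨x, -, -, hx⟩, -⟩ := h.exists_mem_of_not_subset hB hd
        ((hB.isBlock j).le.edgeSet_mono.trans hu.superset) hj.1 hj.2
      exact ⟨_, hx⟩
  · rw [h.vertexSet, h.edgeSet]
    have hsub := fun i => (hB.isBlock i).le.edgeSet_mono
    rintro _ (rfl | ⟨x, hx, rfl⟩)
    · exact Graph.vertsOf_mono (hsub i) (h.mem i)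
    · refine h.map_mem_of_mem (fun i _ => hsub i) ?_
      rwa [hB.connected.vertsOf_eq ((hB.nonempty i).mono (hsub i))]

/-- The cut-vertex is an interior vertex of the divided piece. All other pieces lie on the side of
`n`, while `φ (v i)` lies only on the other side, so the outside of `B i` could not be connected to
`v i` in `Ω`. -/
theorem false_of_not_subset (h : Ω.IsUncurling B v G n φ) (hB : Ω.graph.PendantBlocks B v)
    (hij : i ≠ j) (hd : Disjoint X Y) (hu : X ∪ Y = E(Ω.graph))
    (hw : G.vertsOf X ∩ G.vertsOf Y = {w}) (hX : ¬ E(B i) ⊆ X) (hY : ¬ E(B i) ⊆ Y)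
    (hn : n ∈ G.vertsOf X) (hv : φ (v i) ∈ G.vertsOf Y) : False := by
  have hsub := fun i => (hB.isBlock i).le.edgeSet_mono
  have hVsub := fun i => (hB.isBlock i).le.vertexSet_mono
  obtain ⟨⟨x, hx, hxv, hxw⟩, -⟩ := h.exists_mem_of_not_subset hB hd
    ((hsub i).trans hu.superset) hX hY
  rw [hw] at hxw
  obtain rfl := hxw
  have hnY : n ∉ G.vertsOf Y := fun h' => h.ne x (hVsub i hx) (hw.subset ⟨hn, h'⟩).symm
  have hvX : φ (v i) ∉ G.vertsOf X := fun h' =>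
    hxv (h.injOn (hVsub i (hB.mem i)) (hVsub i hx) (hw.subset ⟨h', hv⟩)).symm
  -- Every other piece meets `n`, so it is not contained in `Y`. Nor is it divided, since its
  -- interior would then contain the same cut-vertex as the interior of `B i`.
  have hpieces : ∀ l, l ≠ i → E(B l) ⊆ X := by
    intro l hl
    by_contra hlX
    by_cases hlY : E(B l) ⊆ Y
    · exact hnY (Graph.vertsOf_mono hlY (h.mem l))
    · obtain ⟨⟨x', hx', hxv', hxw'⟩, -⟩ := h.exists_mem_of_not_subset hB hd
        ((hsub l).trans hu.superset) hlX hlY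
      rw [hw] at hxw'
      obtain rfl := h.injOn (hVsub l hx') (hVsub i hx) hxw'
      exact hxv (hB.eq_of_mem_of_mem hl.symm hx hx')
  have hP : X \ E(B i) ∪ (E(B i) ∪ Y) = E(Ω.graph) := by
    ext e
    have h1 : e ∈ E(Ω.graph) ↔ e ∈ X ∨ e ∈ Y := by rw [← hu]; rfl
    have h2 := @hsub i e
    simp only [Set.mem_union, Set.mem_sdiff]
    tauto
  obtain ⟨e, he⟩ := hB.nonempty j
  obtain ⟨f, hf⟩ := hB.nonempty i
  have hXi : ∀ l, (E(B l) ∩ (X \ E(B i))).Nonempty → E(B l) ⊆ X \ E(B i) := by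
    rintro l ⟨g, hg, hgX⟩
    have hl : l ≠ i := fun h => hgX.2 (h ▸ hg)
    exact fun g hg => ⟨hpieces l hl hg, fun h' => Set.disjoint_left.1 (hB.disjoint l i hl) hg h'⟩
  have heX : e ∈ X \ E(B i) := ⟨hpieces j hij.symm he, fun h' =>
    Set.disjoint_left.1 (hB.disjoint i j hij) h' he⟩
  obtain ⟨z, hz, hz'⟩ := hB.connected.edgeConn (X \ E(B i)) (E(B i) ∪ Y) ⟨e, heX⟩ ⟨f, Or.inl hf⟩
    (Set.disjoint_union_right.2 ⟨Set.disjoint_sdiff_left, hd.mono_left Set.sdiff_subset⟩) hP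
  have hzX : φ z ∈ G.vertsOf X :=
    Graph.vertsOf_mono Set.sdiff_subset (h.map_mem_of_mem hXi hz)
  have hzi : z ∈ V(B i) → z = v i := fun hzB => by
    obtain ⟨g, hg, hgz⟩ := hz
    exact hB.eq_of_mem hzB hgz hg.2
  obtain ⟨g, hg, hgz⟩ := hz'
  by_cases hgi : g ∈ E(B i)
  · have : z ∈ V(B i) := by
      rw [← hB.vertsOf_eq]
      exact ⟨g, hgi, hgz⟩
    exact hvX (hzi this ▸ hzX)
  · have hgY : g ∈ Y := hg.resolve_left hgi
    have hgl : ∀ l, g ∉ E(B l) := by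
      intro l hl
      by_cases hli : l = i
      · exact hgi (hli ▸ hl)
      · exact Set.disjoint_left.1 hd (hpieces l hli hl) hgY
    have : φ z = φ x :=
      hw.subset ⟨hzX, g, hgY, h.inc_map hgz fun l hl => absurd hl (hgl l)⟩
    obtain rfl := h.injOn hgz.vertex_mem (hVsub i hx) this
    exact hxv (hzi hx)

/-- A separation respecting all pieces gives a separation of `Ω`; both sides then contain pieces and
hence meet `n`, although the cut-vertex is an old one. If a piece is divided, its nonseparability
and `false_of_not_subset` exclude every distribution of its terminals. -/
theorem twoConnected (h : Ω.IsUncurling B v G n φ) (hB : Ω.graph.PendantBlocks B v)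
    (hend : ∀ K, Ω.graph.IsEndBlock K → ∃ i, B i = K) (hij : v i ≠ v j) : G.TwoConnected := by
  have hsub := fun i => (hB.isBlock i).le.edgeSet_mono
  have hVsub := fun i => (hB.isBlock i).le.vertexSet_mono
  have hvV : ∀ i, v i ∈ V(Ω.graph) := fun i => hVsub i (hB.mem i)
  refine ⟨h.connected hB i, ?_, ?_⟩
  · have hsubset : {n, φ (v i), φ (v j)} ⊆ V(G) := by
      rw [h.vertexSet]
      rintro _ (rfl | rfl | rfl)
      exacts [Or.inl rfl, Or.inr ⟨_, hvV i, rfl⟩, Or.inr ⟨_, hvV j, rfl⟩]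
    have hcard : ({n, φ (v i), φ (v j)} : Set γ).encard = 3 := Set.encard_eq_three.2
      ⟨_, _, _, (h.ne _ (hvV i)).symm, (h.ne _ (hvV j)).symm,
        fun h' => hij (h.injOn (hvV i) (hvV j) h'), rfl⟩
    calc (2 : ℕ∞) < 3 := by norm_num
      _ ≤ _ := hcard ▸ Set.encard_le_encard hsubset
  · rintro w ⟨X, Y, -, -, hX, hY, hd, hu, hw⟩
    rw [h.edgeSet] at hu
    by_cases hm : ∀ i, E(B i) ⊆ X ∨ E(B i) ⊆ Y
    · have hzX : ∀ z, z ∈ Ω.graph.vertsOf X → φ z ∈ G.vertsOf X := fun z hz =>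
        h.map_mem_of_mem (subset_of_inter hd hm) hz
      have hzY : ∀ z, z ∈ Ω.graph.vertsOf Y → φ z ∈ G.vertsOf Y := fun z hz =>
        h.map_mem_of_mem (subset_of_inter hd.symm fun i => (hm i).symm) hz
      have hmem : ∀ (Z : Set β) z, z ∈ Ω.graph.vertsOf Z → z ∈ V(Ω.graph) :=
        fun Z z ⟨_, _, hz⟩ => hz.vertex_mem
      obtain ⟨z, hz⟩ := hB.connected.edgeConn.exists_inter_eq_singleton hX hY hd hu
        fun a ha b hb => h.injOn (hmem X a ha.1) (hmem X b hb.1)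
          ((hw.subset ⟨hzX a ha.1, hzY a ha.2⟩).trans (hw.subset ⟨hzX b hb.1, hzY b hb.2⟩).symm)
      have hzm := hz.superset rfl
      have hzw : φ z = w := hw.subset ⟨hzX z hzm.1, hzY z hzm.2⟩
      obtain ⟨K, hK, hKY⟩ := hB.connected.exists_isEndBlock hB.finite hX hY hd hu hz
      obtain ⟨L, hL, hLX⟩ := hB.connected.exists_isEndBlock hB.finite hY hX hd.symm
        (by rwa [Set.union_comm]) (by rwa [Set.inter_comm])
      obtain ⟨a, rfl⟩ := hend K hK
      obtain ⟨b, rfl⟩ := hend L hL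
      exact h.ne z (hmem X z hzm.1) (hzw.trans (hw.subset
        ⟨Graph.vertsOf_mono hLX (h.mem b), Graph.vertsOf_mono hKY (h.mem a)⟩).symm)
    · push Not at hm
      obtain ⟨l, hlX, hlY⟩ := hm
      obtain ⟨l', hl'⟩ : ∃ l', l ≠ l' := by
        by_contra! hcon
        exact hij ((congrArg v (hcon i)).symm.trans (congrArg v (hcon j)))
      have hsing : (G.vertsOf X ∩ G.vertsOf Y).Subsingleton := by
        rw [hw]; exact Set.subsingleton_singleton
      obtain ⟨⟨x, hx, hxv, hxw⟩, hs⟩ := h.exists_mem_of_not_subset hB hd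
        ((hsub l).trans hu.superset) hlX hlY
      obtain ⟨h1 | h1, h2 | h2⟩ := hs hsing
      · exact h.ne x (hVsub l hx) (hsing hxw ⟨h1, h2⟩)
      · exact h.false_of_not_subset hB hl' hd hu hw hlX hlY h1 h2
      · exact h.false_of_not_subset hB hl' hd.symm (by rwa [Set.union_comm])
          (by rwa [Set.inter_comm]) hlY hlX h2 h1
      · exact hxv (h.injOn (hVsub l hx) (hvV l) (hsing hxw ⟨h1, h2⟩))

/-- The attachment vertices of a curling must be distinct, so all pieces with the same `v i` are
united into one subgraph. Their common vertex `n` keeps it connected. -/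
theorem isCurling [Finite κ] (h : Ω.IsUncurling B v G n φ) (hB : Ω.graph.PendantBlocks B v)
    (hend : ∀ K, Ω.graph.IsEndBlock K → ∃ i, B i = K) (hij : v i ≠ v j) : Ω.IsCurling G := by
  have hsub := fun i => (hB.isBlock i).le.edgeSet_mono
  have hVsub := fun i => (hB.isBlock i).le.vertexSet_mono
  have hvV : ∀ i, v i ∈ V(Ω.graph) := fun i => hVsub i (hB.mem i)
  refine ⟨h.twoConnected hB hend hij, n, h.vertexSet ▸ Or.inl rfl, ?_⟩
  -- The distinct values of `v` are enumerated; they serve as the vertices to which negative edges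
  -- are curled.
  obtain ⟨k, ⟨ε⟩⟩ := Finite.exists_equiv_fin (Set.range v)
  let u : Fin k → α := fun a => (ε.symm a).1
  have hu : u.Injective := Subtype.val_injective.comp ε.symm.injective
  have hur : ∀ a, ∃ i, v i = u a := fun a => (ε.symm a).2
  have hru : ∀ i, ∃ a, v i = u a := fun i => ⟨ε ⟨v i, i, rfl⟩, by simp [u]⟩
  have huV : ∀ a, u a ∈ V(Ω.graph) := fun a => by
    obtain ⟨i, hi⟩ := hur a
    exact hi ▸ hvV i
  clear_value u
  let X : Fin k → Set β := fun a => ⋃ i ∈ {i | v i = u a}, E(B i)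
  have hX : ∀ a e, e ∈ X a ↔ ∃ i, v i = u a ∧ e ∈ E(B i) := fun a e => by simp [X]
  have hXi : ∀ a i, v i = u a → E(B i) ⊆ X a := fun a i hi e he => (hX a e).2 ⟨i, hi, he⟩
  have hXE : ∀ a, X a ⊆ E(G) := fun a e he => by
    obtain ⟨i, -, hi⟩ := (hX a e).1 he
    exact h.edgeSet ▸ hsub i hi
  have huniq : ∀ i j e, e ∈ E(B i) → e ∈ E(B j) → i = j := fun i j e hi hj => by
    by_contra hij
    exact Set.disjoint_left.1 (hB.disjoint i j hij) hi hj
  have hEX : ∀ a, E(G.edgeSubgraph (X a)) = X a := fun a => Graph.edgeSet_edgeSubgraph (hXE a)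
  refine ⟨k, φ ∘ u, fun a => G.edgeSubgraph (X a), fun a b hab => hu (h.injOn (huV a) (huV b) hab),
    fun a => h.ne _ (huV a), fun a => ⟨Graph.edgeSubgraph_le, ?_, ?_⟩, fun a b hab => ?_, ?_,
    fun e he => h.inc_new_iff he, φ, ⟨?_, h.injOn, ?_⟩, h.edgeSet.symm, ?_⟩
  · obtain ⟨i, hi⟩ := hur a
    obtain ⟨e, he⟩ := hB.nonempty i
    refine Graph.connected_edgeSubgraph (hXE a) ⟨e, hXi a i hi he⟩ ?_
    intro A C hA hC hd hAC
    by_cases hm : ∀ l, v l = u a → E(B l) ⊆ A ∨ E(B l) ⊆ C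
    · have key : ∀ D ⊆ X a, D.Nonempty → (∀ l, v l = u a → (E(B l) ∩ D).Nonempty → E(B l) ⊆ D) →
          n ∈ G.vertsOf D := by
        rintro D hD ⟨f, hf⟩ hl
        obtain ⟨l, hla, hfl⟩ := (hX a f).1 (hD hf)
        exact Graph.vertsOf_mono (hl l hla ⟨f, hfl, hf⟩) (h.mem l)
      refine ⟨n, key A (hAC ▸ Set.subset_union_left) hA ?_, key C (hAC ▸ Set.subset_union_right) hC ?_⟩
      · rintro l hl ⟨f, hf, hfA⟩
        exact (hm l hl).resolve_right fun h => Set.disjoint_left.1 hd hfA (h hf)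
      · rintro l hl ⟨f, hf, hfC⟩
        exact (hm l hl).resolve_left fun h => Set.disjoint_left.1 hd (h hf) hfC
    · push Not at hm
      obtain ⟨l, hl, hlA, hlC⟩ := hm
      obtain ⟨⟨x, -, -, hx⟩, -⟩ := h.exists_mem_of_not_subset hB hd
        ((hXi a l hl).trans hAC.superset) hlA hlC
      exact ⟨_, hx⟩
  · rw [hEX]
    obtain ⟨l, hl⟩ := hur a
    obtain ⟨l', hl'⟩ : ∃ l', v l' ≠ u a := by
      by_contra! hcon
      exact hij ((hcon i).trans (hcon j).symm)
    have hl'X : E(B l') ⊆ E(G) \ X a := fun e he => ⟨h.edgeSet ▸ hsub l' he, fun he' => by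
      obtain ⟨m, hm, hem⟩ := (hX a e).1 he'
      exact hl' (huniq _ _ e he hem ▸ hm)⟩
    have hcom : ∀ z, z ∈ Ω.graph.vertsOf (X a) → z ∈ Ω.graph.vertsOf (E(G) \ X a) → z = u a := by
      rintro z ⟨e, he, hez⟩ ⟨f, hf, hfz⟩
      obtain ⟨m, hm, hem⟩ := (hX a e).1 he
      have : z ∈ V(B m) := by
        rw [← hB.vertsOf_eq]
        exact ⟨e, hem, hez⟩
      exact (hB.eq_of_mem this hfz fun h => hf.2 (hXi a m hm h)).trans hm
    refine Set.Subset.antisymm ?_ ?_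
    · rintro z ⟨hz, hz'⟩
      have hzV : z ∈ insert n (φ '' V(Ω.graph)) := by
        obtain ⟨e, -, he⟩ := hz
        exact h.vertexSet ▸ he.vertex_mem
      rcases hzV with rfl | ⟨x, hx, rfl⟩
      · exact Or.inl rfl
      · exact Or.inr (congrArg φ (hcom x (h.mem_of_map_mem hx hz) (h.mem_of_map_mem hx hz')))
    · rintro _ (rfl | rfl)
      · exact ⟨Graph.vertsOf_mono (hXi a l hl) (h.mem l), Graph.vertsOf_mono hl'X (h.mem l')⟩
      · refine ⟨Graph.vertsOf_mono (hXi a l hl) (show φ (u a) ∈ _ from hl ▸ h.map_mem l),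
          h.map_mem_of_mem (fun m hm e he => ⟨h.edgeSet ▸ hsub m he, fun he' => ?_⟩) ?_⟩
        · obtain ⟨f, hf, hfE⟩ := hm
          obtain ⟨m', hm', hem'⟩ := (hX a e).1 he'
          obtain rfl := huniq _ _ e he hem'
          exact hfE.2 (hXi a m hm' hf)
        · obtain ⟨e, he⟩ := hB.nonempty l
          obtain ⟨f, hf⟩ := hB.nonempty l'
          obtain ⟨z, hz, hz'⟩ := hB.connected.edgeConn (X a) (E(G) \ X a) ⟨e, hXi a l hl he⟩
            ⟨f, hl'X hf⟩ Set.disjoint_sdiff_right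
            ((Set.union_sdiff_cancel (hXE a)).trans h.edgeSet)
          exact hcom z hz hz' ▸ hz'
  · rw [hEX, hEX]
    refine Set.disjoint_left.2 fun e he he' => hab (hu ?_)
    obtain ⟨i, hi, hei⟩ := (hX a e).1 he
    obtain ⟨j, hj, hej⟩ := (hX b e).1 he'
    rw [← hi, ← hj, huniq i j e hei hej]
  · intro e he
    obtain ⟨i, hi, -⟩ := h.inc_neg e (h.edgeSet ▸ he.edge_mem) ((h.inc_new_iff he.edge_mem).2 he)
    obtain ⟨a, ha⟩ := hru i
    exact ⟨a, by rw [hEX]; exact hXi a i ha hi⟩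
  · intro x hx
    exact ⟨h.vertexSet ▸ Or.inr ⟨x, hx, rfl⟩, h.ne x hx⟩
  · rintro y ⟨hy, hyn⟩
    rw [h.vertexSet] at hy
    exact hy.resolve_left hyn
  · intro e x hx y hy
    constructor
    · intro hl
      rcases Int.units_eq_one_or (Ω.sign e) with hs | hs
      · exact Or.inl (h.isLink e x y hs hl)
      · right
        obtain ⟨i, hi, hiv⟩ := h.inc_neg e hl.edge_mem hs
        obtain ⟨a, ha⟩ := hru i
        refine ⟨a, by rw [hEX]; exact hXi a i ha hi, ?_⟩
        rcases hiv.eq_or_eq_of_isLink hl with h' | h'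
        · exact Or.inr ⟨h.isLink_neg i e y hi hs (h' ▸ hl), congrArg φ (h'.symm.trans ha)⟩
        · exact Or.inl ⟨h.isLink_neg i e x hi hs (h' ▸ hl.symm), congrArg φ (h'.symm.trans ha)⟩
    · have key : ∀ a x y, x ∈ V(Ω.graph) → y ∈ V(Ω.graph) → e ∈ X a → G.IsLink e n (φ x) →
          φ y = φ (u a) → Ω.graph.IsLink e x y := by
        intro a x y hx hy he hl hya
        obtain rfl := h.injOn hy (huV a) hya
        have hs := (h.inc_new_iff hl.edge_mem).2 hl.inc_left
        obtain ⟨i, hi, z, hz⟩ := h.inc_neg e (h.edgeSet ▸ hl.edge_mem) hs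
        obtain ⟨j, hj, hej⟩ := (hX a e).1 he
        obtain rfl := huniq _ _ e hi hej
        rcases hl.eq_and_eq_or_eq_and_eq (h.isLink_neg i e z hi hs hz) with ⟨-, h'⟩ | ⟨h', -⟩
        · obtain rfl := h.injOn hx hz.right_mem h'
          exact hj ▸ hz.symm
        · exact absurd h'.symm (h.ne z hz.right_mem)
      rintro (hl | ⟨a, he, ⟨hl, hy'⟩ | ⟨hl, hx'⟩⟩)
      · have heE : e ∈ E(Ω.graph) := h.edgeSet ▸ hl.edge_mem
        have hs : Ω.sign e = 1 := (Int.units_eq_one_or _).resolve_right fun hs => by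
          rcases ((h.inc_new_iff hl.edge_mem).1 hs).eq_or_eq_of_isLink hl with h' | h'
          exacts [h.ne x hx h'.symm, h.ne y hy h'.symm]
        obtain ⟨a, b, hab⟩ := Graph.exists_isLink_of_mem_edgeSet heE
        rcases hl.eq_and_eq_or_eq_and_eq (h.isLink e a b hs hab) with ⟨h1, h2⟩ | ⟨h1, h2⟩
        · rwa [h.injOn hx hab.left_mem h1, h.injOn hy hab.right_mem h2]
        · rw [h.injOn hx hab.right_mem h1, h.injOn hy hab.left_mem h2]
          exact hab.symm
      · rw [hEX] at he
        exact key a x y hx hy he hl hy'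
      · rw [hEX] at he
        exact (key a y x hy hx he hl hx').symm

end IsUncurling

end SignedGraph

/-! ### The gluing of unpinched blocks as an uncurling -/

namespace SignedGraph

variable {α β γ κ : Type*} {Ω : SignedGraph α β} {B : κ → Graph α β} {v : κ → α}
  {H : κ → Graph γ β} {p q : κ → γ} {G : Graph (Option (α ⊕ κ × γ)) β}

/-- Old vertices outside the pieces keep their names, and a vertex of `B i` is sent to its preimage
in `H i` other than `p i`. In particular `v i` goes to `q i`, while `p i` is represented by the new
vertex. -/
theorem exists_isUncurling (hB : Ω.graph.PendantBlocks B v)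
    (hs : ∀ e ∈ E(Ω.graph), Ω.sign e = -1 → ∃ i, e ∈ E(B i) ∧ Ω.graph.Inc e (v i))
    (hH : ∀ i, (H i).IsPathGraph ∧ (Ω.on (B i)).IsPinch (v i) (H i) (p i) (q i))
    (hG : (Ω.graph.remainder B v).IsGluing v H p q G) :
    ∃ φ, Ω.IsUncurling B v G none φ := by
  classical
  have hEH : ∀ i, E(H i) = E(B i) := fun i => (hH i).2.edgeSet_eq
  have hEG := hB.edgeSet_gluing hEH hG
  have hloop : ∀ i e, ¬ (H i).IsLink e (p i) (p i) := fun i e =>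
    (hH i).2.not_isLink (hH i).1.1 (hB.isBlock i).nonSep_self
  have hp := fun i => (hH i).2.1
  have hq := fun i => (hH i).2.2.1
  have hpq := fun i => (hH i).2.2.2.1
  have hsign := fun i => (hH i).2.2.2.2.2
  choose f hfp hfq hinj hf using fun i => (hH i).2.2.2.2.1
  replace hf : ∀ i, B i = (H i).map (f i) := hf
  replace hsign : ∀ i, ∀ e ∈ E(H i), Ω.sign e = -1 ↔ (H i).Inc e (p i) := hsign
  have hle := fun i => (hB.isBlock i).le
  have hVH : ∀ i y, y ∈ V(H i) → f i y ∈ V(B i) := fun i y hy => by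
    rw [hf i, Graph.vertexSet_map]
    exact ⟨y, hy, rfl⟩
  have : ∀ i x, ∃ y, x ∈ V(B i) → y ∈ V(H i) ∧ y ≠ p i ∧ f i y = x := by
    intro i x
    by_cases hx : x ∈ V(B i)
    · have hx' := hx
      rw [hf i, Graph.vertexSet_map] at hx'
      obtain ⟨y, hy, rfl⟩ := hx'
      by_cases hyp : y = p i
      · exact ⟨q i, fun _ => ⟨hq i, (hpq i).symm, by rw [hyp, hfp, hfq]⟩⟩
      · exact ⟨y, fun _ => ⟨hy, hyp, rfl⟩⟩
    · exact ⟨p i, fun h => absurd h hx⟩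
  choose g hg using this
  have hgf : ∀ i y, y ∈ V(H i) → y ≠ p i → g i (f i y) = y := fun i y hy hyp => by
    obtain ⟨h1, h2, h3⟩ := hg i (f i y) (hVH i y hy)
    exact hinj i ⟨h1, h2⟩ ⟨hy, hyp⟩ h3
  have hgv : ∀ i, g i (v i) = q i := fun i => by
    rw [← hfq i]
    exact hgf i (q i) (hq i) (hpq i).symm
  have hgv' : ∀ i x, x = v i → g i x = q i := fun i x hx => hx ▸ hgv i
  let φ : α → Option (α ⊕ κ × γ) := fun x =>
    if h : ∃ i, x ∈ V(B i) then Graph.glueVertex v p q h.choose (g h.choose x)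
    else some (Sum.inl x)
  have hφ : ∀ i x, x ∈ V(B i) → φ x = Graph.glueVertex v p q i (g i x) := by
    intro i x hx
    have h : ∃ i, x ∈ V(B i) := ⟨i, hx⟩
    simp only [φ, dif_pos h]
    -- A vertex in two blocks is the attachment vertex of both, where the two gluings give the same
    -- name.
    by_cases hij : i = h.choose
    · rw [← hij]
    · have h1 := hB.eq_of_mem_of_mem hij hx h.choose_spec
      have h2 := hB.eq_of_mem_of_mem (Ne.symm hij) h.choose_spec hx
      have h3 := hgv' _ _ h2
      have h4 := hgv' _ _ h1
      rw [h3, h4, Graph.glueVertex_right (hpq _), Graph.glueVertex_right (hpq _), ← h1, ← h2]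
  have hφ' : ∀ x, (∀ i, x ∈ V(B i) → x = v i) → φ x = some (Sum.inl x) := by
    intro x hx
    by_cases h : ∃ i, x ∈ V(B i)
    · obtain ⟨i, hi⟩ := h
      rw [hφ i x hi, hx i hi, hgv, Graph.glueVertex_right (hpq i)]
    · simp only [φ, dif_neg h]
  -- `F` pinches the glued graph back. It is a left inverse of `φ`, which yields both injectivity
  -- and the fact that `φ` misses `none`.
  let F : Option (α ⊕ κ × γ) → Option α := fun u =>
    u.map (Sum.elim id fun iy => f iy.1 iy.2)
  have hF : ∀ i y, y ≠ p i → F (Graph.glueVertex v p q i y) = some (f i y) := by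
    intro i y hy
    by_cases hyq : y = q i
    · rw [hyq, Graph.glueVertex_right (hpq i), hfq]; rfl
    · rw [Graph.glueVertex_of_ne hy hyq]; rfl
  have hFφ : ∀ x, F (φ x) = some x := by
    intro x
    by_cases h : ∃ i, x ∈ V(B i)
    · obtain ⟨i, hi⟩ := h
      obtain ⟨-, h2, h3⟩ := hg i x hi
      rw [hφ i x hi, hF i _ h2, h3]
    · rw [hφ' x fun i hi => absurd ⟨i, hi⟩ h]; rfl
  have hφf : ∀ i y, y ∈ V(H i) → y ≠ p i → φ (f i y) = Graph.glueVertex v p q i y :=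
    fun i y hy hyp => by rw [hφ i _ (hVH i y hy), hgf i y hy hyp]
  have hlink : ∀ i e a b, (H i).IsLink e a b →
      G.IsLink e (Graph.glueVertex v p q i a) (Graph.glueVertex v p q i b) :=
    fun i e a b h => (hG.2 _ _ _).2 (Or.inr ⟨i, a, b, h, rfl, rfl⟩)
  have hHv : ∀ i y, y ∈ V(H i) → Graph.glueVertex v p q i y ∈ G.vertsOf E(B i) := by
    intro i y hy
    rw [← (hH i).1.1.vertsOf_eq (hEH i ▸ hB.nonempty i)] at hy
    obtain ⟨e, he, b, hb⟩ := hy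
    exact ⟨e, hEH i ▸ he, (hlink i e y b hb).inc_left⟩
  refine ⟨φ, fun x _ y _ h => ?_, fun x _ h => ?_, ?_, hEG, fun e x y h1 hl => ?_,
    fun i e y he h1 hl => ?_, hs, fun i => ?_, fun i => ?_⟩
  · have := hFφ x
    rw [h, hFφ] at this
    exact (Option.some.inj this).symm
  · have := hFφ x
    rw [h] at this
    exact Option.some_ne_none _ this.symm
  · rw [hG.1, Graph.remainder]
    ext u
    simp only [Graph.vertexSet_deleteVerts, Graph.vertexSet_deleteEdges, Set.mem_union,
      Set.mem_singleton_iff, Set.mem_image, Set.mem_sdiff, Set.mem_iUnion, Set.mem_insert_iff]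
    constructor
    · rintro ((h | ⟨x, ⟨hx, hxB⟩, rfl⟩) | ⟨i, y, hy, rfl⟩)
      · exact Or.inl h
      · exact Or.inr ⟨x, hx, hφ' x fun i hi => by_contra fun hne => hxB ⟨i, hi, hne⟩⟩
      · by_cases hyp : y = p i
        · exact Or.inl (by rw [hyp, Graph.glueVertex_left])
        · exact Or.inr ⟨f i y, (hle i).vertexSet_mono (hVH i y hy), hφf i y hy hyp⟩
    · rintro (h | ⟨x, hx, rfl⟩)
      · exact Or.inl (Or.inl h)
      · by_cases h : ∃ i, x ∈ V(B i)
        · obtain ⟨i, hi⟩ := h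
          exact Or.inr ⟨i, g i x, (hg i x hi).1, (hφ i x hi).symm⟩
        · exact Or.inl (Or.inr ⟨x, ⟨hx, fun ⟨i, hi, _⟩ => h ⟨i, hi⟩⟩,
            (hφ' x fun i hi => absurd ⟨i, hi⟩ h).symm⟩)
  · by_cases hi : ∃ i, e ∈ E(B i)
    · obtain ⟨i, hi⟩ := hi
      have hl' := ((hle i).isLink_iff hi).2 hl
      rw [hf i, Graph.map_isLink] at hl'
      obtain ⟨a, b, hab, rfl, rfl⟩ := hl'
      have hne : ¬ (H i).Inc e (p i) := fun h => by
        have := (hsign i e hab.edge_mem).2 h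
        rw [h1] at this
        exact absurd this (by decide)
      rw [hφf i a hab.left_mem fun h => hne (h ▸ hab.inc_left),
        hφf i b hab.right_mem fun h => hne (h ▸ hab.inc_right)]
      exact hlink i e a b hab
    · push Not at hi
      rw [hφ' x fun i hx => hB.eq_of_mem hx hl.inc_left (hi i),
        hφ' y fun i hy => hB.eq_of_mem hy hl.inc_right (hi i)]
      exact (hG.2 _ _ _).2 (Or.inl ⟨x, y, hB.remainder_isLink.2 ⟨hl, hi⟩, rfl, rfl⟩)
  · obtain ⟨b, hb⟩ := (hsign i e (hEH i ▸ he)).1 h1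
    have hbp : b ≠ p i := fun h => hloop i e (h ▸ hb)
    have hl' : (B i).IsLink e (v i) (f i b) := by
      rw [hf i, ← hfp i]
      exact hb.map (f i)
    have hy : y = f i b := Graph.IsLink.right_unique hl (hl'.mono (hle i))
    rw [hy, hφf i b hb.right_mem hbp, ← Graph.glueVertex_left (v := v) (p := p) (q := q) (i := i)]
    exact hlink i e _ b hb
  · rw [← Graph.glueVertex_left (v := v) (p := p) (q := q) (i := i)]
    exact hHv i _ (hp i)
  · rw [hφ i _ (hB.mem i), hgv]
    exact hHv i _ (hq i)

end SignedGraph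

/-! ### The lemma -/

theorem mainTheorem5 {α β γ : Type*} [Infinite γ] (Ω : SignedGraph α β)
    (hV : V(Ω.graph).Finite) (hE : E(Ω.graph).Finite) (hconn : Ω.graph.Connected)
    (hblock : ∀ K, Ω.graph.IsBlock K → (¬ (Ω.on K).IsBalanced ↔ Ω.graph.IsEndBlock K))
    {k : ℕ} (B : Fin k → Graph α β) (hB : B.Injective)
    (hBend : ∀ K, Ω.graph.IsEndBlock K ↔ ∃ i, B i = K)
    (v : Fin k → α) (hv : ∀ i, v i ∈ V(B i))
    (hvbal : ∀ i, (Ω.on ((B i).deleteVerts {v i})).IsBalanced)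
    (hvsep : ∀ i, Ω.graph.Separates (v i) E(B i) (⋃ j ∈ {j | j ≠ i}, E(B j))) :
    (∃ δ : α → ℤˣ, ∀ e ∈ E(Ω.graph), (Ω.switch δ).sign e = -1 →
      ∃ i, e ∈ E(B i) ∧ Ω.graph.Inc e (v i)) ∧
    ∀ δ : α → ℤˣ,
      (∀ e ∈ E(Ω.graph), (Ω.switch δ).sign e = -1 →
        ∃ i, e ∈ E(B i) ∧ Ω.graph.Inc e (v i)) →
      (∀ i, ∃ (H' : Graph γ β) (p' q' : γ), H'.IsPathGraph ∧
        ((Ω.switch δ).on (B i)).IsPinch (v i) H' p' q' ∧ (Ω.on (B i)).FrameEqCycle H') ∧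
      ∀ (H' : Fin k → Graph γ β) (p' q' : Fin k → γ),
        (∀ i, (H' i).IsPathGraph ∧
          ((Ω.switch δ).on (B i)).IsPinch (v i) (H' i) (p' i) (q' i)) →
        (∀ (H : Fin k → Graph γ β) (p q : Fin k → γ),
          (∀ i, (H' i).PathTwoIsomorphic (p' i) (q' i) (H i) (p i) (q i)) →
          ∃ G : Graph (Option (α ⊕ Fin k × γ)) β,
            (Ω.graph.remainder B v).IsGluing v H p q G ∧ Ω.FrameEqCycle G) ∧
        ((∃ i j, v i ≠ v j) →
          ∃ G : Graph (Option (α ⊕ Fin k × γ)) β,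
            (Ω.graph.remainder B v).IsGluing v H' p' q' G ∧ (Ω.switch δ).IsCurling G) := by

  have hPB := Graph.pendantBlocks_of_separates hconn hE hB (fun i => (hBend _).2 ⟨i, rfl⟩) hv hvsep
  refine ⟨SignedGraph.exists_switch_of_pendantBlocks hE hblock hBend hvbal, fun δ hδ => ?_⟩
  have hPB' : (Ω.switch δ).graph.PendantBlocks B v := hPB
  have hle : ∀ i, B i ≤ Ω.graph := fun i => (hPB.isBlock i).le
  -- Switching preserves the balance of cycles, so each end-block stays unbalanced and both halves
  -- of its split vertex will have edges.
  have hbal : ∀ i, ¬ ((Ω.switch δ).on (B i)).IsBalanced := fun i h =>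
    (hblock _ (hPB.isBlock i)).2 ((hBend _).2 ⟨i, rfl⟩) fun C hC => by
      rw [← SignedGraph.switch_on_balancedCycles (hle i)]
      exact h C hC
  have hneg : ∀ i, ∀ e ∈ E(B i), (Ω.switch δ).sign e = -1 → (B i).Inc e (v i) := by
    intro i e he hs
    obtain ⟨j, hj, hjv⟩ := hδ e ((hle i).edgeSet_mono he) hs
    obtain rfl : i = j := by
      by_contra hij
      exact Set.disjoint_left.1 (hPB.disjoint i j hij) he hj
    exact ((hle i).inc_congr he).2 hjv
  refine ⟨fun i => ?_, fun H' p' q' hH' => ⟨fun H p q hH => ?_, fun hne => ?_⟩⟩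
  · obtain ⟨H, p, q, hH, hpinch⟩ := SignedGraph.exists_isPinch (γ := γ)
      (Ω := (Ω.switch δ).on (B i)) (hV.subset (hle i).vertexSet_mono)
      (hE.subset (hle i).edgeSet_mono) (hPB.isBlock i).connected (hPB.isBlock i).nonSep_self (hv i)
      (hneg i) (hbal i)
    obtain ⟨M, hM, hM'⟩ := hpinch.frameEqCycle
      (fun e => hpinch.not_isLink hH.1 (hPB.isBlock i).nonSep_self)
      (hE.subset (hle i).edgeSet_mono)
    rw [SignedGraph.switch_on_balancedCycles (hle i)] at hM
    exact ⟨H, p, q, hH, hpinch, M, hM, hM'⟩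
  · obtain ⟨G, hG, M, hM, hM'⟩ := SignedGraph.frameEqCycle_of_pathTwoIsomorphic hPB'
      (fun e he hi => (Int.units_eq_one_or _).resolve_right fun h => by
        obtain ⟨i, hei, -⟩ := hδ e he h
        exact hi i hei) hH' hH
    rw [SignedGraph.switch_balancedCycles] at hM
    exact ⟨G, hG, M, hM, hM'⟩
  · obtain ⟨i, j, hij⟩ := hne
    obtain ⟨G, hG⟩ := hPB.exists_isGluing (p := p') (q := q') fun i => (hH' i).2.edgeSet_eq
    obtain ⟨φ, hφ⟩ := SignedGraph.exists_isUncurling hPB' hδ hH' hG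
    exact ⟨G, hG, hφ.isCurling hPB' (fun K hK => (hBend K).1 hK) hij⟩
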